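/- Let $\lambda_r,\lambda_P,m,a>0$. Road-side units (RSUs) form a homogeneous Poisson point process on $\mathbb{R}$ of density $\lambda_r$, and every vehicle is served by its nearest RSU, so that an RSU serves the vehicles in its Voronoi cell. Independently of the RSUs, the vehicles form a one-dimensional Matérn cluster process $\Phi_m$ (platooned traffic scenario, PTS): platoon centres form a homogeneous Poisson point process of density $\lambda_P$, and, independently for each platoon, the number of its vehicles is Poisson with mean $m$ and the vehicles are placed independently and uniformly within distance $a$ of the centre. Consider the typical vehicle, i.e. the Palm distribution of $\Phi_m$: the law of a quantity $F$ seen from the typical vehicle is $A\mapsto \frac{1}{m\lambda_P|W|}\,\mathbb{E}\sum_{y\in\Phi_m\cap W}\mathbf 1(F(y)\in A)$, for any bounded Borel set $W\subset\mathbb{R}$ of positive length. The tagged RSU is the RSU that serves the typical vehicle, the tagged cell is its Voronoi cell, with length $L_o$, the tagged platoon is the platoon of the typical vehicle, and the tagged load $\widetilde S_P$ is the number of vehicles other than the typical one that the tagged RSU serves. For $r>0$ let $\mathcal P_{S(r)}(s)$ be the probability generating function (PGF) of the number $S(r)$ of points of $\Phi_m$ in $[-r,r]$, and let $\mathcal P_{V_m(r)}(s)$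 be the PGF of the number $V_m(r)$ of vehicles of one platoon with centre $x_0$ that lie in $[c-r,c+r]$, where $x_0$ is uniform on $[-a,a]$ and $c$ is uniform on $[-r,r]$, independently of each other and of the number and displacements of the vehicles. Then $\widetilde S_P$ has a probability law, and its PGF is, for $|s|\le 1$, $$\mathcal P_{\widetilde S_P}(s)=\int_0^\infty \mathcal P_{S(t/2)}(s)\,\mathcal P_{V_m(t/2)}(s)\,f_{L_o}(t)\,dt,\qquad f_{L_o}(t)=4\lambda_r^3t^2e^{-2\lambda_r t}.$$ Here $f_{L_o}$ is the probability density of $L_o$. Almost surely, the load of each vehicle is the sum of the load due to the other platoons and the load due to its own platoon. Given $L_o=t$, these two contributions to the tagged load are independent and have PGFs $\mathcal P_{S(t/2)}$ and $\mathcal P_{V_m(t/2)}$, that is, for all Borel $A\subset\mathbb{R}$ and $|u|,|v|\le1$, the expectation of $\mathbf 1(L_o\in A)\,u^{S}v^{V}$ for the typical vehicle, with $S$ and $V$ the two contributions, equals $\int_{A\cap(0,\infty)}\mathcal P_{S(t/2)}(u)\,\mathcal P_{V_m(t/2)}(v)\,f_{L_o}(t)\,dt$. -/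

import Mathlib

open MeasureTheory ProbabilityTheory

/-- The (random) points `X 0, X 1, …` form a homogeneous Poisson point process on the real line
with density `lam`: the numbers of points in disjoint bounded Borel sets are independent, and the
number of points in `B` is Poisson distributed with mean `lam` times the length of `B`. -/
structure IsPoissonProcess {Ω : Type*} [MeasurableSpace Ω] (P : Measure Ω) (lam : ℝ)
    (X : ℕ → Ω → ℝ) : Prop where
  measurable : ∀ i, Measurable (X i)
  counts : ∀ (n : ℕ) (B : Fin n → Set ℝ), (∀ j, MeasurableSet (B j)) →
    (∀ j, Bornology.IsBounded (B j)) → Pairwise (fun j k => Disjoint (B j) (B k)) →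
    ∀ k : Fin n → ℕ,
      P {ω | ∀ j, {i | X i ω ∈ B j}.encard = k j} =
        ∏ j, poissonMeasure (lam * volume.real (B j)).toNNReal {k j}

/-- The random elements of a highway: the positions of the road-side units (RSUs), the positions
of the platoon centres, the number of vehicles of each platoon, and the displacements of the
vehicles of each platoon from its centre. -/
structure Highway (Ω : Type*) where
  rsu : ℕ → Ω → ℝ
  parent : ℕ → Ω → ℝ
  size : ℕ → Ω → ℕ
  disp : ℕ → ℕ → Ω → ℝ

namespace Highway

variable {Ω : Type*}

/-- The platooned traffic scenario: the RSUs form a Poisson process of density `lamR`, the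
vehicles form an independent Matérn cluster process: the platoon centres are a Poisson process of
density `lamP`, and independently each platoon has a Poisson number of vehicles with mean `m`,
placed independently and uniformly within distance `a` of the centre. -/
structure IsPlatooned [MeasurableSpace Ω] (H : Highway Ω) (P : Measure Ω)
    (lamR lamP m a : ℝ) : Prop where
  rsu_poisson : IsPoissonProcess P lamR H.rsu
  parent_poisson : IsPoissonProcess P lamP H.parent
  measurable_size : ∀ i, Measurable (H.size i)
  measurable_disp : ∀ i j, Measurable (H.disp i j)
  size_law : ∀ i, P.map (H.size i) = poissonMeasure m.toNNReal
  disp_law : ∀ i j, pdf.IsUniform (H.disp i j) (Set.Icc (-a) a) P volume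
  /- the sizes are mutually independent, and so are the displacements -/
  indep_size : iIndepFun H.size P
  indep_disp : iIndepFun (fun (p : ℕ × ℕ) => H.disp p.1 p.2) P
  /- the four families are mutually independent -/
  indep_rsu_parent : IndepFun (fun ω i => H.rsu i ω) (fun ω i => H.parent i ω) P
  indep_points_size : IndepFun (fun ω => (fun i => H.rsu i ω, fun i => H.parent i ω))
    (fun ω i => H.size i ω) P
  indep_points_size_disp :
    IndepFun (fun ω => (fun i => H.rsu i ω, fun i => H.parent i ω, fun i => H.size i ω))
      (fun ω (p : ℕ × ℕ) => H.disp p.1 p.2 ω) P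

variable (H : Highway Ω)

/-- The indices of the vehicles present: `(i, j)` is the `j`-th vehicle of the `i`-th platoon. -/
def vehicles (ω : Ω) : Set (ℕ × ℕ) := {p | p.2 < H.size p.1 ω}

/-- The position of a vehicle. -/
def pos (p : ℕ × ℕ) (ω : Ω) : ℝ := H.parent p.1 ω + H.disp p.1 p.2 ω

/-- The Voronoi cell of the `i`-th RSU. -/
def cell (i : ℕ) (ω : Ω) : Set ℝ := {x | ∀ j, |x - H.rsu i ω| ≤ |x - H.rsu j ω|}

/-- The cell of the RSU that serves the location `y` (almost surely there is exactly one). -/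
def servingCell (y : ℝ) (ω : Ω) : Set ℝ := ⋃ i ∈ {i | y ∈ H.cell i ω}, H.cell i ω

/-- The cell of the RSU serving the vehicle `p`. -/
def taggedCell (p : ℕ × ℕ) (ω : Ω) : Set ℝ := H.servingCell (H.pos p ω) ω

/-- The length of the cell of the RSU serving the vehicle `p`. -/
noncomputable def taggedLength (p : ℕ × ℕ) (ω : Ω) : ℝ := volume.real (H.taggedCell p ω)

/-- The number of vehicles other than `p` served by the RSU serving `p`. -/
noncomputable def taggedLoad (p : ℕ × ℕ) (ω : Ω) : ℕ :=
  {q | q ∈ H.vehicles ω ∧ q ≠ p ∧ H.pos q ω ∈ H.taggedCell p ω}.ncard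

/-- The number of vehicles of the other platoons served by the RSU serving `p`. -/
noncomputable def otherPlatoonsLoad (p : ℕ × ℕ) (ω : Ω) : ℕ :=
  {q | q ∈ H.vehicles ω ∧ q.1 ≠ p.1 ∧ H.pos q ω ∈ H.taggedCell p ω}.ncard

/-- The number of vehicles other than `p`, of the platoon of `p`, served by the RSU serving
`p`. -/
noncomputable def ownPlatoonLoad (p : ℕ × ℕ) (ω : Ω) : ℕ :=
  {q | q ∈ H.vehicles ω ∧ q.1 = p.1 ∧ q ≠ p ∧ H.pos q ω ∈ H.taggedCell p ω}.ncard

variable [MeasurableSpace Ω]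

/-- The law of a quantity `F` as seen from the typical vehicle, that is, its law under the Palm
distribution of the vehicle process, whose density is `lam`: for a window `W`,
`(lam * |W|)⁻¹ * E ∑ 𝟙 (F p ∈ A)`, the sum running over the vehicles `p` located in `W`. -/
noncomputable def palmLaw {β : Type*} [MeasurableSpace β] (P : Measure Ω) (lam : ℝ) (W : Set ℝ)
    (F : ℕ × ℕ → Ω → β) : Measure β :=
  (ENNReal.ofReal lam * volume W)⁻¹ •
    Measure.sum fun p : ℕ × ℕ =>
      (P.restrict {ω | p ∈ H.vehicles ω ∧ H.pos p ω ∈ W}).map (F p)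

/-- The probability generating function of `S(r)`, the number of vehicles in the ball of
radius `r` around the origin. -/
noncomputable def pgfS (P : Measure Ω) (r s : ℝ) : ℝ :=
  ∫ ω, s ^ {q | q ∈ H.vehicles ω ∧ H.pos q ω ∈ Metric.closedBall 0 r}.ncard ∂P

/-- The probability generating function of `V(r)`, the number of vehicles of a platoon in an
interval of length `2 * r`, when the platoon centre `x` is uniform on `[-a, a]` and,
independently, the centre `c` of the interval is uniform on `[-r, r]`. -/
noncomputable def pgfV (P : Measure Ω) (a r s : ℝ) : ℝ :=
  (2 * a)⁻¹ * ∫ x in (-a)..a, (2 * r)⁻¹ * ∫ c in (-r)..r,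
    ∫ ω, s ^ {j | j < H.size 0 ω ∧ x + H.disp 0 j ω ∈ Metric.closedBall c r}.ncard ∂P

end Highway

/-- The density of the length of the tagged cell. -/
noncomputable def taggedLengthDensity (lamR t : ℝ) : ℝ :=
  4 * lamR ^ 3 * t ^ 2 * Real.exp (-2 * lamR * t)

/-! The Palm law is a sum over vehicles, and almost surely each vehicle lies in the cell of exactly
one RSU (`ae_existsUnique_cell`), so the sum may be taken cell by cell. RSUs and vehicles are
independent, hence the RSUs can be frozen: a cell becomes a fixed bounded interval `I`, and each
vehicle in `W ∩ I` is recorded with the loads in `I`.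

For fixed `I`, the Mecke equation of the platoon centres (`mecke`, with marks
`lintegral_mecke_marks`) says that, seen from one platoon, the others form an undisturbed copy of
the whole vehicle process. Within the platoon, size biasing a Poisson number and removing one
vehicle gives back the same Poisson law (`lintegral_mul_pred_poissonMeasure`). Since displacements
are exchangeable, the companions of a vehicle form a full platoon whose centre is uniformly
displaced from it (`tsum_lintegral_mateCount`). So the two loads are independent given the cell
(`tsum_lintegral_vehicles`), and by stationarity the first depends on the length of `I` only.

It remains to average over the cells. The Mecke equation of the RSUs gives the two gaps at the
typical RSU; its cell covers half of each, hence extends by independent exponential lengths of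
parameter `2 λ_r` (`sum_map_reach`). Integrating out the RSU position, the distances `b`, `c` from a
location to the ends of its cell have joint density `4 λ_r³ (b + c) exp(-2 λ_r (b + c))`
(`tsum_lintegral_voronoiCell`). This depends on `t = b + c` only: given `t`, the cell centre is
uniform on `[-t/2, t/2]` around the vehicle, as in `pgfV`, and integrating over its position
contributes another factor `t`, which gives the length density. The joint law is `palmLaw_triple`;
the distributional claims follow from it, together with the almost sure splitting of the load.

The Mecke equation itself is derived from counts in disjoint bounded sets. For a step function a
product over the points is a product of powers of independent Poisson counts, and the Chen-Stein
identity applies; monotone limits give measurable functions. Comparing power series in `u`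
(`eq_of_tsum_mul_pow_eq`) passes from products to laws of counts. -/

open scoped ENNReal NNReal Topology
open Filter

set_option linter.unusedSectionVars false

/-! ### Measurability of random counts. -/

section Counting

variable {α ι : Type*} [MeasurableSpace α]

lemma measurable_encard_setOf [Countable ι] {p : ι → α → Prop}
    (hp : ∀ i, MeasurableSet {x | p i x}) : Measurable fun x => {i | p i x}.encard :=
  measurable_encard.comp (measurable_set_iff.2 fun i => measurableSet_setOfPred.1 (hp i))

lemma measurable_ncard_setOf [Countable ι] {p : ι → α → Prop}
    (hp : ∀ i, MeasurableSet {x | p i x}) : Measurable fun x => {i | p i x}.ncard :=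
  measurable_ncard.comp (measurable_set_iff.2 fun i => measurableSet_setOfPred.1 (hp i))

end Counting

/-! ### Uniqueness of generating functions. -/

section PowerSeries

lemma tsum_mul_pow_split (a : ℕ → ℝ≥0∞) (N : ℕ) (u : ℝ≥0∞) :
    ∑' n, a n * u ^ n =
      (∑ n ∈ Finset.range N, a n * u ^ n) + u ^ N * ∑' n, a (n + N) * u ^ n := by
  rw [← ENNReal.summable.sum_add_tsum_nat_add' (f := fun n => a n * u ^ n) (k := N),
    ← ENNReal.tsum_mul_left]
  congr 2
  ext n
  rw [pow_add]
  ring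

/-- The coefficients of a power series with summable nonnegative coefficients are determined by
its values on the unit interval. -/
lemma eq_of_tsum_mul_pow_eq {a b : ℕ → ℝ≥0∞} (ha : ∑' n, a n ≠ ∞) (hb : ∑' n, b n ≠ ∞)
    (h : ∀ u : ℝ≥0∞, u ≤ 1 → ∑' n, a n * u ^ n = ∑' n, b n * u ^ n) : a = b := by
  -- By symmetry one inequality is enough. Once the coefficients below `N` are cancelled and `u ^ N`
  -- is divided out, only the `N`-th ones survive as `u` tends to `0`.
  have aux : ∀ {a b : ℕ → ℝ≥0∞} (_ : ∑' n, a n ≠ ∞) (_ : ∑' n, b n ≠ ∞)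
      (_ : ∀ u : ℝ≥0∞, u ≤ 1 → ∑' n, a n * u ^ n = ∑' n, b n * u ^ n) (N : ℕ)
      (_ : ∀ n < N, a n = b n), a N ≤ b N := by
    intro a b ha hb h N hN
    have key : ∀ u : ℝ≥0∞, 0 < u → u ≤ 1 → a N ≤ b N + u * ∑' n, b n := by
      intro u hu0 hu
      have h1 := h u hu
      rw [tsum_mul_pow_split a N, tsum_mul_pow_split b N,
        Finset.sum_congr rfl fun n hn => by rw [hN n (Finset.mem_range.1 hn)]] at h1
      have hfin : ∑ n ∈ Finset.range N, b n * u ^ n ≠ ∞ := by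
        refine ENNReal.sum_ne_top.2 fun n _ => ENNReal.mul_ne_top ?_ ?_
        · exact ENNReal.ne_top_of_tsum_ne_top hb n
        · exact ENNReal.pow_ne_top (ne_top_of_le_ne_top ENNReal.one_ne_top hu)
      have h2 := (ENNReal.add_right_inj hfin).1 h1
      have h3 := (ENNReal.mul_right_inj (pow_ne_zero N hu0.ne')
        (ENNReal.pow_ne_top (ne_top_of_le_ne_top ENNReal.one_ne_top hu))).1 h2
      calc a N = a (0 + N) * u ^ 0 := by simp
        _ ≤ ∑' n, a (n + N) * u ^ n := ENNReal.le_tsum 0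
        _ = ∑' n, b (n + N) * u ^ n := h3
        _ = b N + u * ∑' n, b (n + 1 + N) * u ^ n := by
            rw [tsum_eq_zero_add' ENNReal.summable, ← ENNReal.tsum_mul_left]
            simp only [zero_add, pow_zero, mul_one]
            congr 2
            ext n
            rw [pow_succ]
            ring
        _ ≤ b N + u * ∑' n, b n := by
            refine add_le_add le_rfl (mul_le_mul_right ?_ u)
            calc ∑' n, b (n + 1 + N) * u ^ n ≤ ∑' n, b (n + (1 + N)) := by
                  refine ENNReal.tsum_le_tsum fun n => ?_
                  rw [add_assoc]
                  exact mul_le_of_le_one_right' (pow_le_one' hu n)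
              _ ≤ ∑' n, b n :=
                  ENNReal.tsum_comp_le_tsum_of_injective (add_left_injective _) b
    refine ge_of_tendsto (x := 𝓝[>] (0 : ℝ≥0∞)) (f := fun u => b N + u * ∑' n, b n) ?_ ?_
    · have : Tendsto (fun u : ℝ≥0∞ => b N + u * ∑' n, b n) (𝓝 0)
          (𝓝 (b N + 0 * ∑' n, b n)) :=
        tendsto_const_nhds.add (ENNReal.Tendsto.mul_const tendsto_id (Or.inr hb))
      rw [zero_mul, add_zero] at this
      exact this.mono_left nhdsWithin_le_nhds
    · filter_upwards [Ioc_mem_nhdsGT (zero_lt_one' ℝ≥0∞)] with u hu using key u hu.1 hu.2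
  funext N
  induction N using Nat.strong_induction_on with
  | _ N ih =>
    exact le_antisymm (aux ha hb h N ih)
      (aux hb ha (fun u hu => (h u hu).symm) N fun n hn => (ih n hn).symm)

end PowerSeries

/-! ### Infinite products of numbers in the unit interval. -/

section InfProd

/-- The infinite product of a sequence of numbers from the unit interval. -/
noncomputable def infProd (f : ℕ → ℝ≥0∞) : ℝ≥0∞ := ⨅ n, ∏ k ∈ Finset.range n, f k

/-- Factors at most `1` make the partial products decrease, so the infimum in `infProd` is their
limit. -/
lemma antitone_prod_range {f : ℕ → ℝ≥0∞} (hf : ∀ k, f k ≤ 1) :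
    Antitone fun n => ∏ k ∈ Finset.range n, f k := by
  refine antitone_nat_of_succ_le fun n => ?_
  rw [Finset.prod_range_succ]
  exact mul_le_of_le_one_right' (hf n)

lemma infProd_eq_prod {f : ℕ → ℝ≥0∞} (hf : ∀ k, f k ≤ 1) {s : Finset ℕ}
    (hs : ∀ k ∉ s, f k = 1) : infProd f = ∏ k ∈ s, f k := by
  have h : ∀ n, s ⊆ Finset.range n → ∏ k ∈ Finset.range n, f k = ∏ k ∈ s, f k :=
    fun n hn => (Finset.prod_subset hn fun k _ hk => hs k hk).symm
  obtain ⟨N, hN⟩ := s.exists_nat_subset_range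
  refine le_antisymm ((iInf_le _ N).trans (h N hN).le) (le_iInf fun n => ?_)
  rw [← h (max n N) (hN.trans (Finset.range_mono (le_max_right _ _)))]
  exact antitone_prod_range hf (le_max_left n N)

lemma infProd_mono {f g : ℕ → ℝ≥0∞} (h : ∀ k, f k ≤ g k) : infProd f ≤ infProd g :=
  iInf_mono fun _ => Finset.prod_le_prod' fun k _ => h k

lemma measurable_infProd {α : Type*} [MeasurableSpace α] {f : ℕ → α → ℝ≥0∞}
    (hf : ∀ k, Measurable (f k)) : Measurable fun x => infProd fun k => f k x :=
  Measurable.iInf fun _ => Finset.measurable_prod _ fun k _ => hf k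

/-- Outside the common finite set `s` all factors are `1`, so the limit passes through a finite
product; an infimum would not commute with limits in general. -/
lemma tendsto_infProd {f : ℕ → ℕ → ℝ≥0∞} {g : ℕ → ℝ≥0∞} (hf : ∀ n k, f n k ≤ 1)
    (hg : ∀ k, g k ≤ 1) {s : Finset ℕ} (hfs : ∀ n, ∀ k ∉ s, f n k = 1)
    (hgs : ∀ k ∉ s, g k = 1) (h : ∀ k, Tendsto (fun n => f n k) atTop (𝓝 (g k))) :
    Tendsto (fun n => infProd (f n)) atTop (𝓝 (infProd g)) := by
  simp_rw [fun n => infProd_eq_prod (hf n) (hfs n), infProd_eq_prod hg hgs]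
  clear hfs hgs
  induction s using Finset.induction_on with
  | empty => simp
  | insert i s hi ih =>
    simp_rw [Finset.prod_insert hi]
    have h1 : ∏ k ∈ s, g k ≠ ∞ :=
      ne_top_of_le_ne_top ENNReal.one_ne_top (Finset.prod_le_one' fun k _ => hg k)
    exact ENNReal.Tendsto.mul (h i) (Or.inr h1) ih
      (Or.inr (ne_top_of_le_ne_top ENNReal.one_ne_top (hg i)))

lemma update_one_le_one {f : ℕ → ℝ≥0∞} (hf : ∀ k, f k ≤ 1) (i k : ℕ) :
    Function.update f i 1 k ≤ 1 := by
  rcases eq_or_ne k i with rfl | h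
  · simp
  · simpa [h] using hf k

end InfProd

/-! ### Fubini for independent variables. -/

section Independence

variable {Ω : Type*} [MeasurableSpace Ω] {P : Measure Ω} [IsProbabilityMeasure P]

/-- The second variable is resampled on a copy of `Ω`; this is how one family is frozen while
another is integrated out. -/
lemma lintegral_comp_of_indepFun {β γ : Type*} [MeasurableSpace β] [MeasurableSpace γ]
    {X : Ω → β} {Y : Ω → γ} (hX : Measurable X) (hY : Measurable Y) (h : IndepFun X Y P)
    {f : β × γ → ℝ≥0∞} (hf : Measurable f) :
    ∫⁻ ω, f (X ω, Y ω) ∂P = ∫⁻ ω, ∫⁻ ω', f (X ω, Y ω') ∂P ∂P := by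
  have h1 := (indepFun_iff_map_prod_eq_prod_map_map hX.aemeasurable hY.aemeasurable).1 h
  have hp : IsProbabilityMeasure (P.map Y) := Measure.isProbabilityMeasure_map hY.aemeasurable
  rw [← lintegral_map (f := f) hf (hX.prodMk hY), h1, lintegral_prod _ hf.aemeasurable,
    lintegral_map hf.lintegral_prod_right' hX]
  congr 1
  ext ω
  rw [lintegral_map (by fun_prop) hY]

end Independence

/-! ### The Chen-Stein identity. -/

section Poisson

lemma lintegral_poissonMeasure (r : ℝ≥0) (f : ℕ → ℝ≥0∞) :
    ∫⁻ n, f n ∂(poissonMeasure r) = ∑' n, poissonMeasure r {n} * f n := by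
  rw [lintegral_countable']
  simp_rw [mul_comm]

lemma succ_mul_poissonMeasure_succ (r : ℝ≥0) (n : ℕ) :
    ((n + 1 : ℕ) : ℝ≥0∞) * poissonMeasure r {n + 1} = r * poissonMeasure r {n} := by
  rw [poissonMeasure_singleton, poissonMeasure_singleton, ← ENNReal.ofReal_natCast,
    ← ENNReal.ofReal_coe_nnreal, ← ENNReal.ofReal_mul (by positivity),
    ← ENNReal.ofReal_mul (by positivity)]
  congr 1
  rw [Nat.factorial_succ, pow_succ]
  push_cast
  field_simp

/-- The Chen-Stein identity of the Poisson distribution. -/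
lemma lintegral_mul_pred_poissonMeasure (r : ℝ≥0) (f : ℕ → ℝ≥0∞) :
    ∫⁻ n, n * f (n - 1) ∂(poissonMeasure r) = r * ∫⁻ n, f n ∂(poissonMeasure r) := by
  rw [lintegral_poissonMeasure, lintegral_poissonMeasure, tsum_eq_zero_add' ENNReal.summable,
    ← ENNReal.tsum_mul_left]
  simp only [Nat.cast_zero, zero_mul, mul_zero, zero_add, Nat.add_sub_cancel]
  congr 1
  ext n
  rw [← mul_assoc, ← mul_assoc, ← succ_mul_poissonMeasure_succ]
  ring

end Poisson

/-! ### Local finiteness and joint law of the counts of a Poisson process. -/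

namespace IsPoissonProcess

variable {Ω : Type*} [MeasurableSpace Ω] {P : Measure Ω} [IsProbabilityMeasure P] {lam : ℝ}
  {X : ℕ → Ω → ℝ}

lemma measurableSet_mem (hX : IsPoissonProcess P lam X) {B : Set ℝ} (hB : MeasurableSet B)
    (i : ℕ) : MeasurableSet {ω | X i ω ∈ B} := hX.measurable i hB

lemma counts_fintype (hX : IsPoissonProcess P lam X) {ι : Type*} [Fintype ι] (B : ι → Set ℝ)
    (hB : ∀ j, MeasurableSet (B j)) (hb : ∀ j, Bornology.IsBounded (B j))
    (hd : Pairwise fun j k => Disjoint (B j) (B k)) (k : ι → ℕ) :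
    P {ω | ∀ j, {i | X i ω ∈ B j}.encard = k j} =
      ∏ j, poissonMeasure (lam * volume.real (B j)).toNNReal {k j} := by
  let e := (Fintype.equivFin ι).symm
  have h := hX.counts _ (fun j => B (e j)) (fun j => hB _) (fun j => hb _)
    (fun i j hij => hd (e.injective.ne hij)) (fun j => k (e j))
  rw [e.prod_comp fun j => poissonMeasure (lam * volume.real (B j)).toNNReal {k j}] at h
  rw [← h]
  congr 1
  ext ω
  exact ⟨fun h j => h (e j), fun h j => by simpa using h (e.symm j)⟩

/-- The count could be infinite a priori, but the Poisson masses of its finite values already add up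
to `1`. -/
lemma ae_finite (hX : IsPoissonProcess P lam X) {B : Set ℝ} (hB : MeasurableSet B)
    (hb : Bornology.IsBounded B) : ∀ᵐ ω ∂P, {i | X i ω ∈ B}.Finite := by
  have h1 : ∀ n : ℕ, MeasurableSet {ω | {i | X i ω ∈ B}.encard = n} := fun n =>
    measurable_encard_setOf (fun i => hX.measurableSet_mem hB i) (measurableSet_singleton (n : ℕ∞))
  have h2 : P (⋃ n : ℕ, {ω | {i | X i ω ∈ B}.encard = n}) = 1 := by
    rw [measure_iUnion _ h1]
    · have : ∀ n : ℕ, P {ω | {i | X i ω ∈ B}.encard = n} =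
          poissonMeasure (lam * volume.real B).toNNReal {n} := by
        intro n
        have := hX.counts_fintype (fun _ : Unit => B) (fun _ => hB) (fun _ => hb)
          (fun i j hij => (hij rfl).elim) (fun _ => n)
        simpa using this
      simp_rw [this]
      have h3 := lintegral_poissonMeasure (lam * volume.real B).toNNReal fun _ => 1
      simpa using h3.symm
    · intro m n hmn
      refine Set.disjoint_left.2 fun ω hm hn => hmn ?_
      have : (m : ℕ∞) = n := hm.symm.trans hn
      exact_mod_cast this
  have h3 := (mem_ae_iff_prob_eq_one (MeasurableSet.iUnion h1)).2 h2
  filter_upwards [h3] with ω hω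
  obtain ⟨n, hn⟩ := Set.mem_iUnion.1 hω
  exact Set.finite_of_encard_eq_coe hn

lemma ae_locallyFinite (hX : IsPoissonProcess P lam X) :
    ∀ᵐ ω ∂P, ∀ B : Set ℝ, Bornology.IsBounded B → {i | X i ω ∈ B}.Finite := by
  have h : ∀ n : ℕ, ∀ᵐ ω ∂P, {i | X i ω ∈ Metric.closedBall (0 : ℝ) n}.Finite := fun n =>
    hX.ae_finite measurableSet_closedBall Metric.isBounded_closedBall
  filter_upwards [ae_all_iff.2 h] with ω hω B hB
  obtain ⟨r, hr⟩ := hB.subset_closedBall 0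
  obtain ⟨n, hn⟩ := exists_nat_ge r
  exact (hω n).subset fun i hi => Metric.closedBall_subset_closedBall hn (hr hi)

lemma measurable_count (hX : IsPoissonProcess P lam X) {B : Set ℝ} (hB : MeasurableSet B) :
    Measurable fun ω => {i | X i ω ∈ B}.ncard :=
  measurable_ncard_setOf fun i => hX.measurableSet_mem hB i

lemma map_counts (hX : IsPoissonProcess P lam X) {ι : Type*} [Fintype ι] (B : ι → Set ℝ)
    (hB : ∀ j, MeasurableSet (B j)) (hb : ∀ j, Bornology.IsBounded (B j))
    (hd : Pairwise fun j k => Disjoint (B j) (B k)) :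
    P.map (fun ω j => {i | X i ω ∈ B j}.ncard) =
      Measure.pi fun j => poissonMeasure (lam * volume.real (B j)).toNNReal := by
  have hm : Measurable fun ω (j : ι) => {i | X i ω ∈ B j}.ncard :=
    measurable_pi_iff.2 fun j => hX.measurable_count (hB j)
  refine Measure.ext_of_singleton fun k => ?_
  rw [Measure.map_apply hm (measurableSet_singleton k), Measure.pi_singleton,
    ← hX.counts_fintype B hB hb hd]
  refine measure_congr ?_
  -- `ncard` is `0` on infinite sets, so passing back to `encard` requires the finiteness of the
  -- counts.
  filter_upwards [hX.ae_locallyFinite] with ω hω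
  refine propext ⟨fun h j => ?_, fun h => funext fun j => ?_⟩
  · rw [← Set.Finite.cast_ncard_eq (hω _ (hb j))]
    exact congrArg _ (congrFun h j)
  · have := h j
    show Set.ncard _ = _
    rw [Set.ncard, this]
    simp

lemma lintegral_counts (hX : IsPoissonProcess P lam X) {ι : Type*} [Fintype ι] (B : ι → Set ℝ)
    (hB : ∀ j, MeasurableSet (B j)) (hb : ∀ j, Bornology.IsBounded (B j))
    (hd : Pairwise fun j k => Disjoint (B j) (B k)) (f : ι → ℕ → ℝ≥0∞) :
    ∫⁻ ω, ∏ j, f j {i | X i ω ∈ B j}.ncard ∂P =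
      ∏ j, ∫⁻ n, f j n ∂(poissonMeasure (lam * volume.real (B j)).toNNReal) := by
  have hm : Measurable fun ω (j : ι) => {i | X i ω ∈ B j}.ncard :=
    measurable_pi_iff.2 fun j => hX.measurable_count (hB j)
  rw [← lintegral_map (f := fun k : ι → ℕ => ∏ j, f j (k j)) Measurable.of_discrete hm,
    hX.map_counts B hB hb hd, lintegral_prod_eq_prod_lintegral_of_indepFun Finset.univ
      (fun j (k : ι → ℕ) => f j (k j))
      (iIndepFun_pi (X := f) fun j => Measurable.of_discrete.aemeasurable)
      fun j => Measurable.of_discrete]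
  refine Finset.prod_congr rfl fun j _ => ?_
  exact (measurePreserving_eval _ j).lintegral_comp Measurable.of_discrete

end IsPoissonProcess

/-! ### Generating functional and Mecke equation for step functions. -/

/-- A function which is constant on finitely many disjoint bounded sets, and equal to `1`
elsewhere. -/
structure IsStep {ι : Type*} (B : ι → Set ℝ) (c : ι → ℝ≥0∞) (g : ℝ → ℝ≥0∞) : Prop where
  measurableSet : ∀ j, MeasurableSet (B j)
  bounded : ∀ j, Bornology.IsBounded (B j)
  disjoint : Pairwise fun j k => Disjoint (B j) (B k)
  le_one : ∀ j, c j ≤ 1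
  eq_of_mem : ∀ j, ∀ x ∈ B j, g x = c j
  eq_one : ∀ x, (∀ j, x ∉ B j) → g x = 1

namespace IsStep

variable {ι : Type*} [Fintype ι] {B : ι → Set ℝ} {c : ι → ℝ≥0∞} {g : ℝ → ℝ≥0∞}

lemma apply_le_one (h : IsStep B c g) (x : ℝ) : g x ≤ 1 := by
  by_cases hx : ∃ j, x ∈ B j
  · obtain ⟨j, hj⟩ := hx
    rw [h.eq_of_mem j x hj]
    exact h.le_one j
  · rw [h.eq_one x (not_exists.1 hx)]

/-- Grouping the points by the piece that contains them turns the product into powers of the counts.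
-/
lemma infProd_eq (h : IsStep B c g) {x : ℕ → ℝ} (hx : ∀ j, {k | x k ∈ B j}.Finite) :
    infProd (fun k => g (x k)) = ∏ j, c j ^ {k | x k ∈ B j}.ncard := by
  classical
  rw [infProd_eq_prod (fun k => h.apply_le_one _)
    (s := Finset.univ.biUnion fun j => (hx j).toFinset), Finset.prod_biUnion]
  · refine Finset.prod_congr rfl fun j _ => ?_
    rw [Finset.prod_congr rfl fun k hk => h.eq_of_mem j (x k) (by simpa using hk),
      Finset.prod_const, Set.ncard_eq_toFinset_card _ (hx j)]
  · intro j _ j' _ hjj'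
    refine Finset.disjoint_left.2 fun k hk hk' => ?_
    exact Set.disjoint_left.1 (h.disjoint hjj') (by simpa using hk) (by simpa using hk')
  · intro k hk
    exact h.eq_one _ (by simpa using hk)

/-- Resetting the factor of the point `i` to `1` deletes the point. The count of its piece is
positive, so the truncated subtraction is exact. -/
lemma infProd_update_eq [DecidableEq ι] (h : IsStep B c g) {x : ℕ → ℝ}
    (hx : ∀ j, {k | x k ∈ B j}.Finite) {j : ι} {i : ℕ} (hi : x i ∈ B j) :
    infProd (Function.update (fun k => g (x k)) i 1) =
      ∏ j', c j' ^ ({k | x k ∈ B j'}.ncard - if j' = j then 1 else 0) := by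
  rw [infProd_eq_prod (update_one_le_one (fun k => h.apply_le_one _) i)
    (s := Finset.univ.biUnion fun j => (hx j).toFinset), Finset.prod_biUnion]
  · refine Finset.prod_congr rfl fun j' _ => ?_
    rcases eq_or_ne j' j with rfl | hj
    · have hi' : i ∈ (hx j').toFinset := by simpa using hi
      rw [← Finset.mul_prod_erase _ _ hi', Function.update_self, one_mul,
        Finset.prod_congr rfl (g := fun _ => c j'), Finset.prod_const,
        Finset.card_erase_of_mem hi', Set.ncard_eq_toFinset_card _ (hx j'), if_pos rfl]
      intro k hk
      rw [Finset.mem_erase] at hk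
      rw [Function.update_of_ne hk.1]
      exact h.eq_of_mem j' (x k) (by simpa using hk.2)
    · rw [Finset.prod_congr rfl (g := fun _ => c j'), Finset.prod_const,
        Set.ncard_eq_toFinset_card _ (hx j'), if_neg hj, Nat.sub_zero]
      intro k hk
      have hk' : x k ∈ B j' := by simpa using hk
      rw [Function.update_of_ne, h.eq_of_mem j' (x k) hk']
      rintro rfl
      exact Set.disjoint_left.1 (h.disjoint hj) hk' hi
  · intro j _ j' _ hjj'
    refine Finset.disjoint_left.2 fun k hk hk' => ?_
    exact Set.disjoint_left.1 (h.disjoint hjj') (by simpa using hk) (by simpa using hk')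
  · intro k hk
    rcases eq_or_ne k i with rfl | hki
    · simp
    · rw [Function.update_of_ne hki]
      exact h.eq_one _ (by simpa using hk)

variable {Ω : Type*} [MeasurableSpace Ω] {P : Measure Ω} [IsProbabilityMeasure P] {lam : ℝ}
  {X : ℕ → Ω → ℝ}

lemma lintegral_infProd (h : IsStep B c g) (hX : IsPoissonProcess P lam X) :
    ∫⁻ ω, infProd (fun k => g (X k ω)) ∂P =
      ∏ j, ∫⁻ n, c j ^ n ∂(poissonMeasure (lam * volume.real (B j)).toNNReal) := by
  rw [← hX.lintegral_counts B h.measurableSet h.bounded h.disjoint fun j n => c j ^ n]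
  refine lintegral_congr_ae ?_
  filter_upwards [hX.ae_locallyFinite] with ω hω
  exact h.infProd_eq fun j => hω _ (h.bounded j)

/-- The Mecke equation for a step function. -/
lemma lintegral_tsum (h : IsStep B c g) (hX : IsPoissonProcess P lam X) (j : ι) :
    ∫⁻ ω, ∑' i, (B j).indicator 1 (X i ω) *
        infProd (Function.update (fun k => g (X k ω)) i 1) ∂P =
      ENNReal.ofReal lam * volume (B j) * ∫⁻ ω, infProd (fun k => g (X k ω)) ∂P := by
  classical
  -- Deleting any point of `B j` leaves the same product, so the sum over `i` is the count `n` of `B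
  -- j` times it; the factor of the piece `j` becomes `n * c j ^ (n - 1)`.
  have h1 : ∀ᵐ ω ∂P, ∑' i, (B j).indicator 1 (X i ω) *
        infProd (Function.update (fun k => g (X k ω)) i 1) =
      ∏ j', (fun (j' : ι) (n : ℕ) => (if j' = j then (n : ℝ≥0∞) else 1) *
        c j' ^ (n - if j' = j then 1 else 0)) j' {k | X k ω ∈ B j'}.ncard := by
    filter_upwards [hX.ae_locallyFinite] with ω hω
    have hf : ∀ j, {k | X k ω ∈ B j}.Finite := fun j => hω _ (h.bounded j)
    have h2 : ∀ i, (B j).indicator 1 (X i ω) *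
        infProd (Function.update (fun k => g (X k ω)) i 1) =
        {k | X k ω ∈ B j}.indicator (fun _ => ∏ j', c j' ^ ({k | X k ω ∈ B j'}.ncard -
          if j' = j then 1 else 0)) i := by
      intro i
      by_cases hi : X i ω ∈ B j
      · rw [h.infProd_update_eq hf hi, Set.indicator_of_mem hi,
          Set.indicator_of_mem (s := {k | X k ω ∈ B j}) hi, Pi.one_apply, one_mul]
      · rw [Set.indicator_of_notMem hi, Set.indicator_of_notMem (s := {k | X k ω ∈ B j}) hi,
          zero_mul]
    simp_rw [h2]
    rw [← tsum_subtype, ENNReal.tsum_set_const, Finset.prod_mul_distrib]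
    congr 1
    rw [Finset.prod_ite_eq' Finset.univ j, if_pos (Finset.mem_univ j),
      ← Set.Finite.cast_ncard_eq (hf j)]
    simp
  rw [lintegral_congr_ae h1, hX.lintegral_counts B h.measurableSet h.bounded h.disjoint
      (fun (j' : ι) (n : ℕ) => (if j' = j then (n : ℝ≥0∞) else 1) *
        c j' ^ (n - if j' = j then 1 else 0)),
    h.lintegral_infProd hX, ← Finset.mul_prod_erase _ _ (Finset.mem_univ j),
    ← Finset.mul_prod_erase Finset.univ (fun j => ∫⁻ n, c j ^ n
      ∂(poissonMeasure (lam * volume.real (B j)).toNNReal)) (Finset.mem_univ j), ← mul_assoc]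
  congr 1
  -- The Chen-Stein identity turns this factor into the mean number of points in `B j` times the
  -- undisturbed factor.
  · simp only [if_true]
    rw [lintegral_mul_pred_poissonMeasure _ fun n => c j ^ n]
    congr 1
    rw [← ENNReal.ofReal, ENNReal.ofReal_mul' measureReal_nonneg, measureReal_def,
      ENNReal.ofReal_toReal (h.bounded j).measure_lt_top.ne]
  · refine Finset.prod_congr rfl fun j' hj' => ?_
    simp [Finset.ne_of_mem_erase hj']

end IsStep

/-! ### From step functions to measurable functions. -/

/-- The level sets of a simple function in `B` and in `K \ B`. -/
def levelSets (K B : Set ℝ) (s : SimpleFunc ℝ ℝ≥0∞) (p : s.range × Bool) : Set ℝ :=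
  (if p.2 then B else K \ B) ∩ s ⁻¹' {p.1.1}

open Classical in
/-- The function equal to `g` on `K`, and to `1` elsewhere. -/
noncomputable def extendOne (K : Set ℝ) (g : ℝ → ℝ≥0∞) (x : ℝ) : ℝ≥0∞ := if x ∈ K then g x else 1

lemma extendOne_le_one {K : Set ℝ} {g : ℝ → ℝ≥0∞} (hg : ∀ x, g x ≤ 1) (x : ℝ) :
    extendOne K g x ≤ 1 := by
  unfold extendOne
  split_ifs
  exacts [hg x, le_rfl]

lemma extendOne_of_notMem {K : Set ℝ} {g : ℝ → ℝ≥0∞} {x : ℝ} (hx : x ∉ K) :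
    extendOne K g x = 1 := if_neg hx

lemma extendOne_eq_self {K : Set ℝ} {g : ℝ → ℝ≥0∞} (hg : ∀ x ∉ K, g x = 1) :
    extendOne K g = g := by
  funext x
  unfold extendOne
  split_ifs with h
  exacts [rfl, (hg x h).symm]

/-- The level sets are cut along `B` as well, so that `B` is a union of pieces and the Mecke
equations of these pieces add up to the one for `B`. -/
lemma isStep_extendOne {K B : Set ℝ} (hK : MeasurableSet K) (hKb : Bornology.IsBounded K)
    (hB : MeasurableSet B) (hBK : B ⊆ K) {s : SimpleFunc ℝ ℝ≥0∞} (hs : ∀ x, s x ≤ 1) :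
    IsStep (levelSets K B s) (fun p => p.1.1) (extendOne K s) where
  measurableSet p := by
    refine MeasurableSet.inter ?_ (s.measurable (measurableSet_singleton _))
    split_ifs
    exacts [hB, hK.diff hB]
  bounded p := by
    refine hKb.subset (Set.inter_subset_left.trans ?_)
    split_ifs
    exacts [hBK, Set.sdiff_subset]
  disjoint := by
    rintro ⟨v, b⟩ ⟨v', b'⟩ h
    refine Set.disjoint_left.2 fun x hx hx' => h ?_
    have hv : v = v' := Subtype.ext (hx.2.symm.trans hx'.2)
    have hb : b = b' := by
      have h1 := hx.1
      have h2 := hx'.1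
      cases b <;> cases b' <;> simp_all
    rw [hv, hb]
  le_one p := by
    obtain ⟨x, hx⟩ := SimpleFunc.mem_range.1 p.1.2
    exact hx ▸ hs x
  eq_of_mem p x hx := by
    have hxK : x ∈ K := by
      have := hx.1
      split_ifs at this
      exacts [hBK this, this.1]
    rw [extendOne, if_pos hxK]
    exact hx.2
  eq_one x hx := by
    refine extendOne_of_notMem fun hxK => ?_
    by_cases hxB : x ∈ B
    · exact hx ⟨⟨s x, s.mem_range_self x⟩, true⟩ ⟨by simpa using hxB, rfl⟩
    · exact hx ⟨⟨s x, s.mem_range_self x⟩, false⟩ ⟨by simpa using ⟨hxK, hxB⟩, rfl⟩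

lemma sum_indicator_levelSets (K B : Set ℝ) (s : SimpleFunc ℝ ℝ≥0∞) (x : ℝ) :
    ∑ v : s.range, (levelSets K B s (v, true)).indicator (1 : ℝ → ℝ≥0∞) x = B.indicator 1 x := by
  classical
  rw [Finset.sum_eq_single ⟨s x, s.mem_range_self x⟩]
  · by_cases hx : x ∈ B <;> simp [levelSets, hx]
  · intro v _ hv
    refine Set.indicator_of_notMem (fun h => hv ?_) _
    exact Subtype.ext h.2.symm
  · simp

/-- The simple approximations of `g` need not equal `1` outside `K`; truncating them by `extendOne`
keeps all but finitely many factors equal to `1` at every stage. -/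
lemma tendsto_extendOne_eapprox {K : Set ℝ} {g : ℝ → ℝ≥0∞} (hg : Measurable g) (x : ℝ) :
    Tendsto (fun n => extendOne K (SimpleFunc.eapprox g n) x) atTop (𝓝 (extendOne K g x)) := by
  unfold extendOne
  split_ifs
  · exact SimpleFunc.tendsto_eapprox hg x
  · exact tendsto_const_nhds

lemma monotone_extendOne_eapprox (K : Set ℝ) (g : ℝ → ℝ≥0∞) (x : ℝ) :
    Monotone fun n => extendOne K (SimpleFunc.eapprox g n) x := by
  intro m n hmn
  dsimp only [extendOne]
  split_ifs
  · exact SimpleFunc.monotone_eapprox g hmn x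
  · exact le_rfl

lemma eapprox_le_one {g : ℝ → ℝ≥0∞} (hg : Measurable g) (hg1 : ∀ x, g x ≤ 1) (n : ℕ) (x : ℝ) :
    SimpleFunc.eapprox g n x ≤ 1 := by
  refine le_trans ?_ (hg1 x)
  rw [← SimpleFunc.iSup_eapprox_apply hg x]
  exact le_iSup (fun n => SimpleFunc.eapprox g n x) n

lemma measurable_extendOne {K : Set ℝ} (hK : MeasurableSet K) {g : ℝ → ℝ≥0∞} (hg : Measurable g) :
    Measurable (extendOne K g) :=
  Measurable.ite hK hg measurable_const

lemma update_one_mono {f g : ℕ → ℝ≥0∞} (h : ∀ k, f k ≤ g k) (i k : ℕ) :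
    Function.update f i 1 k ≤ Function.update g i 1 k := by
  rcases eq_or_ne k i with rfl | hk
  · simp
  · simpa [hk] using h k

namespace IsPoissonProcess

variable {Ω : Type*} [MeasurableSpace Ω] {P : Measure Ω} [IsProbabilityMeasure P] {lam : ℝ}
  {X : ℕ → Ω → ℝ} {g : ℝ → ℝ≥0∞} {K B : Set ℝ}

lemma measurable_infProd (hX : IsPoissonProcess P lam X) (hg : Measurable g) :
    Measurable fun ω => infProd fun k => g (X k ω) :=
  _root_.measurable_infProd fun k => hg.comp (hX.measurable k)

lemma measurable_infProd_update (hX : IsPoissonProcess P lam X) (hg : Measurable g) (i : ℕ) :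
    Measurable fun ω => infProd (Function.update (fun k => g (X k ω)) i 1) := by
  refine _root_.measurable_infProd fun k => ?_
  rcases eq_or_ne k i with rfl | hk
  · simp
  · simpa only [Function.update_of_ne hk] using! hg.comp (hX.measurable k)

lemma tendsto_lintegral_infProd (hX : IsPoissonProcess P lam X) (hKm : MeasurableSet K)
    (hK : Bornology.IsBounded K) (hg : Measurable g) (hg1 : ∀ x, g x ≤ 1) :
    Tendsto (fun n => ∫⁻ ω, infProd (fun k => extendOne K (SimpleFunc.eapprox g n) (X k ω)) ∂P)
      atTop (𝓝 (∫⁻ ω, infProd (fun k => extendOne K g (X k ω)) ∂P)) := by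
  refine lintegral_tendsto_of_tendsto_of_monotone
    (fun n => (hX.measurable_infProd (measurable_extendOne hKm
      (SimpleFunc.measurable _))).aemeasurable)
    (ae_of_all _ fun ω m n hmn => infProd_mono fun k => monotone_extendOne_eapprox K g _ hmn) ?_
  filter_upwards [hX.ae_locallyFinite] with ω hω
  refine tendsto_infProd (s := (hω K hK).toFinset)
    (fun n k => extendOne_le_one (eapprox_le_one hg hg1 n) _)
    (fun k => extendOne_le_one hg1 _) (fun n k hk => extendOne_of_notMem (by simpa using hk))
    (fun k hk => extendOne_of_notMem (by simpa using hk))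
    fun k => tendsto_extendOne_eapprox hg _

/-- The generating functional of a Poisson process depends on its density only. -/
lemma lintegral_infProd_congr (hX : IsPoissonProcess P lam X) {Ω' : Type*} [MeasurableSpace Ω']
    {P' : Measure Ω'} [IsProbabilityMeasure P'] {X' : ℕ → Ω' → ℝ}
    (hX' : IsPoissonProcess P' lam X') (hg : Measurable g) (hg1 : ∀ x, g x ≤ 1)
    (hK : Bornology.IsBounded K) (hgK : ∀ x ∉ K, g x = 1) :
    ∫⁻ ω, infProd (fun k => g (X k ω)) ∂P = ∫⁻ ω, infProd (fun k => g (X' k ω)) ∂P' := by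
  obtain ⟨r, hr⟩ := hK.subset_closedBall 0
  have hm : MeasurableSet (Metric.closedBall (0 : ℝ) r) := measurableSet_closedBall
  have hb : Bornology.IsBounded (Metric.closedBall (0 : ℝ) r) := Metric.isBounded_closedBall
  have h1 := hX.tendsto_lintegral_infProd hm hb hg hg1
  have h2 := hX'.tendsto_lintegral_infProd hm hb hg hg1
  rw [extendOne_eq_self fun x hx => hgK x fun h => hx (hr h)] at h1 h2
  refine tendsto_nhds_unique h1 (h2.congr fun n => ?_)
  have hs := isStep_extendOne hm hb MeasurableSet.empty (Set.empty_subset _)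
    (eapprox_le_one hg hg1 n)
  -- For a step function both sides are the same product of Poisson integrals over the pieces.
  rw [hs.lintegral_infProd hX, hs.lintegral_infProd hX']

lemma mecke_simpleFunc (hX : IsPoissonProcess P lam X) (hKm : MeasurableSet K)
    (hK : Bornology.IsBounded K) (hB : MeasurableSet B) (hBK : B ⊆ K) {s : SimpleFunc ℝ ℝ≥0∞}
    (hs : ∀ x, s x ≤ 1) :
    ∫⁻ ω, ∑' i, B.indicator 1 (X i ω) *
        infProd (Function.update (fun k => extendOne K s (X k ω)) i 1) ∂P =
      ENNReal.ofReal lam * volume B * ∫⁻ ω, infProd (fun k => extendOne K s (X k ω)) ∂P := by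
  have hst := isStep_extendOne hKm hK hB hBK hs
  have hvol : volume B = ∑ v : s.range, volume (levelSets K B s (v, true)) := by
    rw [← lintegral_indicator_one hB]
    simp_rw [← sum_indicator_levelSets K B s]
    rw [lintegral_finsetSum _ fun v _ => measurable_one.indicator (hst.measurableSet _)]
    simp_rw [lintegral_indicator_one (hst.measurableSet _)]
  rw [hvol, Finset.mul_sum, Finset.sum_mul]
  simp_rw [← hst.lintegral_tsum hX]
  rw [← lintegral_finsetSum]
  · congr 1
    ext ω
    rw [← Summable.tsum_finsetSum fun _ _ => ENNReal.summable]
    simp_rw [← Finset.sum_mul, sum_indicator_levelSets]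
  · intro v _
    exact Measurable.tsum fun i =>
      ((measurable_one.indicator (hst.measurableSet _)).comp (hX.measurable i)).mul
        (hX.measurable_infProd_update (measurable_extendOne hKm s.measurable) i)

/-- The Mecke equation for product functionals. -/
lemma mecke (hX : IsPoissonProcess P lam X) (hg : Measurable g) (hg1 : ∀ x, g x ≤ 1)
    (hK : Bornology.IsBounded K) (hgK : ∀ x ∉ K, g x = 1) (hB : MeasurableSet B)
    (hBb : Bornology.IsBounded B) :
    ∑' i, ∫⁻ ω, B.indicator 1 (X i ω) *
        infProd (Function.update (fun k => g (X k ω)) i 1) ∂P =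
      ENNReal.ofReal lam * volume B * ∫⁻ ω, infProd (fun k => g (X k ω)) ∂P := by
  obtain ⟨r, hr⟩ := (hK.union hBb).subset_closedBall 0
  have hm : MeasurableSet (Metric.closedBall (0 : ℝ) r) := measurableSet_closedBall
  have hb : Bornology.IsBounded (Metric.closedBall (0 : ℝ) r) := Metric.isBounded_closedBall
  have hBr : B ⊆ Metric.closedBall 0 r := Set.subset_union_right.trans hr
  have hgr : extendOne (Metric.closedBall 0 r) g = g :=
    extendOne_eq_self fun x hx => hgK x fun h => hx (hr (Or.inl h))
  have hmeas : ∀ {f : ℝ → ℝ≥0∞}, Measurable f → ∀ i, Measurable fun ω =>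
      B.indicator 1 (X i ω) * infProd (Function.update (fun k => f (X k ω)) i 1) := fun hf i =>
    ((measurable_one.indicator hB).comp (hX.measurable i)).mul (hX.measurable_infProd_update hf i)
  have h1 := hX.tendsto_lintegral_infProd hm hb hg hg1
  have h2 : Tendsto (fun n => ∫⁻ ω, ∑' i, B.indicator 1 (X i ω) * infProd (Function.update
      (fun k => extendOne (Metric.closedBall 0 r) (SimpleFunc.eapprox g n) (X k ω)) i 1) ∂P) atTop
      (𝓝 (∫⁻ ω, ∑' i, B.indicator 1 (X i ω) * infProd (Function.update
      (fun k => extendOne (Metric.closedBall 0 r) g (X k ω)) i 1) ∂P)) := by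
    refine lintegral_tendsto_of_tendsto_of_monotone
      (fun n => (Measurable.tsum
        (hmeas (measurable_extendOne hm (SimpleFunc.measurable _)))).aemeasurable)
      (ae_of_all _ fun ω m n hmn => ENNReal.tsum_le_tsum fun i => mul_le_mul_right
        (infProd_mono (update_one_mono (fun k => monotone_extendOne_eapprox _ g _ hmn) i)) _) ?_
    filter_upwards [hX.ae_locallyFinite] with ω hω
    -- Only finitely many points lie in `B`, so the series is a finite sum and the limit may be
    -- taken term by term.
    have hB0 : ∀ f : ℕ → ℝ≥0∞, ∑' i, B.indicator 1 (X i ω) * f i =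
        ∑ i ∈ (hω B hBb).toFinset, B.indicator 1 (X i ω) * f i := by
      intro f
      refine tsum_eq_sum fun i hi => ?_
      rw [Set.indicator_of_notMem (by simpa using hi), zero_mul]
    simp_rw [hB0]
    refine tendsto_finsetSum _ fun i _ => ENNReal.Tendsto.const_mul ?_ (Or.inr ?_)
    · refine tendsto_infProd (s := (hω _ hb).toFinset)
        (fun n => update_one_le_one (fun k => extendOne_le_one (eapprox_le_one hg hg1 n) _) i)
        (update_one_le_one (fun k => extendOne_le_one hg1 _) i) ?_ ?_ ?_
      · intro n k hk
        rcases eq_or_ne k i with rfl | hki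
        · simp
        · rw [Function.update_of_ne hki, extendOne_of_notMem (by simpa using hk)]
      · intro k hk
        rcases eq_or_ne k i with rfl | hki
        · simp
        · rw [Function.update_of_ne hki, extendOne_of_notMem (by simpa using hk)]
      · intro k
        rcases eq_or_ne k i with rfl | hki
        · simp
        · simp_rw [Function.update_of_ne hki]
          exact tendsto_extendOne_eapprox hg _
    · exact ne_top_of_le_ne_top ENNReal.one_ne_top (Set.indicator_le_self _ _ _)
  rw [hgr] at h1 h2
  simp_rw [hX.mecke_simpleFunc hm hb hB hBr (eapprox_le_one hg hg1 _)] at h2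
  rw [← lintegral_tsum fun i => (hmeas hg i).aemeasurable]
  refine tendsto_nhds_unique h2 (ENNReal.Tendsto.const_mul h1 (Or.inr ?_))
  exact ENNReal.mul_ne_top ENNReal.ofReal_ne_top hBb.measure_lt_top.ne

/-- Only the lengths of sets enter the law of the counts, and lengths are translation invariant. -/
lemma add_const (hX : IsPoissonProcess P lam X) (c : ℝ) :
    IsPoissonProcess P lam fun i ω => X i ω + c where
  measurable i := (hX.measurable i).add_const c
  counts n B hB hb hd k := by
    have h := hX.counts n (fun j => (· + c) ⁻¹' B j)
      (fun j => (hB j).preimage (measurable_add_const c))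
      (fun j => ?_) (fun i j hij => (hd hij).preimage _) k
    · simpa [measureReal_def, measure_preimage_add_right] using h
    · exact ((IsometryEquiv.addRight c).symm.isometry.lipschitz.isBounded_image (hb j)).subset
        fun x hx => ⟨x + c, hx, by simp⟩

end IsPoissonProcess

lemma infProd_update {f : ℕ → ℝ≥0∞} (hf : ∀ k, f k ≤ 1) (i : ℕ) {a : ℝ≥0∞} (ha : a ≤ 1) :
    infProd (Function.update f i a) = a * infProd (Function.update f i 1) := by
  have hle : ∀ k, Function.update f i a k ≤ 1 := by
    intro k
    rcases eq_or_ne k i with rfl | h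
    · simpa using ha
    · simpa [h] using hf k
  -- From index `i + 1` on every partial product contains the factor at `i`, and dropping the
  -- earlier ones does not change the infimum of a decreasing sequence.
  have hprod : ∀ n, ∏ k ∈ Finset.range (n + (i + 1)), Function.update f i a k =
      a * ∏ k ∈ Finset.range (n + (i + 1)), Function.update f i 1 k := by
    intro n
    have hi : i ∈ Finset.range (n + (i + 1)) := Finset.mem_range.2 (by omega)
    rw [← Finset.mul_prod_erase _ _ hi, ← Finset.mul_prod_erase _ (Function.update f i 1) hi,
      Function.update_self, Function.update_self, one_mul]
    congr 1
    refine Finset.prod_congr rfl fun k hk => ?_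
    rw [Function.update_of_ne (Finset.ne_of_mem_erase hk),
      Function.update_of_ne (Finset.ne_of_mem_erase hk)]
  rw [infProd, infProd, ← (antitone_prod_range hle).iInf_nat_add (i + 1),
    ← (antitone_prod_range (update_one_le_one hf i)).iInf_nat_add (i + 1)]
  simp_rw [hprod]
  rcases eq_or_ne a 0 with rfl | ha0
  · simp
  · rw [ENNReal.mul_iInf_of_ne ha0 (ne_top_of_le_ne_top ENNReal.one_ne_top ha)]

/-- The bounded Borel sets. -/
def boundedBorelSets : Set (Set ℝ) := {B | MeasurableSet B ∧ Bornology.IsBounded B}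

lemma generateFrom_boundedBorelSets :
    MeasurableSpace.generateFrom boundedBorelSets = (inferInstance : MeasurableSpace ℝ) := by
  refine le_antisymm (MeasurableSpace.generateFrom_le fun B hB => hB.1) fun s hs => ?_
  have : s = ⋃ n : ℕ, s ∩ Metric.closedBall 0 n := by
    rw [← Set.inter_iUnion, Metric.iUnion_closedBall_nat, Set.inter_univ]
  rw [this]
  exact MeasurableSet.iUnion fun n => MeasurableSpace.measurableSet_generateFrom
    ⟨hs.inter measurableSet_closedBall, Metric.isBounded_closedBall.subset Set.inter_subset_right⟩

lemma isPiSystem_boundedBorelSets : IsPiSystem boundedBorelSets :=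
  fun _ hs _ ht _ => ⟨hs.1.inter ht.1, hs.2.subset Set.inter_subset_left⟩

/-- The line is covered by countably many bounded Borel sets of finite length. -/
noncomputable def spanningBoundedBorelSets :
    (volume : Measure ℝ).FiniteSpanningSetsIn boundedBorelSets where
  set n := Metric.closedBall 0 n
  set_mem _ := ⟨measurableSet_closedBall, Metric.isBounded_closedBall⟩
  finite _ := Metric.isBounded_closedBall.measure_lt_top
  spanning := Metric.iUnion_closedBall_nat 0

/-! ### The Mecke equation with independent marks. -/

section Marks

variable {Ω 𝓜 : Type*} [MeasurableSpace Ω] [MeasurableSpace 𝓜] {P : Measure Ω}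
  [IsProbabilityMeasure P] {Q : Measure 𝓜} [IsProbabilityMeasure Q] {lam : ℝ}
  {X : ℕ → Ω → ℝ} {M : ℕ → Ω → 𝓜}

lemma lintegral_setOf_mul_pow {S : Set Ω} (hS : MeasurableSet S) {R : Ω → ℕ} (hR : Measurable R)
    (u : ℝ≥0∞) :
    ∫⁻ ω, S.indicator 1 ω * u ^ R ω ∂P = ∑' n, P (S ∩ {ω | R ω = n}) * u ^ n := by
  have h1 : ∀ ω, S.indicator 1 ω * u ^ R ω = S.indicator (fun ω => u ^ R ω) ω := by
    intro ω
    by_cases h : ω ∈ S <;> simp [h]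
  simp_rw [h1]
  rw [lintegral_indicator hS, ← lintegral_map (f := fun n : ℕ => u ^ n) .of_discrete hR,
    lintegral_countable']
  refine tsum_congr fun n => ?_
  rw [Measure.map_apply hR (measurableSet_singleton n), Measure.restrict_apply
    (hR (measurableSet_singleton n)), mul_comm, Set.inter_comm]
  rfl

/-- Integrating out independent marks. -/
lemma lintegral_infProd_marks (hX : ∀ k, Measurable (X k)) (hM : ∀ k, Measurable (M k))
    (hMi : iIndepFun M P) (hQ : ∀ k, P.map (M k) = Q)
    (hXM : IndepFun (fun ω k => X k ω) (fun ω k => M k ω) P) {f : ℕ → ℝ × 𝓜 → ℝ≥0∞}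
    (hf : ∀ k, Measurable (f k)) (hf1 : ∀ k p, f k p ≤ 1) :
    ∫⁻ ω, infProd (fun k => f k (X k ω, M k ω)) ∂P =
      ∫⁻ ω, infProd (fun k => ∫⁻ m, f k (X k ω, m) ∂Q) ∂P := by
  have hmeas : Measurable fun p : (ℕ → ℝ) × (ℕ → 𝓜) => infProd fun k => f k (p.1 k, p.2 k) :=
    measurable_infProd fun k => (hf k).comp (by fun_prop)
  rw [lintegral_comp_of_indepFun (measurable_pi_iff.2 hX) (measurable_pi_iff.2 hM) hXM
    (f := fun p => infProd fun k => f k (p.1 k, p.2 k)) hmeas]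
  refine lintegral_congr fun ω => ?_
  dsimp only [infProd]
  have hm : ∀ k, Measurable fun ω' => f k (X k ω, M k ω') := fun k =>
    (hf k).comp (measurable_const.prodMk (hM k))
  -- The partial products decrease from `1`, so integral and infimum commute; with the points fixed,
  -- the marks then factor by independence.
  rw [lintegral_iInf (fun n => Finset.measurable_prod _ fun k _ => hm k)
    (fun m n hmn ω' => antitone_prod_range (fun k => hf1 k _) hmn) (by simp)]
  refine iInf_congr fun n => ?_
  rw [lintegral_prod_eq_prod_lintegral_of_indepFun (Finset.range n)
    (fun k ω' => f k (X k ω, M k ω'))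
    (hMi.comp (fun k m => f k (X k ω, m)) fun k => (hf k).comp (by fun_prop)) hm]
  refine Finset.prod_congr rfl fun k _ => ?_
  rw [← hQ k, lintegral_map (f := fun m => f k (X k ω, m)) ((hf k).comp (by fun_prop)) (hM k)]

/-- The Mecke equation for the number of points contributed by the other clusters, when the
cluster of a point `x` with mark `m` contributes `c x m` points. -/
lemma mecke_marks (hX : IsPoissonProcess P lam X) (hM : ∀ k, Measurable (M k))
    (hMi : iIndepFun M P) (hQ : ∀ k, P.map (M k) = Q)
    (hXM : IndepFun (fun ω k => X k ω) (fun ω k => M k ω) P) {c : ℝ × 𝓜 → ℕ}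
    (hc : Measurable c) {K : Set ℝ} (hK : Bornology.IsBounded K)
    (hcK : ∀ x ∉ K, ∀ᵐ m ∂Q, c (x, m) = 0) {N : Ω → ℕ} (hN : Measurable N)
    {R : ℕ → Ω → ℕ} (hR : ∀ i, Measurable (R i))
    (hNc : ∀ᵐ ω ∂P, ∀ u : ℝ≥0∞, u ≤ 1 → u ^ N ω = infProd fun k => u ^ c (X k ω, M k ω))
    (hRc : ∀ᵐ ω ∂P, ∀ i, ∀ u : ℝ≥0∞, u ≤ 1 →
      u ^ R i ω = infProd (Function.update (fun k => u ^ c (X k ω, M k ω)) i 1))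
    {B : Set ℝ} (hB : MeasurableSet B) (hBb : Bornology.IsBounded B) {E : Set 𝓜}
    (hE : MeasurableSet E) (n : ℕ) :
    ∑' i, P ((X i ⁻¹' B ∩ M i ⁻¹' E) ∩ {ω | R i ω = n}) =
      ENNReal.ofReal lam * volume B * Q E * P {ω | N ω = n} := by
  have hS : ∀ i, MeasurableSet (X i ⁻¹' B ∩ M i ⁻¹' E) := fun i =>
    (hX.measurable i hB).inter (hM i hE)
  -- Both sides are compared through generating functions in `u`, because the Mecke equation is
  -- available for product functionals only.
  have key : ∀ u : ℝ≥0∞, u ≤ 1 →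
      ∑' n, (∑' i, P ((X i ⁻¹' B ∩ M i ⁻¹' E) ∩ {ω | R i ω = n})) * u ^ n =
        ∑' n, (ENNReal.ofReal lam * volume B * Q E * P {ω | N ω = n}) * u ^ n := by
    intro u hu
    have hu1 : ∀ k : ℕ, u ^ k ≤ 1 := fun k => pow_le_one' hu k
    set g : ℝ → ℝ≥0∞ := fun x => ∫⁻ m, u ^ c (x, m) ∂Q
    have hpow : Measurable fun p => u ^ c p := Measurable.of_discrete.comp hc
    have hg : Measurable g := hpow.lintegral_prod_right'
    have hg1 : ∀ x, g x ≤ 1 := fun x =>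
      (lintegral_mono fun m => hu1 _).trans (by simp)
    have hgK : ∀ x ∉ K, g x = 1 := by
      intro x hx
      have : g x = ∫⁻ _, 1 ∂Q := lintegral_congr_ae ((hcK x hx).mono fun m hm => by simp [hm])
      simpa using this
    have h1 : ∀ i, ∫⁻ ω, (X i ⁻¹' B ∩ M i ⁻¹' E).indicator 1 ω * u ^ R i ω ∂P =
        Q E * ∫⁻ ω, B.indicator 1 (X i ω) *
          infProd (Function.update (fun k => g (X k ω)) i 1) ∂P := by
      intro i
      -- Replacing the `i`-th factor by the indicator of `B ×ˢ E` makes the restriction on the point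
      -- and its mark part of the product functional.
      let f : ℕ → ℝ × 𝓜 → ℝ≥0∞ := Function.update (fun _ p => u ^ c p) i
        ((B ×ˢ E).indicator 1)
      have hf : ∀ k, Measurable (f k) := by
        intro k
        rcases eq_or_ne k i with rfl | hk
        · simpa [f] using measurable_one.indicator (hB.prod hE)
        · simpa [f, hk] using hpow
      have hf1 : ∀ k p, f k p ≤ 1 := by
        intro k p
        rcases eq_or_ne k i with rfl | hk
        · simpa [f] using! Set.indicator_le_self (B ×ˢ E) (1 : ℝ × 𝓜 → ℝ≥0∞) p
        · simpa [f, hk] using hu1 _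
      have h2 := lintegral_infProd_marks hX.measurable hM hMi hQ hXM hf hf1
      have h3 : ∀ᵐ ω ∂P, infProd (fun k => f k (X k ω, M k ω)) =
          (X i ⁻¹' B ∩ M i ⁻¹' E).indicator 1 ω * u ^ R i ω := by
        filter_upwards [hRc] with ω hω
        rw [hω i u hu]
        have : (X i ⁻¹' B ∩ M i ⁻¹' E).indicator 1 ω =
          (B ×ˢ E).indicator (1 : ℝ × 𝓜 → ℝ≥0∞) (X i ω, M i ω) := rfl
        rw [this, ← infProd_update]
        · congr 1
          funext k
          rcases eq_or_ne k i with rfl | hk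
          · simp [f]
          · simp [f, hk]
        · exact fun k => hu1 _
        · exact Set.indicator_le_self (B ×ˢ E) (1 : ℝ × 𝓜 → ℝ≥0∞) _
      have h4 : ∀ ω, infProd (fun k => ∫⁻ m, f k (X k ω, m) ∂Q) =
          infProd (Function.update (fun k => g (X k ω)) i (B.indicator 1 (X i ω) * Q E)) := by
        intro ω
        congr 1
        funext k
        rcases eq_or_ne k i with rfl | hk
        · simp only [f, Function.update_self]
          by_cases h : X k ω ∈ B
          · simp only [Set.indicator_of_mem h, Pi.one_apply, one_mul]
            rw [← lintegral_indicator_one hE]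
            refine lintegral_congr fun m => ?_
            by_cases hm : m ∈ E <;> simp [h, hm]
          · simp [h]
        · simp [f, hk, g]
      have hBm : Measurable fun ω => B.indicator (1 : ℝ → ℝ≥0∞) (X i ω) *
          infProd (Function.update (fun k => g (X k ω)) i 1) :=
        ((measurable_one.indicator hB).comp (hX.measurable i)).mul
          (hX.measurable_infProd_update hg i)
      rw [← lintegral_congr_ae h3, h2, ← lintegral_const_mul _ hBm]
      refine lintegral_congr fun ω => ?_
      have hBE : B.indicator 1 (X i ω) * Q E ≤ 1 :=
        mul_le_one' (Set.indicator_le_self B (1 : ℝ → ℝ≥0∞) _) prob_le_one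
      rw [h4, infProd_update (fun k => hg1 _) i hBE]
      ring
    have h5 : ∫⁻ ω, u ^ N ω ∂P = ∫⁻ ω, infProd (fun k => g (X k ω)) ∂P := by
      rw [← lintegral_infProd_marks hX.measurable hM hMi hQ hXM (f := fun _ p => u ^ c p)
        (fun _ => hpow) fun _ p => hu1 _]
      exact lintegral_congr_ae (hNc.mono fun ω hω => hω u hu)
    simp_rw [← ENNReal.tsum_mul_right]
    rw [ENNReal.tsum_comm]
    simp_rw [← lintegral_setOf_mul_pow (hS _) (hR _) u, h1, mul_assoc]
    rw [ENNReal.tsum_mul_left, ENNReal.tsum_mul_left, ENNReal.tsum_mul_left,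
      ENNReal.tsum_mul_left, hX.mecke hg hg1 hK hgK hB hBb, ← h5]
    have h6 := lintegral_setOf_mul_pow (P := P) MeasurableSet.univ hN u
    simp only [Set.indicator_univ, Pi.one_apply, one_mul, Set.univ_inter] at h6
    rw [h6]
    ring
  have hfin : ∑' n, (ENNReal.ofReal lam * volume B * Q E * P {ω | N ω = n}) ≠ ∞ := by
    rw [ENNReal.tsum_mul_left]
    refine ENNReal.mul_ne_top (ENNReal.mul_ne_top (ENNReal.mul_ne_top ENNReal.ofReal_ne_top
      hBb.measure_lt_top.ne) (measure_ne_top _ _)) ?_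
    have h6 := lintegral_setOf_mul_pow (P := P) MeasurableSet.univ hN 1
    simp only [Set.indicator_univ, Pi.one_apply, Set.univ_inter, one_pow, mul_one,
      lintegral_one, measure_univ] at h6
    simp [← h6]
  have h1 := key 1 le_rfl
  simp only [one_pow, mul_one] at h1
  exact congrFun (eq_of_tsum_mul_pow_eq (h1 ▸ hfin) hfin key) n

/-- The Mecke equation for functionals of a point, its mark, and the number of points
contributed by the other clusters. -/
lemma lintegral_mecke_marks (hX : IsPoissonProcess P lam X) (hM : ∀ k, Measurable (M k))
    (hMi : iIndepFun M P) (hQ : ∀ k, P.map (M k) = Q)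
    (hXM : IndepFun (fun ω k => X k ω) (fun ω k => M k ω) P) {c : ℝ × 𝓜 → ℕ}
    (hc : Measurable c) {K : Set ℝ} (hK : Bornology.IsBounded K)
    (hcK : ∀ x ∉ K, ∀ᵐ m ∂Q, c (x, m) = 0) {N : Ω → ℕ} (hN : Measurable N)
    {R : ℕ → Ω → ℕ} (hR : ∀ i, Measurable (R i))
    (hNc : ∀ᵐ ω ∂P, ∀ u : ℝ≥0∞, u ≤ 1 → u ^ N ω = infProd fun k => u ^ c (X k ω, M k ω))
    (hRc : ∀ᵐ ω ∂P, ∀ i, ∀ u : ℝ≥0∞, u ≤ 1 →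
      u ^ R i ω = infProd (Function.update (fun k => u ^ c (X k ω, M k ω)) i 1))
    {Ψ : ℝ × 𝓜 → ℕ → ℝ≥0∞} (hΨ : ∀ n, Measurable fun p => Ψ p n) :
    ∑' i, ∫⁻ ω, Ψ (X i ω, M i ω) (R i ω) ∂P =
      ENNReal.ofReal lam * ∫⁻ x, ∫⁻ m, ∫⁻ ω, Ψ (x, m) (N ω) ∂P ∂Q := by
  have hXMm : ∀ i, Measurable fun ω => (X i ω, M i ω) := fun i =>
    (hX.measurable i).prodMk (hM i)
  have hRn : ∀ i n, MeasurableSet {ω | R i ω = n} := fun i n => hR i (measurableSet_singleton n)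
  -- On `{R i = n}` the pairs of a point and its mark have a product intensity: `mecke_marks`
  -- evaluates it on a generating family of rectangles.
  have hmeas : ∀ n, volume.prod ((ENNReal.ofReal lam * P {ω | N ω = n}) • Q) =
      Measure.sum fun i => (P.restrict {ω | R i ω = n}).map fun ω => (X i ω, M i ω) := by
    intro n
    have : IsFiniteMeasure ((ENNReal.ofReal lam * P {ω | N ω = n}) • Q) :=
      Measure.smul_finite _ (ENNReal.mul_ne_top ENNReal.ofReal_ne_top (measure_ne_top _ _))
    refine Measure.prod_eq_generateFrom generateFrom_boundedBorelSets
      MeasurableSpace.generateFrom_measurableSet isPiSystem_boundedBorelSets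
      MeasurableSpace.isPiSystem_measurableSet spanningBoundedBorelSets
      (Measure.toFiniteSpanningSetsIn _) fun B hB E hE => ?_
    rw [Measure.sum_apply _ (hB.1.prod hE)]
    have h1 : ∀ i, ((P.restrict {ω | R i ω = n}).map fun ω => (X i ω, M i ω)) (B ×ˢ E) =
        P ((X i ⁻¹' B ∩ M i ⁻¹' E) ∩ {ω | R i ω = n}) := by
      intro i
      rw [Measure.map_apply (hXMm i) (hB.1.prod hE), Measure.restrict_apply
        (hXMm i (hB.1.prod hE))]
      rfl
    simp_rw [h1]
    rw [mecke_marks hX hM hMi hQ hXM hc hK hcK hN hR hNc hRc hB.1 hB.2 hE n,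
      Measure.smul_apply, smul_eq_mul]
    ring
  have h1 : ∀ i, ∫⁻ ω, Ψ (X i ω, M i ω) (R i ω) ∂P =
      ∑' n, ∫⁻ ω in {ω | R i ω = n}, Ψ (X i ω, M i ω) n ∂P := by
    intro i
    have hd : Pairwise (Function.onFun Disjoint fun n => {ω | R i ω = n}) := fun m n hmn =>
      Set.disjoint_left.2 fun ω hm hn => hmn (hm.symm.trans hn)
    have hU : ⋃ n, {ω | R i ω = n} = Set.univ := by
      ext ω
      simp
    rw [← setLIntegral_univ, ← hU, lintegral_iUnion (hRn i) hd]
    exact tsum_congr fun n => setLIntegral_congr_fun (hRn i n) fun ω hω => by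
      rw [show R i ω = n from hω]
  have h2 : ∀ n, ∑' i, ∫⁻ ω in {ω | R i ω = n}, Ψ (X i ω, M i ω) n ∂P =
      ENNReal.ofReal lam * P {ω | N ω = n} * ∫⁻ x, ∫⁻ m, Ψ (x, m) n ∂Q := by
    intro n
    have : IsFiniteMeasure ((ENNReal.ofReal lam * P {ω | N ω = n}) • Q) :=
      Measure.smul_finite _ (ENNReal.mul_ne_top ENNReal.ofReal_ne_top (measure_ne_top _ _))
    simp_rw [← fun i => lintegral_map (μ := P.restrict {ω | R i ω = n}) (hΨ n) (hXMm i)]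
    rw [← lintegral_sum_measure, ← hmeas n, lintegral_prod _ (hΨ n).aemeasurable]
    simp_rw [lintegral_smul_measure, smul_eq_mul]
    rw [lintegral_const_mul _ (hΨ n).lintegral_prod_right']
  have h3 : ∀ x m, ∫⁻ ω, Ψ (x, m) (N ω) ∂P = ∑' n, P {ω | N ω = n} * Ψ (x, m) n := by
    intro x m
    rw [← lintegral_map (f := fun n => Ψ (x, m) n) .of_discrete hN, lintegral_countable']
    refine tsum_congr fun n => ?_
    rw [Measure.map_apply hN (measurableSet_singleton n), mul_comm]
    rfl
  simp_rw [h1]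
  rw [ENNReal.tsum_comm]
  simp_rw [h2, h3]
  have h4 : ∀ x, ∫⁻ m, ∑' n, P {ω | N ω = n} * Ψ (x, m) n ∂Q =
      ∑' n, P {ω | N ω = n} * ∫⁻ m, Ψ (x, m) n ∂Q := by
    intro x
    have hx : ∀ n, Measurable fun m => Ψ (x, m) n := fun n =>
      (hΨ n).comp measurable_prodMk_left
    rw [lintegral_tsum fun n => ((hx n).const_mul _).aemeasurable]
    exact tsum_congr fun n => lintegral_const_mul _ (hx n)
  simp_rw [h4]
  rw [lintegral_tsum fun n => ((hΨ n).lintegral_prod_right'.const_mul _).aemeasurable,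
    ← ENNReal.tsum_mul_left]
  refine tsum_congr fun n => ?_
  rw [lintegral_const_mul _ (hΨ n).lintegral_prod_right', mul_assoc]

end Marks

/-! ### Regrouping independent families. -/

section Independence

variable {Ω : Type*} [MeasurableSpace Ω] {P : Measure Ω} [IsProbabilityMeasure P]
  {α β γ : Type*} [MeasurableSpace α] [MeasurableSpace β] [MeasurableSpace γ]

/-- Associativity of product measures. It serves to merge sizes and displacements into marks, and
then centres and marks into the vehicles. -/
lemma indepFun_prodMk_right_of_prodMk_left {A : Ω → α} {B : Ω → β} {C : Ω → γ}
    (hA : Measurable A) (hB : Measurable B) (hC : Measurable C) (hAB : IndepFun A B P)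
    (hABC : IndepFun (fun ω => (A ω, B ω)) C P) : IndepFun A (fun ω => (B ω, C ω)) P := by
  have hBC : IndepFun B C P := hABC.comp measurable_snd measurable_id
  have h1 := (indepFun_iff_map_prod_eq_prod_map_map hA.aemeasurable hB.aemeasurable).1 hAB
  have h2 := (indepFun_iff_map_prod_eq_prod_map_map hB.aemeasurable hC.aemeasurable).1 hBC
  have h3 := (indepFun_iff_map_prod_eq_prod_map_map (hA.prodMk hB).aemeasurable
    hC.aemeasurable).1 hABC
  refine (indepFun_iff_map_prod_eq_prod_map_map hA.aemeasurable
    (hB.prodMk hC).aemeasurable).2 ?_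
  have := Measure.isProbabilityMeasure_map (μ := P) hA.aemeasurable
  have := Measure.isProbabilityMeasure_map (μ := P) hB.aemeasurable
  have := Measure.isProbabilityMeasure_map (μ := P) hC.aemeasurable
  rw [h2, ← Measure.prodAssoc_prod, ← h1, ← h3,
    Measure.map_map MeasurableEquiv.prodAssoc.measurable ((hA.prodMk hB).prodMk hC)]
  rfl

/-- Pairing two independent families of independent random variables. -/
lemma iIndepFun_prodMk {ι : Type*} {A : ι → Ω → α} {B : ι → Ω → β}
    (hA : ∀ i, Measurable (A i)) (hB : ∀ i, Measurable (B i)) (hAi : iIndepFun A P)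
    (hBi : iIndepFun B P) (hAB : IndepFun (fun ω i => A i ω) (fun ω i => B i ω) P) :
    iIndepFun (fun i ω => (A i ω, B i ω)) P := by
  refine iIndepFun_iff_measure_inter_preimage_eq_mul.2 fun S s hs => ?_
  have hind : ∀ i ∈ S, Measurable ((s i).indicator (1 : α × β → ℝ≥0∞)) := fun i hi =>
    measurable_one.indicator (hs i hi)
  -- Measurability of `s i` is known for `i ∈ S` only; elsewhere the factor is taken to be `1`.
  let f : ι → α × β → ℝ≥0∞ := fun i => open Classical in if i ∈ S then (s i).indicator 1 else 1
  have hf : ∀ i, Measurable (f i) := by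
    intro i
    by_cases hi : i ∈ S
    · simpa [f, hi] using hind i hi
    · simpa [f, hi] using measurable_one
  have hfS : ∀ i ∈ S, f i = (s i).indicator 1 := fun i hi => by simp [f, hi]
  have h1 : ∀ ω, (⋂ i ∈ S, (fun ω => (A i ω, B i ω)) ⁻¹' s i).indicator (1 : Ω → ℝ≥0∞) ω =
      ∏ i ∈ S, f i (A i ω, B i ω) := by
    intro ω
    by_cases h : ∀ i ∈ S, (A i ω, B i ω) ∈ s i
    · rw [Set.indicator_of_mem (by simpa using h), Finset.prod_eq_one]
      · rfl
      · intro i hi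
        rw [hfS i hi, Set.indicator_of_mem (h i hi)]
        rfl
    · rw [Set.indicator_of_notMem (by simpa using h)]
      push Not at h
      obtain ⟨i, hi, his⟩ := h
      rw [Finset.prod_eq_zero hi]
      rw [hfS i hi, Set.indicator_of_notMem his]
  have hm : MeasurableSet (⋂ i ∈ S, (fun ω => (A i ω, B i ω)) ⁻¹' s i) :=
    S.measurableSet_biInter fun i hi => ((hA i).prodMk (hB i)) (hs i hi)
  have h2 : ∀ i, ∫⁻ ω, f i (A i ω, B i ω) ∂P = ∫⁻ ω, ∫⁻ ω', f i (A i ω, B i ω') ∂P ∂P :=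
    fun i => lintegral_comp_of_indepFun (hA i) (hB i)
      (hAB.comp (measurable_pi_apply i) (measurable_pi_apply i)) (hf i)
  rw [← lintegral_indicator_one hm]
  simp_rw [h1]
  rw [lintegral_comp_of_indepFun (measurable_pi_iff.2 hA) (measurable_pi_iff.2 hB) hAB
    (f := fun p => ∏ i ∈ S, f i (p.1 i, p.2 i))
    (Finset.measurable_prod _ fun i _ => (hf i).comp (by fun_prop))]
  have h3 : ∀ ω, ∫⁻ ω', ∏ i ∈ S, f i (A i ω, B i ω') ∂P =
      ∏ i ∈ S, ∫⁻ ω', f i (A i ω, B i ω') ∂P := fun ω =>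
    lintegral_prod_eq_prod_lintegral_of_indepFun S (fun i ω' => f i (A i ω, B i ω'))
      (hBi.comp (fun i b => f i (A i ω, b)) fun i => (hf i).comp (by fun_prop))
      fun i => (hf i).comp (measurable_const.prodMk (hB i))
  have hg : ∀ i, Measurable fun x => ∫⁻ ω', f i (x, B i ω') ∂P := fun i =>
    Measurable.lintegral_prod_right' (f := fun p : α × Ω => f i (p.1, B i p.2))
      ((hf i).comp (measurable_fst.prodMk ((hB i).comp measurable_snd)))
  simp_rw [h3]
  rw [lintegral_prod_eq_prod_lintegral_of_indepFun S
    (fun i ω => ∫⁻ ω', f i (A i ω, B i ω') ∂P) (hAi.comp _ hg) fun i => (hg i).comp (hA i)]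
  refine Finset.prod_congr rfl fun i hi => ?_
  rw [← h2, hfS i hi, ← lintegral_indicator_one (((hA i).prodMk (hB i)) (hs i hi))]
  rfl

/-- Independence means that the joint law is an infinite product, and currying a product over pairs
gives a product of products. -/
lemma iIndepFun_rows {ι κ : Type*} {A : ι → κ → Ω → α}
    (hA : ∀ i j, Measurable (A i j)) (h : iIndepFun (fun p : ι × κ => A p.1 p.2) P) :
    iIndepFun (fun i ω j => A i j ω) P := by
  have hp : ∀ i j, IsProbabilityMeasure (P.map (A i j)) := fun i j =>
    Measure.isProbabilityMeasure_map (hA i j).aemeasurable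
  have h1 := h.map_fun_eq_infinitePi_map fun p : ι × κ => hA p.1 p.2
  refine (iIndepFun_iff_map_fun_eq_infinitePi_map fun i => measurable_pi_iff.2 (hA i)).2 ?_
  have h2 : ∀ i, P.map (fun ω j => A i j ω) = Measure.infinitePi fun j => P.map (A i j) :=
    fun i => (h.precomp (g := fun j => (i, j)) fun j j' hj => by simpa using hj)
      |>.map_fun_eq_infinitePi_map fun j => hA i j
  simp_rw [h2]
  rw [← Measure.infinitePi_map_curry, ← h1, Measure.map_map (MeasurableEquiv.measurable _)
    (measurable_pi_iff.2 fun p : ι × κ => hA p.1 p.2)]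
  rfl

end Independence

/-- The count splits over the first coordinates `k`; a finite set meets only finitely many of them,
and the others contribute the factor `1`. -/
lemma pow_ncard_eq_infProd {S : Set (ℕ × ℕ)} (hS : S.Finite) {u : ℝ≥0∞} (hu : u ≤ 1) :
    u ^ S.ncard = infProd fun k => u ^ {j | (k, j) ∈ S}.ncard := by
  classical
  have hfib : ∀ k, {j | (k, j) ∈ S}.ncard = (hS.toFinset.filter fun q => q.1 = k).card := by
    intro k
    rw [← Set.ncard_coe_finset, ← Set.ncard_image_of_injective {j | (k, j) ∈ S}
      (f := fun j => (k, j)) fun j j' h => by simpa using h]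
    congr 1
    ext ⟨k', j⟩
    simp only [Set.mem_image, Finset.coe_filter, Set.Finite.mem_toFinset]
    constructor
    · rintro ⟨j', h1, h2⟩
      obtain ⟨rfl, rfl⟩ := Prod.mk.inj h2
      exact ⟨h1, rfl⟩
    · rintro ⟨h1, rfl⟩
      exact ⟨j, h1, rfl⟩
  rw [infProd_eq_prod (fun k => pow_le_one' hu _) (s := hS.toFinset.image Prod.fst),
    Finset.prod_pow_eq_pow_sum]
  · simp_rw [hfib]
    rw [← Finset.card_eq_sum_card_image, Set.ncard_eq_toFinset_card _ hS]
  · intro k hk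
    rw [hfib, Finset.card_eq_zero.2, pow_zero]
    refine Finset.filter_eq_empty_iff.2 fun q hq hqk => hk ?_
    exact Finset.mem_image.2 ⟨q, hq, hqk⟩

/-! ### Platoons as marked points, and stationarity of the vehicle process. -/

namespace Highway

variable {Ω : Type*} (H : Highway Ω)

/-- The size and the displacements of a platoon. -/
def mark (i : ℕ) (ω : Ω) : ℕ × (ℕ → ℝ) := (H.size i ω, fun j => H.disp i j ω)

/-- The number of vehicles in `I` of a platoon with given centre, size and displacements. -/
noncomputable def platoonCount (I : Set ℝ) (p : ℝ × ℕ × (ℕ → ℝ)) : ℕ :=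
  {j | j < p.2.1 ∧ p.1 + p.2.2 j ∈ I}.ncard

/-- The number of vehicles in `I`. -/
noncomputable def count (I : Set ℝ) (ω : Ω) : ℕ := {q | q ∈ H.vehicles ω ∧ H.pos q ω ∈ I}.ncard

/-- The number of vehicles in `I` not belonging to the `i`-th platoon. -/
noncomputable def countOthers (I : Set ℝ) (i : ℕ) (ω : Ω) : ℕ :=
  {q | q ∈ H.vehicles ω ∧ q.1 ≠ i ∧ H.pos q ω ∈ I}.ncard

lemma measurable_platoonCount {I : Set ℝ} (hI : MeasurableSet I) :
    Measurable (platoonCount I) := by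
  refine measurable_ncard_setOf fun j => MeasurableSet.inter ?_ ?_
  · exact measurableSet_lt measurable_const
      (measurable_fst.comp measurable_snd : Measurable fun p : ℝ × ℕ × (ℕ → ℝ) => p.2.1)
  · exact (by fun_prop : Measurable fun p : ℝ × ℕ × (ℕ → ℝ) => p.1 + p.2.2 j) hI

variable {H} [MeasurableSpace Ω] {P : Measure Ω} [IsProbabilityMeasure P] {lamR lamP m a : ℝ}

namespace IsPlatooned

lemma measurable_mark (hH : H.IsPlatooned P lamR lamP m a) (i : ℕ) : Measurable (H.mark i) :=
  (hH.measurable_size i).prodMk (measurable_pi_iff.2 (hH.measurable_disp i))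

lemma measurable_pos (hH : H.IsPlatooned P lamR lamP m a) (q : ℕ × ℕ) : Measurable (H.pos q) :=
  (hH.parent_poisson.measurable _).add (hH.measurable_disp _ _)

lemma measurableSet_vehicles (hH : H.IsPlatooned P lamR lamP m a) (q : ℕ × ℕ) :
    MeasurableSet {ω | q ∈ H.vehicles ω} :=
  measurableSet_lt measurable_const (hH.measurable_size q.1)

lemma measurable_rsu_fun (hH : H.IsPlatooned P lamR lamP m a) :
    Measurable fun ω i => H.rsu i ω := measurable_pi_iff.2 hH.rsu_poisson.measurable

lemma measurable_parent_fun (hH : H.IsPlatooned P lamR lamP m a) :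
    Measurable fun ω i => H.parent i ω := measurable_pi_iff.2 hH.parent_poisson.measurable

lemma measurable_size_fun (hH : H.IsPlatooned P lamR lamP m a) :
    Measurable fun ω i => H.size i ω := measurable_pi_iff.2 hH.measurable_size

lemma measurable_disp_fun (hH : H.IsPlatooned P lamR lamP m a) :
    Measurable fun ω (p : ℕ × ℕ) => H.disp p.1 p.2 ω :=
  measurable_pi_iff.2 fun p => hH.measurable_disp p.1 p.2

lemma measurable_mark_fun (hH : H.IsPlatooned P lamR lamP m a) :
    Measurable fun ω i => H.mark i ω := measurable_pi_iff.2 hH.measurable_mark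

lemma indepFun_points_marks (hH : H.IsPlatooned P lamR lamP m a) :
    IndepFun (fun ω => (fun i => H.rsu i ω, fun i => H.parent i ω)) (fun ω i => H.mark i ω) P := by
  have h : IndepFun (fun ω => ((fun i => H.rsu i ω, fun i => H.parent i ω),
      fun i => H.size i ω)) (fun ω (p : ℕ × ℕ) => H.disp p.1 p.2 ω) P :=
    hH.indep_points_size_disp.comp (φ := fun q : (ℕ → ℝ) × (ℕ → ℝ) × (ℕ → ℕ) =>
      ((q.1, q.2.1), q.2.2)) (by fun_prop) measurable_id
  refine (indepFun_prodMk_right_of_prodMk_left (hH.measurable_rsu_fun.prodMk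
    hH.measurable_parent_fun) hH.measurable_size_fun hH.measurable_disp_fun
    hH.indep_points_size h).comp (ψ := fun (q : (ℕ → ℕ) × (ℕ × ℕ → ℝ)) (i : ℕ) =>
      (q.1 i, fun j : ℕ => q.2 (i, j))) measurable_id (by fun_prop)

lemma indepFun_rsu_vehicles (hH : H.IsPlatooned P lamR lamP m a) :
    IndepFun (fun ω i => H.rsu i ω) (fun ω => (fun i => H.parent i ω, fun i => H.mark i ω)) P :=
  indepFun_prodMk_right_of_prodMk_left hH.measurable_rsu_fun hH.measurable_parent_fun
    hH.measurable_mark_fun hH.indep_rsu_parent hH.indepFun_points_marks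

lemma indepFun_parent_marks (hH : H.IsPlatooned P lamR lamP m a) :
    IndepFun (fun ω i => H.parent i ω) (fun ω i => H.mark i ω) P :=
  hH.indepFun_points_marks.comp measurable_snd measurable_id

lemma indepFun_size_disp (hH : H.IsPlatooned P lamR lamP m a) :
    IndepFun (fun ω i => H.size i ω) (fun ω (p : ℕ × ℕ) => H.disp p.1 p.2 ω) P :=
  hH.indep_points_size_disp.comp (φ := fun q : (ℕ → ℝ) × (ℕ → ℝ) × (ℕ → ℕ) => q.2.2)
    (by fun_prop) measurable_id

lemma iIndepFun_mark (hH : H.IsPlatooned P lamR lamP m a) : iIndepFun H.mark P :=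
  iIndepFun_prodMk hH.measurable_size (fun i => measurable_pi_iff.2 (hH.measurable_disp i))
    hH.indep_size (iIndepFun_rows hH.measurable_disp hH.indep_disp)
    (hH.indepFun_size_disp.comp (ψ := fun (q : ℕ × ℕ → ℝ) (i j : ℕ) => q (i, j))
      measurable_id (by fun_prop))

lemma iIndepFun_disp (hH : H.IsPlatooned P lamR lamP m a) (i : ℕ) : iIndepFun (H.disp i) P :=
  hH.indep_disp.precomp (g := fun j => (i, j)) fun j j' hj => by simpa using hj

/-- Injective relabelling preserves the law of i.i.d. displacements. The identity compares platoons;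
a transposition makes a chosen vehicle the last of its platoon. -/
lemma map_disp_fun (hH : H.IsPlatooned P lamR lamP m a) (i : ℕ) {σ : ℕ → ℕ}
    (hσ : Function.Injective σ) :
    P.map (fun ω j => H.disp i (σ j) ω) = P.map (fun ω j => H.disp 0 j ω) := by
  rw [((hH.iIndepFun_disp i).precomp hσ).map_fun_eq_infinitePi_map fun j =>
      hH.measurable_disp i (σ j),
    (hH.iIndepFun_disp 0).map_fun_eq_infinitePi_map (hH.measurable_disp 0)]
  congr 1
  funext j
  exact (hH.disp_law i (σ j)).trans (hH.disp_law 0 j).symm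

lemma map_mark (hH : H.IsPlatooned P lamR lamP m a) (i : ℕ) :
    P.map (H.mark i) = P.map (H.mark 0) := by
  have h : ∀ i, P.map (H.mark i) =
      (P.map (H.size i)).prod (P.map fun ω j => H.disp i j ω) := fun i =>
    (indepFun_iff_map_prod_eq_prod_map_map (hH.measurable_size i).aemeasurable
      (measurable_pi_iff.2 (hH.measurable_disp i)).aemeasurable).1
      (hH.indepFun_size_disp.comp (φ := fun q : ℕ → ℕ => q i)
        (ψ := fun (q : ℕ × ℕ → ℝ) (j : ℕ) => q (i, j)) (by fun_prop) (by fun_prop))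
  rw [h i, h 0, hH.size_law i, hH.size_law 0]
  exact congrArg _ (hH.map_disp_fun i Function.injective_id)

lemma ae_disp_mem (hH : H.IsPlatooned P lamR lamP m a) :
    ∀ᵐ ω ∂P, ∀ i j, H.disp i j ω ∈ Set.Icc (-a) a := by
  refine ae_all_iff.2 fun i => ae_all_iff.2 fun j => ?_
  have h : ∀ᵐ x ∂(P.map (H.disp i j)), x ∈ Set.Icc (-a) a := by
    rw [hH.disp_law i j]
    exact ae_cond_mem measurableSet_Icc
  exact ae_of_ae_map (hH.measurable_disp i j).aemeasurable h

/-- Displacements are at most `a`, so vehicles within `r` of the origin belong to the finitely many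
platoons centred within `r + a`. -/
lemma ae_finite_vehicles (hH : H.IsPlatooned P lamR lamP m a) :
    ∀ᵐ ω ∂P, ∀ I : Set ℝ, Bornology.IsBounded I →
      {q | q ∈ H.vehicles ω ∧ H.pos q ω ∈ I}.Finite := by
  filter_upwards [hH.ae_disp_mem, hH.parent_poisson.ae_locallyFinite] with ω hω hX I hI
  obtain ⟨r, hr⟩ := hI.subset_closedBall 0
  have hfin := hX (Metric.closedBall 0 (r + a)) Metric.isBounded_closedBall
  refine (hfin.biUnion (t := fun k => (fun j => (k, j)) '' Set.Iio (H.size k ω))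
    fun k _ => (Set.finite_Iio _).image _).subset ?_
  rintro ⟨k, j⟩ ⟨hq, hpos⟩
  refine Set.mem_biUnion (x := k) ?_ ⟨j, hq, rfl⟩
  have h1 := hr hpos
  have h2 := hω k j
  rw [Metric.mem_closedBall, Real.dist_eq, sub_zero, abs_le] at h1
  show H.parent k ω ∈ Metric.closedBall 0 (r + a)
  rw [Metric.mem_closedBall, Real.dist_eq, sub_zero, abs_le]
  dsimp only [pos] at h1
  constructor <;> linarith [h2.1, h2.2, h1.1, h1.2]

lemma measurable_count (hH : H.IsPlatooned P lamR lamP m a) {I : Set ℝ} (hI : MeasurableSet I) :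
    Measurable (H.count I) :=
  measurable_ncard_setOf fun q => (hH.measurableSet_vehicles q).inter (hH.measurable_pos q hI)

lemma measurable_countOthers (hH : H.IsPlatooned P lamR lamP m a) {I : Set ℝ}
    (hI : MeasurableSet I) (i : ℕ) : Measurable (H.countOthers I i) :=
  measurable_ncard_setOf fun q => (hH.measurableSet_vehicles q).inter
    ((MeasurableSet.const _).inter (hH.measurable_pos q hI))

lemma ae_pow_count (hH : H.IsPlatooned P lamR lamP m a) {I : Set ℝ} (hI : Bornology.IsBounded I) :
    ∀ᵐ ω ∂P, ∀ u : ℝ≥0∞, u ≤ 1 → u ^ H.count I ω =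
      infProd fun k => u ^ platoonCount I (H.parent k ω, H.mark k ω) := by
  filter_upwards [hH.ae_finite_vehicles] with ω hω u hu
  exact pow_ncard_eq_infProd (hω I hI) hu

/-- The omitted platoon is a factor reset to `1`, the form in which the Mecke equation deletes a
point. -/
lemma ae_pow_countOthers (hH : H.IsPlatooned P lamR lamP m a) {I : Set ℝ}
    (hI : Bornology.IsBounded I) :
    ∀ᵐ ω ∂P, ∀ i, ∀ u : ℝ≥0∞, u ≤ 1 → u ^ H.countOthers I i ω =
      infProd (Function.update
        (fun k => u ^ platoonCount I (H.parent k ω, H.mark k ω)) i 1) := by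
  filter_upwards [hH.ae_finite_vehicles] with ω hω i u hu
  refine (pow_ncard_eq_infProd ((hω I hI).subset fun q hq => ⟨hq.1, hq.2.2⟩) hu).trans ?_
  congr 1
  funext k
  rcases eq_or_ne k i with rfl | hk
  · simp
  · rw [Function.update_of_ne hk]
    congr 2
    ext j
    simp [hk, mark, vehicles, pos]

lemma ae_platoonCount_eq_zero (hH : H.IsPlatooned P lamR lamP m a) {I : Set ℝ}
    (hI : MeasurableSet I) {r : ℝ} (hr : I ⊆ Metric.closedBall 0 r) :
    ∀ x ∉ Metric.closedBall (0 : ℝ) (r + a),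
      ∀ᵐ p ∂(P.map (H.mark 0)), platoonCount I (x, p) = 0 := by
  intro x hx
  have hm : Measurable fun p => platoonCount I (x, p) :=
    (measurable_platoonCount hI).comp measurable_prodMk_left
  refine (ae_map_iff (hH.measurable_mark 0).aemeasurable
    (hm (measurableSet_singleton 0))).2 ?_
  filter_upwards [hH.ae_disp_mem] with ω hω
  change platoonCount I (x, H.mark 0 ω) = 0
  rw [platoonCount, Set.ncard_eq_zero (Set.finite_Iio (H.size 0 ω) |>.subset fun j hj => hj.1)]
  refine Set.eq_empty_of_forall_notMem fun j hj => hx ?_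
  have h1 := hr hj.2
  have h2 := hω 0 j
  rw [Metric.mem_closedBall, Real.dist_eq, sub_zero, abs_le] at h1 ⊢
  dsimp only [mark] at h1
  constructor <;> linarith [h2.1, h2.2, h1.1, h1.2]

/-- The Mecke equation for the number of vehicles of the other platoons in a fixed set. -/
lemma lintegral_mecke (hH : H.IsPlatooned P lamR lamP m a) {I : Set ℝ} (hI : MeasurableSet I)
    (hIb : Bornology.IsBounded I) {Ψ : ℝ × ℕ × (ℕ → ℝ) → ℕ → ℝ≥0∞}
    (hΨ : ∀ n, Measurable fun p => Ψ p n) :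
    ∑' i, ∫⁻ ω, Ψ (H.parent i ω, H.mark i ω) (H.countOthers I i ω) ∂P =
      ENNReal.ofReal lamP *
        ∫⁻ x, ∫⁻ ω', ∫⁻ ω, Ψ (x, H.mark 0 ω') (H.count I ω) ∂P ∂P := by
  obtain ⟨r, hr⟩ := hIb.subset_closedBall 0
  have := Measure.isProbabilityMeasure_map (μ := P) (hH.measurable_mark 0).aemeasurable
  rw [lintegral_mecke_marks hH.parent_poisson hH.measurable_mark hH.iIndepFun_mark hH.map_mark
    hH.indepFun_parent_marks (measurable_platoonCount hI) Metric.isBounded_closedBall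
    (hH.ae_platoonCount_eq_zero hI hr) (hH.measurable_count hI) (hH.measurable_countOthers hI)
    (hH.ae_pow_count hIb) (hH.ae_pow_countOthers hIb) hΨ]
  congr 1
  refine lintegral_congr fun x => ?_
  rw [lintegral_map _ (hH.measurable_mark 0)]
  have hc := hH.measurable_count hI
  have h1 : Measurable fun q : (ℝ × ℕ × (ℕ → ℝ)) × ℕ => Ψ q.1 q.2 :=
    measurable_from_prod_countable_left hΨ
  exact Measurable.lintegral_prod_right' (f := fun q : (ℕ × (ℕ → ℝ)) × Ω =>
    Ψ (x, q.1) (H.count I q.2)) (h1.comp ((measurable_const.prodMk measurable_fst).prodMk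
      (hc.comp measurable_snd)))

lemma lintegral_pow_count (hH : H.IsPlatooned P lamR lamP m a) {I : Set ℝ} (hI : MeasurableSet I)
    (hIb : Bornology.IsBounded I) {u : ℝ≥0∞} (hu : u ≤ 1) :
    ∫⁻ ω, u ^ H.count I ω ∂P = ∫⁻ ω, infProd (fun k =>
      ∫⁻ p, u ^ platoonCount I (H.parent k ω, p) ∂(P.map (H.mark 0))) ∂P := by
  have := Measure.isProbabilityMeasure_map (μ := P) (hH.measurable_mark 0).aemeasurable
  rw [← lintegral_infProd_marks hH.parent_poisson.measurable hH.measurable_mark hH.iIndepFun_mark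
    hH.map_mark hH.indepFun_parent_marks (f := fun _ p => u ^ platoonCount I p)
    (fun _ => Measurable.of_discrete.comp (measurable_platoonCount hI))
    fun _ p => pow_le_one' hu _]
  exact lintegral_congr_ae ((hH.ae_pow_count hIb).mono fun ω hω => hω u hu)

/-- The law of the number of vehicles in a set is invariant under translations. -/
lemma map_count_translate (hH : H.IsPlatooned P lamR lamP m a) {I : Set ℝ} (hI : MeasurableSet I)
    (hIb : Bornology.IsBounded I) (e : ℝ) :
    P.map (H.count ((· + e) ⁻¹' I)) = P.map (H.count I) := by
  have hQ := Measure.isProbabilityMeasure_map (μ := P) (hH.measurable_mark 0).aemeasurable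
  have hI' : MeasurableSet ((· + e) ⁻¹' I) := measurable_add_const e hI
  have hIb' : Bornology.IsBounded ((· + e) ⁻¹' I) :=
    ((IsometryEquiv.addRight e).symm.isometry.lipschitz.isBounded_image hIb).subset
      fun x hx => ⟨x + e, hx, by simp⟩
  have h1 : ∀ {J : Set ℝ} (_ : MeasurableSet J) (u : ℝ≥0∞),
      ∫⁻ ω, u ^ H.count J ω ∂P = ∑' n, P.map (H.count J) {n} * u ^ n := by
    intro J hJ u
    rw [← lintegral_map (f := fun n => u ^ n) .of_discrete (hH.measurable_count hJ),
      lintegral_countable']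
    simp_rw [mul_comm]
  have h2 : ∀ {J : Set ℝ} (_ : MeasurableSet J), ∑' n, P.map (H.count J) {n} ≠ ∞ := by
    intro J hJ
    have := h1 hJ 1
    simp only [one_pow, lintegral_one, measure_univ, mul_one] at this
    simp [← this]
  refine Measure.ext_of_singleton fun n => congrFun (eq_of_tsum_mul_pow_eq (h2 hI') (h2 hI) ?_) n
  intro u hu
  obtain ⟨r, hr⟩ := hIb.subset_closedBall 0
  rw [← h1 hI', ← h1 hI, hH.lintegral_pow_count hI' hIb' hu, hH.lintegral_pow_count hI hIb hu]
  -- Translating the set amounts to translating the platoon centres, and the translated centres are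
  -- again a Poisson process of the same density.
  have h3 : ∀ x p, platoonCount ((· + e) ⁻¹' I) (x, p) = platoonCount I (x + e, p) := by
    intro x p
    simp only [platoonCount, Set.mem_preimage]
    congr 1
    ext j
    simp only [Set.mem_ofPred_eq, add_right_comm]
  simp_rw [h3]
  refine ((hH.parent_poisson.add_const e).lintegral_infProd_congr hH.parent_poisson
    (g := fun x => ∫⁻ p, u ^ platoonCount I (x, p) ∂(P.map (H.mark 0)))
    (K := Metric.closedBall 0 (r + a)) ?_ ?_ Metric.isBounded_closedBall ?_)
  · exact (Measurable.of_discrete.comp (measurable_platoonCount hI)).lintegral_prod_right'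
  · exact fun x => (lintegral_mono fun p => pow_le_one' hu _).trans (by simp)
  · intro x hx
    have := hH.ae_platoonCount_eq_zero hI hr x hx
    rw [lintegral_congr_ae (g := fun _ => 1) (this.mono fun p hp => by simp [hp])]
    simp

end IsPlatooned

end Highway

/-! ### The companions of a vehicle in its own platoon. -/

namespace Highway

/-- The number of vehicles other than the `j`-th one, in `I`, of a platoon with given centre,
size and displacements. -/
noncomputable def mateCount (I : Set ℝ) (j : ℕ) (p : ℝ × ℕ × (ℕ → ℝ)) : ℕ :=
  {j' | j' < p.2.1 ∧ j' ≠ j ∧ p.1 + p.2.2 j' ∈ I}.ncard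

lemma measurable_mateCount {I : Set ℝ} (hI : MeasurableSet I) (j : ℕ) :
    Measurable (mateCount I j) := by
  refine measurable_ncard_setOf fun j' =>
    MeasurableSet.inter ?_ (MeasurableSet.inter (MeasurableSet.const _) ?_)
  · exact measurableSet_lt measurable_const
      (measurable_fst.comp measurable_snd : Measurable fun p : ℝ × ℕ × (ℕ → ℝ) => p.2.1)
  · exact (by fun_prop : Measurable fun p : ℝ × ℕ × (ℕ → ℝ) => p.1 + p.2.2 j') hI

lemma platoonCount_congr {I : Set ℝ} {x : ℝ} {n : ℕ} {d d' : ℕ → ℝ} (h : ∀ j < n, d j = d' j) :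
    platoonCount I (x, n, d) = platoonCount I (x, n, d') := by
  unfold platoonCount
  congr 1
  ext j
  exact and_congr_right fun hj => by simp only [h j hj]

/-- The transposition of `j` and `n` moves the excluded vehicle to the last place, which leaves the
first `n` vehicles without restriction. -/
lemma mateCount_comp_perm (I : Set ℝ) (x : ℝ) {j n : ℕ} (hj : j ≤ n) (d : ℕ → ℝ) :
    platoonCount I (x, n, fun l => d (Equiv.swap j n l)) = mateCount I j (x, n + 1, d) := by
  unfold platoonCount mateCount
  rw [← Set.ncard_image_of_injective _ (Equiv.swap j n).injective]
  congr 1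
  ext l
  simp only [Set.mem_image, Set.mem_ofPred_eq]
  constructor
  · rintro ⟨l', ⟨h1, h2⟩, rfl⟩
    refine ⟨?_, ?_, h2⟩
    · by_cases h : l' = j
      · subst h
        simp
      · rw [Equiv.swap_apply_of_ne_of_ne h h1.ne]
        omega
    · intro h
      rw [Equiv.swap_apply_eq_iff, Equiv.swap_apply_left] at h
      exact h1.ne h
  · rintro ⟨h1, h2, h3⟩
    refine ⟨Equiv.swap j n l, ⟨?_, by simpa using h3⟩, by simp⟩
    by_cases h : l = n
    · subst h
      rw [Equiv.swap_apply_right]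
      omega
    · rw [Equiv.swap_apply_of_ne_of_ne h2 h]
      omega

variable {Ω : Type*} {H : Highway Ω} [MeasurableSpace Ω] {P : Measure Ω} [IsProbabilityMeasure P]
  {lamR lamP m a : ℝ}

namespace IsPlatooned

lemma lintegral_disp_congr (hH : H.IsPlatooned P lamR lamP m a) (i j : ℕ) {f : ℝ → ℝ≥0∞}
    (hf : Measurable f) : ∫⁻ ω, f (H.disp i j ω) ∂P = ∫⁻ ω, f (H.disp 0 0 ω) ∂P := by
  rw [← lintegral_map hf (hH.measurable_disp i j), ← lintegral_map hf (hH.measurable_disp 0 0)]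
  exact congrArg (fun μ => ∫⁻ x, f x ∂μ) ((hH.disp_law i j).trans (hH.disp_law 0 0).symm)

lemma measurable_platoonCount_disp (hH : H.IsPlatooned P lamR lamP m a) {I : Set ℝ}
    (hI : MeasurableSet I) (n : ℕ) :
    Measurable fun q : ℝ × Ω => platoonCount I (q.1, n, fun l => H.disp 0 l q.2) :=
  (measurable_platoonCount hI).comp (measurable_fst.prodMk (measurable_const.prodMk
    (measurable_pi_iff.2 fun l => (hH.measurable_disp 0 l).comp measurable_snd)))

/-- By exchangeability the distinguished vehicle may be taken to be the last one. Its displacement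
is independent of the first `n`, so it can be resampled separately. -/
lemma lintegral_mateCount_fixed_size (hH : H.IsPlatooned P lamR lamP m a) {I : Set ℝ}
    (hI : MeasurableSet I) (h : ℕ → ℝ≥0∞) (y : ℝ) {j n : ℕ} (hj : j ≤ n) :
    ∫⁻ ω, h (mateCount I j (y - H.disp 0 j ω, n + 1, fun l => H.disp 0 l ω)) ∂P =
      ∫⁻ ω', ∫⁻ ω, h (platoonCount I (y - H.disp 0 0 ω', n, fun l => H.disp 0 l ω)) ∂P ∂P := by
  let F : (ℕ → ℝ) → ℝ≥0∞ := fun d => h (platoonCount I (y - d n, n, d))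
  have hF : Measurable F := Measurable.of_discrete.comp ((measurable_platoonCount hI).comp
    (by fun_prop))
  have hD : ∀ σ : ℕ → ℕ, Measurable fun ω l => H.disp 0 (σ l) ω := fun σ =>
    measurable_pi_iff.2 fun l => hH.measurable_disp 0 _
  have h1 : ∫⁻ ω, h (mateCount I j (y - H.disp 0 j ω, n + 1, fun l => H.disp 0 l ω)) ∂P =
      ∫⁻ ω, F (fun l => H.disp 0 l ω) ∂P := by
    have hD' : Measurable fun ω l => H.disp 0 l ω := hD id
    rw [← lintegral_map hF hD', ← hH.map_disp_fun 0 (Equiv.swap j n).injective,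
      lintegral_map hF (hD _)]
    refine lintegral_congr fun ω => ?_
    simp only [F, Equiv.swap_apply_right, mateCount_comp_perm I _ hj fun l => H.disp 0 l ω]
  -- The count sees the first `n` displacements only; padding them by `0` exhibits it as a function
  -- of a finite family independent of `H.disp 0 n`.
  let ψ : (Finset.range n → ℝ) → ℕ → ℝ := fun v l =>
    if hl : l ∈ Finset.range n then v ⟨l, hl⟩ else 0
  have hψ : Measurable ψ := by
    refine measurable_pi_iff.2 fun l => ?_
    by_cases hl : l ∈ Finset.range n
    · simp only [ψ, hl, dif_pos]
      exact measurable_pi_apply _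
    · simp only [ψ, hl, dif_neg, not_false_iff]
      exact measurable_const
  have hind : IndepFun (fun ω => H.disp 0 n ω)
      (fun ω => ψ fun l : Finset.range n => H.disp 0 l ω) P :=
    ((hH.iIndepFun_disp 0).indepFun_finset {n} (Finset.range n) (by simp)
      (hH.measurable_disp 0)).comp (φ := fun v : ({n} : Finset ℕ) → ℝ =>
        v ⟨n, Finset.mem_singleton_self n⟩) (by fun_prop) hψ
  have hψm : Measurable fun ω => ψ fun l : Finset.range n => H.disp 0 l ω :=
    hψ.comp (measurable_pi_iff.2 fun l => hH.measurable_disp 0 l)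
  have hψe : ∀ x ω, platoonCount I (x, n, ψ fun l : Finset.range n => H.disp 0 l ω) =
      platoonCount I (x, n, fun l => H.disp 0 l ω) := fun x ω =>
    platoonCount_congr fun l hl => dif_pos (Finset.mem_range.2 hl)
  have hf : Measurable fun q : ℝ × (ℕ → ℝ) => h (platoonCount I (y - q.1, n, q.2)) :=
    Measurable.of_discrete.comp ((measurable_platoonCount hI).comp (by fun_prop))
  have h2 := lintegral_comp_of_indepFun (hH.measurable_disp 0 n) hψm hind hf
  simp only [hψe] at h2
  rw [h1, h2]
  exact hH.lintegral_disp_congr 0 n (f := fun x => ∫⁻ ω, h (platoonCount I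
    (y - x, n, fun l => H.disp 0 l ω)) ∂P) (Measurable.lintegral_prod_right'
      (f := fun q : ℝ × Ω => h (platoonCount I (y - q.1, n, fun l => H.disp 0 l q.2)))
      (Measurable.of_discrete.comp ((hH.measurable_platoonCount_disp hI n).comp
        ((measurable_const.sub measurable_fst).prodMk measurable_snd))))

/-- The number of the other vehicles of the platoon of the typical vehicle has the law of the
number of vehicles of a platoon with uniformly displaced centre. -/
lemma tsum_lintegral_mateCount (hH : H.IsPlatooned P lamR lamP m a) {I : Set ℝ}
    (hI : MeasurableSet I) (h : ℕ → ℝ≥0∞) (y : ℝ) :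
    ∑' j, ∫⁻ ω, {ω | j < H.size 0 ω}.indicator
        (fun ω => h (mateCount I j (y - H.disp 0 j ω, H.mark 0 ω))) ω ∂P =
      ENNReal.ofReal m * ∫⁻ ω', ∫⁻ ω,
        h (platoonCount I (y - H.disp 0 0 ω', H.mark 0 ω)) ∂P ∂P := by
  have hKD : IndepFun (H.size 0) (fun ω l => H.disp 0 l ω) P :=
    hH.indepFun_size_disp.comp (φ := fun q : ℕ → ℕ => q 0)
      (ψ := fun (q : ℕ × ℕ → ℝ) (j : ℕ) => q (0, j)) (by fun_prop) (by fun_prop)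
  have hD : Measurable fun ω l => H.disp 0 l ω := measurable_pi_iff.2 (hH.measurable_disp 0)
  let G : ℕ → ℝ≥0∞ := fun n => ∫⁻ ω', ∫⁻ ω,
    h (platoonCount I (y - H.disp 0 0 ω', n, fun l => H.disp 0 l ω)) ∂P ∂P
  have hmate : ∀ j, Measurable fun q : ℕ × (ℕ → ℝ) => {n : ℕ | j < n}.indicator
      (fun n => h (mateCount I j (y - q.2 j, n, q.2))) q.1 := by
    intro j
    refine measurable_from_prod_countable_right fun n => ?_
    by_cases hn : j < n
    · simp only [Set.indicator_of_mem (show n ∈ {n : ℕ | j < n} from hn)]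
      exact Measurable.of_discrete.comp ((measurable_mateCount hI j).comp (by fun_prop))
    · simp only [Set.indicator_of_notMem (show n ∉ {n : ℕ | j < n} from hn)]
      exact measurable_const
  have h1 : ∀ j, ∫⁻ ω, {ω | j < H.size 0 ω}.indicator
      (fun ω => h (mateCount I j (y - H.disp 0 j ω, H.mark 0 ω))) ω ∂P =
      ∫⁻ ω, {n : ℕ | j < n}.indicator (fun n => G (n - 1)) (H.size 0 ω) ∂P := by
    intro j
    refine (lintegral_comp_of_indepFun (hH.measurable_size 0) hD hKD (hmate j)).trans ?_
    refine lintegral_congr fun ω => ?_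
    by_cases hn : j < H.size 0 ω
    · simp only [Set.indicator_of_mem (show H.size 0 ω ∈ {n : ℕ | j < n} from hn)]
      obtain ⟨n, hn'⟩ : ∃ n, H.size 0 ω = n + 1 := ⟨H.size 0 ω - 1, by omega⟩
      rw [hn', hH.lintegral_mateCount_fixed_size hI h y (by omega), Nat.add_sub_cancel]
    · simp only [Set.indicator_of_notMem (show H.size 0 ω ∉ {n : ℕ | j < n} from hn),
        lintegral_zero]
  -- Each of the `n` vehicles gives the same value, which produces the size-biased weight of the
  -- Chen-Stein identity.
  have h2 : ∀ n : ℕ, ∑' j, {n : ℕ | j < n}.indicator (fun n => G (n - 1)) n = n * G (n - 1) := by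
    intro n
    rw [tsum_eq_sum (s := Finset.range n) fun j hj =>
      Set.indicator_of_notMem (by simpa using hj) _, Finset.sum_congr rfl fun j hj =>
      Set.indicator_of_mem (show n ∈ {n : ℕ | j < n} from Finset.mem_range.1 hj) _]
    simp
  simp_rw [h1]
  have hind : ∀ j, Measurable fun ω => {n : ℕ | j < n}.indicator (fun n => G (n - 1))
      (H.size 0 ω) := fun j =>
    (Measurable.of_discrete (f := {n : ℕ | j < n}.indicator fun n => G (n - 1))).comp
      (hH.measurable_size 0)
  rw [← lintegral_tsum fun j => (hind j).aemeasurable]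
  simp_rw [h2]
  rw [← lintegral_map (f := fun n : ℕ => (n : ℝ≥0∞) * G (n - 1)) .of_discrete
    (hH.measurable_size 0), hH.size_law 0, lintegral_mul_pred_poissonMeasure, ← hH.size_law 0,
    lintegral_map .of_discrete (hH.measurable_size 0)]
  have hjoint : Measurable fun q : Ω × ℕ × Ω => h (platoonCount I
      (y - H.disp 0 0 q.1, q.2.1, fun l => H.disp 0 l q.2.2)) :=
    Measurable.of_discrete.comp ((measurable_platoonCount hI).comp
      ((measurable_const.sub ((hH.measurable_disp 0 0).comp measurable_fst)).prodMk
        ((measurable_fst.comp measurable_snd).prodMk (hD.comp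
          (measurable_snd.comp measurable_snd)))))
  congr 1
  rw [lintegral_lintegral_swap]
  · refine lintegral_congr fun ω' => ?_
    exact (lintegral_comp_of_indepFun (hH.measurable_size 0) hD hKD
      (f := fun q => h (platoonCount I (y - H.disp 0 0 ω', q)))
      (Measurable.of_discrete.comp ((measurable_platoonCount hI).comp measurable_prodMk_left))).symm
  · have h3 : Measurable fun q : (Ω × Ω) × Ω => ((q.1.2, H.size 0 q.1.1, q.2) : Ω × ℕ × Ω) :=
      (measurable_snd.comp measurable_fst).prodMk
        (((hH.measurable_size 0).comp (measurable_fst.comp measurable_fst)).prodMk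
          measurable_snd)
    have h4 := hjoint.comp h3
    exact (Measurable.lintegral_prod_right' h4).aemeasurable

end IsPlatooned

end Highway

/-! ### Void probabilities, gaps and simplicity of a Poisson process. -/

lemma infProd_ite (p : ℕ → Prop) [DecidablePred p] [Decidable (∀ k, p k)] :
    infProd (fun k => if p k then 1 else 0) = if ∀ k, p k then 1 else 0 := by
  split_ifs with h
  · simp [infProd, h]
  · obtain ⟨k, hk⟩ := not_forall.1 h
    refine le_antisymm ((iInf_le _ (k + 1)).trans (le_of_eq ?_)) zero_le
    exact Finset.prod_eq_zero (Finset.self_mem_range_succ k) (by simp [hk])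

namespace IsPoissonProcess

variable {Ω : Type*} [MeasurableSpace Ω] {P : Measure Ω} [IsProbabilityMeasure P] {lam : ℝ}
  {X : ℕ → Ω → ℝ}

lemma measurableSet_void (hX : IsPoissonProcess P lam X) {J : Set ℝ} (hJ : MeasurableSet J) :
    MeasurableSet {ω | ∀ k, X k ω ∉ J} := by
  rw [Set.ofPred_forall]
  exact MeasurableSet.iInter fun k => (hX.measurable k hJ).compl

/-- The void probabilities of a Poisson process. -/
lemma void_probability (hX : IsPoissonProcess P lam X) (hlam : 0 ≤ lam) {J : Set ℝ}
    (hJ : MeasurableSet J) (hJb : Bornology.IsBounded J) :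
    P {ω | ∀ k, X k ω ∉ J} = ENNReal.ofReal (Real.exp (-(lam * volume.real J))) := by
  have h := hX.counts_fintype (fun _ : Unit => J) (fun _ => hJ) (fun _ => hJb)
    (fun i j hij => (hij rfl).elim) fun _ => 0
  simp only [forall_const, Nat.cast_zero, Set.encard_eq_zero, Finset.univ_unique,
    Finset.prod_const, Finset.card_singleton, pow_one, poissonMeasure_singleton, pow_zero,
    Nat.factorial_zero, Nat.cast_one, mul_one, div_one] at h
  rw [Real.coe_toNNReal _ (mul_nonneg hlam measureReal_nonneg)] at h
  rw [← h]
  congr 1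
  ext ω
  simp [Set.eq_empty_iff_forall_notMem]

lemma measurableSet_isolated (hX : IsPoissonProcess P lam X) {J : Set ℝ} (hJ : MeasurableSet J)
    (i : ℕ) : MeasurableSet {ω | ∀ k, k ≠ i → X k ω ∉ J} := by
  simp_rw [Set.ofPred_forall]
  exact MeasurableSet.iInter fun k => MeasurableSet.iInter fun _ => (hX.measurable k hJ).compl

/-- The absence of other points from `J` is the product functional of the indicator of the
complement of `J`, with the point itself deleted. -/
lemma mecke_void (hX : IsPoissonProcess P lam X) (hlam : 0 ≤ lam) {B J : Set ℝ}
    (hB : MeasurableSet B) (hBb : Bornology.IsBounded B) (hJ : MeasurableSet J)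
    (hJb : Bornology.IsBounded J) :
    ∑' i, P (X i ⁻¹' B ∩ {ω | ∀ k, k ≠ i → X k ω ∉ J}) =
      ENNReal.ofReal lam * volume B * ENNReal.ofReal (Real.exp (-(lam * volume.real J))) := by
  classical
  have h := hX.mecke (g := fun x => if x ∉ J then 1 else 0) (K := J) (B := B)
    (Measurable.ite hJ.compl measurable_const measurable_const)
    (fun x => by split_ifs <;> simp) hJb (fun x hx => by simp [hx]) hB hBb
  rw [← hX.void_probability hlam hJ hJb]
  have h1 : ∀ ω, infProd (fun k => if X k ω ∉ J then 1 else 0) =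
      {ω | ∀ k, X k ω ∉ J}.indicator 1 ω := by
    intro ω
    rw [infProd_ite]
    rfl
  have h2 : ∀ i ω, B.indicator 1 (X i ω) *
      infProd (Function.update (fun k => if X k ω ∉ J then (1 : ℝ≥0∞) else 0) i 1) =
      (X i ⁻¹' B ∩ {ω | ∀ k, k ≠ i → X k ω ∉ J}).indicator 1 ω := by
    intro i ω
    have : Function.update (fun k => if X k ω ∉ J then (1 : ℝ≥0∞) else 0) i 1 =
        fun k => if k ≠ i → X k ω ∉ J then 1 else 0 := by
      funext k
      rcases eq_or_ne k i with rfl | hk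
      · simp
      · simp [hk]
    rw [this, infProd_ite, Set.inter_indicator_one]
    rfl
  simp_rw [h1, h2] at h
  rw [lintegral_indicator_one (hX.measurableSet_void hJ)] at h
  rw [← h]
  exact tsum_congr fun i =>
    (lintegral_indicator_one ((hX.measurable i hB).inter (hX.measurableSet_isolated hJ i))).symm

lemma measurableSet_gap (hX : IsPoissonProcess P lam X) (s t : ℝ) (i : ℕ) :
    MeasurableSet {ω | ∀ k, k ≠ i → X k ω ∉ Set.Ioo (X i ω - s) (X i ω + t)} := by
  simp_rw [Set.ofPred_forall]
  refine MeasurableSet.iInter fun k => MeasurableSet.iInter fun _ => ?_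
  exact ((measurableSet_lt ((hX.measurable i).sub_const s) (hX.measurable k)).inter
    (measurableSet_lt (hX.measurable k) ((hX.measurable i).add_const t))).compl

/-- The grid localizes a point up to `ε`, so that fixed intervals can stand in for intervals moving
with the point. -/
lemma tsum_measure_inter_grid (hX : IsPoissonProcess P lam X) {B : Set ℝ} (hB : MeasurableSet B)
    {E : ℕ → Set Ω} (hE : ∀ i, MeasurableSet (E i)) {ε : ℝ} (hε : 0 < ε) :
    ∑' i, P (X i ⁻¹' B ∩ E i) =
      ∑' z : ℤ, ∑' i, P (X i ⁻¹' (B ∩ Set.Ico (z • ε) ((z + 1) • ε)) ∩ E i) := by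
  rw [ENNReal.tsum_comm]
  refine tsum_congr fun i => ?_
  rw [← measure_iUnion]
  · congr 1
    rw [← Set.iUnion_inter, ← Set.preimage_iUnion, ← Set.inter_iUnion, iUnion_Ico_zsmul hε,
      Set.inter_univ]
  · intro z z' hz
    refine Disjoint.mono Set.inter_subset_left Set.inter_subset_left (Disjoint.preimage _ ?_)
    exact Disjoint.mono Set.inter_subset_right Set.inter_subset_right
      (Set.pairwise_disjoint_Ico_zsmul ε hz)
  · exact fun z => (hX.measurable i (hB.inter measurableSet_Ico)).inter (hE i)

lemma volume_eq_tsum_grid {B : Set ℝ} (hB : MeasurableSet B) {ε : ℝ} (hε : 0 < ε) :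
    volume B = ∑' z : ℤ, volume (B ∩ Set.Ico (z • ε) ((z + 1) • ε)) := by
  rw [← measure_iUnion, ← Set.inter_iUnion, iUnion_Ico_zsmul hε, Set.inter_univ]
  · intro z z' hz
    exact Disjoint.mono Set.inter_subset_right Set.inter_subset_right
      (Set.pairwise_disjoint_Ico_zsmul ε hz)
  · exact fun z => hB.inter measurableSet_Ico

/-- The joint law of the gaps on both sides of the typical point of a Poisson process. -/
lemma mecke_gap (hX : IsPoissonProcess P lam X) (hlam : 0 ≤ lam) {B : Set ℝ}
    (hB : MeasurableSet B) (hBb : Bornology.IsBounded B) {s t : ℝ} (hs : 0 ≤ s) (ht : 0 ≤ t) :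
    ∑' i, P (X i ⁻¹' B ∩ {ω | ∀ k, k ≠ i → X k ω ∉ Set.Ioo (X i ω - s) (X i ω + t)}) =
      ENNReal.ofReal lam * volume B * ENNReal.ofReal (Real.exp (-(lam * (s + t)))) := by
  have hlim : ∀ c : ℝ, Tendsto (fun ε : ℝ => ENNReal.ofReal lam * volume B *
      ENNReal.ofReal (Real.exp (-(lam * (s + t + c * ε))))) (𝓝[>] 0)
      (𝓝 (ENNReal.ofReal lam * volume B * ENNReal.ofReal (Real.exp (-(lam * (s + t)))))) := by
    intro c
    refine ENNReal.Tendsto.const_mul ?_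
      (Or.inr (ENNReal.mul_ne_top ENNReal.ofReal_ne_top hBb.measure_lt_top.ne))
    refine (ENNReal.continuous_ofReal.tendsto _).comp ?_
    have : Continuous fun ε : ℝ => Real.exp (-(lam * (s + t + c * ε))) := by fun_prop
    have h := (this.tendsto 0).mono_left (nhdsWithin_le_nhds (s := Set.Ioi 0))
    simpa using h
  have hBz : ∀ (ε : ℝ) (z : ℤ), MeasurableSet (B ∩ Set.Ico (z • ε) ((z + 1) • ε)) := fun ε z =>
    hB.inter measurableSet_Ico
  have hBzb : ∀ (ε : ℝ) (z : ℤ), Bornology.IsBounded (B ∩ Set.Ico (z • ε) ((z + 1) • ε)) :=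
    fun ε z => hBb.subset Set.inter_subset_left
  -- The gap moves with the point, while `mecke_void` needs a fixed set. On a grid cell of mesh `ε`
  -- the gap lies between fixed intervals of lengths `s + t - ε` (empty if this is negative) and `s
  -- + t + ε`; then `ε` tends to `0`.
  refine le_antisymm (ge_of_tendsto (hlim (-1)) ?_) (le_of_tendsto (hlim 1) ?_)
  · filter_upwards [self_mem_nhdsWithin] with ε hε
    rw [Set.mem_Ioi] at hε
    rw [hX.tsum_measure_inter_grid hB (hX.measurableSet_gap s t) hε, volume_eq_tsum_grid hB hε,
      ← ENNReal.tsum_mul_left, ← ENNReal.tsum_mul_right]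
    refine ENNReal.tsum_le_tsum fun z => ?_
    refine (ENNReal.tsum_le_tsum fun i => measure_mono ?_).trans
      ((hX.mecke_void hlam (hBz ε z) (hBzb ε z) (measurableSet_Ioo (a := (z + 1) • ε - s)
        (b := z • ε + t)) (Metric.isBounded_Ioo _ _)).le.trans ?_)
    · rintro ω ⟨h1, h2⟩
      refine ⟨h1, fun k hk hkJ => h2 k hk ⟨?_, ?_⟩⟩
      · linarith [hkJ.1, h1.2.2]
      · linarith [hkJ.2, h1.2.1]
    · gcongr
      rw [Real.volume_real_Ioo]
      refine le_trans (le_of_eq ?_) (le_max_left _ _)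
      simp only [zsmul_eq_mul]
      push_cast
      ring
  · filter_upwards [self_mem_nhdsWithin] with ε hε
    rw [Set.mem_Ioi] at hε
    rw [hX.tsum_measure_inter_grid hB (hX.measurableSet_gap s t) hε, volume_eq_tsum_grid hB hε,
      ← ENNReal.tsum_mul_left, ← ENNReal.tsum_mul_right]
    refine ENNReal.tsum_le_tsum fun z => ?_
    refine le_trans ?_ ((hX.mecke_void hlam (hBz ε z) (hBzb ε z)
      (measurableSet_Ioo (a := z • ε - s) (b := (z + 1) • ε + t))
      (Metric.isBounded_Ioo _ _)).ge.trans (ENNReal.tsum_le_tsum fun i => measure_mono ?_))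
    · gcongr
      rw [Real.volume_real_Ioo]
      refine max_le (le_of_eq ?_) (by positivity)
      simp only [zsmul_eq_mul]
      push_cast
      ring
    · rintro ω ⟨h1, h2⟩
      refine ⟨h1, fun k hk hkJ => h2 k hk ⟨?_, ?_⟩⟩
      · linarith [hkJ.1, h1.2.1]
      · linarith [hkJ.2, h1.2.2]

lemma tsum_measure_mem (hX : IsPoissonProcess P lam X) (hlam : 0 ≤ lam) {B : Set ℝ}
    (hB : MeasurableSet B) (hBb : Bornology.IsBounded B) :
    ∑' i, P (X i ⁻¹' B) = ENNReal.ofReal lam * volume B := by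
  simpa using hX.mecke_gap hlam hB hBb le_rfl le_rfl

/-- A Poisson process has no multiple points. -/
lemma ae_injective (hX : IsPoissonProcess P lam X) (hlam : 0 ≤ lam) :
    ∀ᵐ ω ∂P, Function.Injective fun i => X i ω := by
  have hdup : ∀ i, MeasurableSet {ω | ∃ k, k ≠ i ∧ X k ω = X i ω} := by
    intro i
    simp_rw [Set.ofPred_exists]
    exact MeasurableSet.iUnion fun k => (MeasurableSet.const _).inter
      (measurableSet_eq_fun (hX.measurable k) (hX.measurable i))
  have key : ∀ n : ℕ, ∑' i, P (X i ⁻¹' Metric.closedBall 0 n ∩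
      {ω | ∃ k, k ≠ i ∧ X k ω = X i ω}) = 0 := by
    intro n
    set B : Set ℝ := Metric.closedBall 0 n
    have hB : MeasurableSet B := measurableSet_closedBall
    have hBb : Bornology.IsBounded B := Metric.isBounded_closedBall
    have hfin : ENNReal.ofReal lam * volume B ≠ ∞ :=
      ENNReal.mul_ne_top ENNReal.ofReal_ne_top hBb.measure_lt_top.ne
    set bad := ∑' i, P (X i ⁻¹' B ∩ {ω | ∃ k, k ≠ i ∧ X k ω = X i ω})
    -- A point with a duplicate is not alone within `ε`, so the two disjoint contributions stay
    -- below the mean number of points in `B`. As `ε` tends to `0` the first one already exhausts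
    -- it.
    have h1 : ∀ ε : ℝ, 0 < ε → ENNReal.ofReal lam * volume B *
        ENNReal.ofReal (Real.exp (-(lam * (ε + ε)))) + bad ≤ ENNReal.ofReal lam * volume B := by
      intro ε hε
      rw [← hX.mecke_gap hlam hB hBb hε.le hε.le, ← hX.tsum_measure_mem hlam hB hBb,
        ← ENNReal.tsum_add]
      refine ENNReal.tsum_le_tsum fun i => ?_
      rw [← measure_union _ ((hX.measurable i hB).inter (hdup i))]
      · exact measure_mono (Set.union_subset Set.inter_subset_left Set.inter_subset_left)
      · refine Set.disjoint_left.2 fun ω h2 h3 => ?_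
        obtain ⟨k, hk, hki⟩ := h3.2
        refine h2.2 k hk ⟨?_, ?_⟩ <;> rw [hki] <;> linarith
    have h2 : Tendsto (fun ε : ℝ => ENNReal.ofReal lam * volume B *
        ENNReal.ofReal (Real.exp (-(lam * (ε + ε)))) + bad) (𝓝[>] 0)
        (𝓝 (ENNReal.ofReal lam * volume B * 1 + bad)) := by
      refine Tendsto.add (ENNReal.Tendsto.const_mul ?_ (Or.inr hfin)) tendsto_const_nhds
      have h3 : Continuous fun ε : ℝ => ENNReal.ofReal (Real.exp (-(lam * (ε + ε)))) :=
        ENNReal.continuous_ofReal.comp (by fun_prop)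
      have h4 := (h3.tendsto 0).mono_left (nhdsWithin_le_nhds (s := Set.Ioi 0))
      simpa using h4
    have h3 := le_of_tendsto h2 (by
      filter_upwards [self_mem_nhdsWithin] with ε hε using h1 ε hε)
    rw [mul_one] at h3
    by_contra hbad
    exact (ENNReal.lt_add_right hfin hbad).not_ge h3
  have h4 : ∀ (n : ℕ) i, ∀ᵐ ω ∂P,
      ω ∉ X i ⁻¹' Metric.closedBall 0 n ∩ {ω | ∃ k, k ≠ i ∧ X k ω = X i ω} := fun n i =>
    measure_eq_zero_iff_ae_notMem.1 (ENNReal.tsum_eq_zero.1 (key n) i)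
  filter_upwards [ae_all_iff.2 fun n => ae_all_iff.2 (h4 n)] with ω hω i j hij
  by_contra hne
  obtain ⟨n, hn⟩ := exists_nat_ge |X j ω|
  exact hω n j ⟨by simpa using hn, i, hne, hij⟩

/-- A Poisson process has points on both sides of every location. -/
lemma ae_unbounded (hX : IsPoissonProcess P lam X) (hlam : 0 < lam) :
    ∀ᵐ ω ∂P, ∀ r : ℝ, (∃ k, r < X k ω) ∧ ∃ k, X k ω < r := by
  -- An empty half-line contains empty intervals of every length `n`, and their void probabilities
  -- tend to `0`.
  have hlim : Tendsto (fun n : ℕ => ENNReal.ofReal (Real.exp (-(lam * n)))) atTop (𝓝 0) := by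
    have h1 : Tendsto (fun n : ℕ => Real.exp (-(lam * n))) atTop (𝓝 0) :=
      Real.tendsto_exp_neg_atTop_nhds_zero.comp
        (tendsto_natCast_atTop_atTop.const_mul_atTop hlam)
    simpa [Function.comp_def] using (ENNReal.continuous_ofReal.tendsto 0).comp h1
  have hvol : ∀ (r : ℝ) (n : ℕ), P {ω | ∀ k, X k ω ∉ Set.Ioo r (r + n)} =
      ENNReal.ofReal (Real.exp (-(lam * n))) := by
    intro r n
    rw [hX.void_probability hlam.le measurableSet_Ioo (Metric.isBounded_Ioo _ _),
      Real.volume_real_Ioo]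
    simp
  have h1 : ∀ r : ℕ, ∀ᵐ ω ∂P, ∃ k, (r : ℝ) < X k ω := by
    intro r
    have : P {ω | ¬ ∃ k, (r : ℝ) < X k ω} = 0 := by
      refine le_antisymm (ge_of_tendsto' hlim fun n => ?_) zero_le
      rw [← hvol r n]
      refine measure_mono fun ω hω k hk => hω ⟨k, hk.1⟩
    exact this
  have h2 : ∀ r : ℕ, ∀ᵐ ω ∂P, ∃ k, X k ω < -(r : ℝ) := by
    intro r
    have : P {ω | ¬ ∃ k, X k ω < -(r : ℝ)} = 0 := by
      refine le_antisymm (ge_of_tendsto' hlim fun n => ?_) zero_le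
      rw [← hvol (-r - n) n]
      refine measure_mono fun ω hω k hk => hω ⟨k, ?_⟩
      linarith [hk.2]
    exact this
  filter_upwards [ae_all_iff.2 h1, ae_all_iff.2 h2] with ω hω1 hω2 r
  obtain ⟨n, hn⟩ := exists_nat_ge |r|
  obtain ⟨k, hk⟩ := hω1 n
  obtain ⟨l, hl⟩ := hω2 n
  rw [abs_le] at hn
  exact ⟨⟨k, by linarith⟩, ⟨l, by linarith⟩⟩

end IsPoissonProcess

/-! ### Deterministic geometry of Voronoi cells on the line. -/

/-- The Voronoi cell of the `i`-th point of a sequence. -/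
def voronoiCell (x : ℕ → ℝ) (i : ℕ) : Set ℝ := {y | ∀ j, |y - x i| ≤ |y - x j|}

/-- The length of the part of the Voronoi cell to the left of its centre. -/
noncomputable def leftReach (x : ℕ → ℝ) (i : ℕ) : ℝ :=
  volume.real (voronoiCell x i ∩ Set.Iic (x i))

/-- The length of the part of the Voronoi cell to the right of its centre. -/
noncomputable def rightReach (x : ℕ → ℝ) (i : ℕ) : ℝ :=
  volume.real (voronoiCell x i ∩ Set.Ici (x i))

/-- A simple, locally finite sequence of points which is unbounded on both sides. -/
structure IsGeneric (x : ℕ → ℝ) : Prop where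
  injective : Function.Injective x
  finite : ∀ B : Set ℝ, Bornology.IsBounded B → {i | x i ∈ B}.Finite
  unbounded : ∀ r : ℝ, (∃ k, r < x k) ∧ ∃ k, x k < r

lemma center_mem_voronoiCell (x : ℕ → ℝ) (i : ℕ) : x i ∈ voronoiCell x i := fun j => by simp

/-- Squaring makes each condition affine in `y`, from which convexity and the comparison with gaps
follow. -/
lemma mem_voronoiCell_iff {x : ℕ → ℝ} {i : ℕ} {y : ℝ} :
    y ∈ voronoiCell x i ↔ ∀ j, 2 * y * (x j - x i) ≤ x j ^ 2 - x i ^ 2 := by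
  refine forall_congr' fun j => ?_
  rw [← sq_le_sq]
  constructor <;> intro h <;> linarith

lemma isClosed_voronoiCell (x : ℕ → ℝ) (i : ℕ) : IsClosed (voronoiCell x i) := by
  rw [voronoiCell, Set.ofPred_forall]
  exact isClosed_iInter fun j => isClosed_le (by fun_prop) (by fun_prop)

lemma convex_voronoiCell (x : ℕ → ℝ) (i : ℕ) : Convex ℝ (voronoiCell x i) := by
  intro y hy z hz a b ha hb hab
  rw [mem_voronoiCell_iff] at *
  intro j
  simp only [smul_eq_mul]
  calc 2 * (a * y + b * z) * (x j - x i) =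
        a * (2 * y * (x j - x i)) + b * (2 * z * (x j - x i)) := by ring
    _ ≤ a * (x j ^ 2 - x i ^ 2) + b * (x j ^ 2 - x i ^ 2) := by
        gcongr
        exacts [hy j, hz j]
    _ = x j ^ 2 - x i ^ 2 := by rw [← add_mul, hab, one_mul]

/-- Cells overlap only at midpoints, a countable set of locations which the vehicles almost surely
avoid. -/
lemma eq_midpoint_of_mem_voronoiCell {x : ℕ → ℝ} (hx : Function.Injective x) {i j : ℕ}
    (hij : i ≠ j) {y : ℝ} (hi : y ∈ voronoiCell x i) (hj : y ∈ voronoiCell x j) :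
    y = (x i + x j) / 2 := by
  have h := le_antisymm (hi j) (hj i)
  rcases abs_eq_abs.1 h with h | h
  · exact absurd (hx (by linarith)) hij
  · linarith

/-- A cell ends halfway to the neighbouring point; the factors `2` become the parameter `2 * lam` of
the exponential reaches. -/
lemma mem_voronoiCell_iff_gap {x : ℕ → ℝ} (hx : Function.Injective x) {i : ℕ} {s t : ℝ}
    (hs : 0 ≤ s) (ht : 0 ≤ t) :
    (x i - s ∈ voronoiCell x i ∧ x i + t ∈ voronoiCell x i) ↔
      ∀ k, k ≠ i → x k ∉ Set.Ioo (x i - 2 * s) (x i + 2 * t) := by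
  simp only [mem_voronoiCell_iff]
  constructor
  · rintro ⟨h1, h2⟩ k hk ⟨h3, h4⟩
    rcases lt_or_gt_of_ne (hx.ne hk) with h | h
    · nlinarith [h1 k]
    · nlinarith [h2 k]
  · intro h
    have key : ∀ j, j ≠ i → x j ≤ x i - 2 * s ∨ x i + 2 * t ≤ x j := by
      intro j hj
      have := h j hj
      rw [Set.mem_Ioo, not_and_or, not_lt, not_lt] at this
      exact this
    constructor <;> intro j <;> rcases eq_or_ne j i with rfl | hj
    · simp
    · rcases key j hj with h | h <;> nlinarith
    · simp
    · rcases key j hj with h | h <;> nlinarith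

namespace IsGeneric

variable {x : ℕ → ℝ}

lemma isBounded_voronoiCell (hx : IsGeneric x) (i : ℕ) :
    Bornology.IsBounded (voronoiCell x i) := by
  obtain ⟨⟨k, hk⟩, ⟨l, hl⟩⟩ := hx.unbounded (x i)
  refine (Metric.isBounded_Icc ((x l + x i) / 2) ((x k + x i) / 2)).subset fun y hy => ?_
  rw [mem_voronoiCell_iff] at hy
  have h1 := hy k
  have h2 := hy l
  constructor
  · by_contra h
    push Not at h
    nlinarith
  · by_contra h
    push Not at h
    nlinarith

lemma voronoiCell_eq_Icc (hx : IsGeneric x) (i : ℕ) :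
    0 ≤ leftReach x i ∧ 0 ≤ rightReach x i ∧
      voronoiCell x i = Set.Icc (x i - leftReach x i) (x i + rightReach x i) := by
  obtain ⟨c, d, hcd⟩ : ∃ c d, voronoiCell x i = Set.Icc c d :=
    ⟨_, _, eq_Icc_of_connected_compact
      ⟨⟨x i, center_mem_voronoiCell x i⟩, (convex_voronoiCell x i).isPreconnected⟩
      (Metric.isCompact_of_isClosed_isBounded (isClosed_voronoiCell x i)
        (hx.isBounded_voronoiCell i))⟩
  have hi := center_mem_voronoiCell x i
  rw [hcd] at hi
  have hl : leftReach x i = x i - c := by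
    rw [leftReach, hcd, ← Set.Ici_inter_Iic, Set.inter_assoc, Set.Iic_inter_Iic,
      inf_eq_right.2 hi.2, Set.Ici_inter_Iic, Real.volume_real_Icc_of_le hi.1]
  have hr : rightReach x i = d - x i := by
    rw [rightReach, hcd, ← Set.Ici_inter_Iic, Set.inter_comm (Set.Ici c), Set.inter_assoc,
      Set.Ici_inter_Ici, sup_eq_right.2 hi.1, Set.inter_comm, Set.Ici_inter_Iic,
      Real.volume_real_Icc_of_le hi.2]
  refine ⟨measureReal_nonneg, measureReal_nonneg, ?_⟩
  rw [hcd, hl, hr]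
  congr 1 <;> ring

/-- Negative bounds hold trivially; `max` with `0` covers them, as `sum_map_reach` tests the law on
arbitrary half-lines. -/
lemma le_reach_iff (hx : IsGeneric x) (i : ℕ) (s t : ℝ) :
    (s ≤ leftReach x i ∧ t ≤ rightReach x i) ↔
      ∀ k, k ≠ i → x k ∉ Set.Ioo (x i - 2 * max s 0) (x i + 2 * max t 0) := by
  obtain ⟨h1, h2, h3⟩ := hx.voronoiCell_eq_Icc i
  rw [← mem_voronoiCell_iff_gap hx.injective (le_max_right _ _) (le_max_right _ _), h3]
  simp only [Set.mem_Icc]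
  have h4 : s ≤ leftReach x i ↔ max s 0 ≤ leftReach x i := by simp [h1]
  have h5 : t ≤ rightReach x i ↔ max t 0 ≤ rightReach x i := by simp [h2]
  rw [h4, h5]
  have := le_max_right s 0
  have := le_max_right t 0
  constructor
  · rintro ⟨h6, h7⟩
    refine ⟨⟨?_, ?_⟩, ⟨?_, ?_⟩⟩ <;> linarith
  · rintro ⟨⟨h6, h7⟩, ⟨h8, h9⟩⟩
    constructor <;> linarith

/-- Points farther away than the `0`-th one cannot be nearest, and local finiteness leaves finitely
many candidates. -/
lemma exists_mem_voronoiCell (hx : IsGeneric x) (y : ℝ) : ∃ i, y ∈ voronoiCell x i := by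
  let B : Set ℝ := Metric.closedBall y |x 0 - y|
  have hfin := hx.finite B Metric.isBounded_closedBall
  have h0 : (0 : ℕ) ∈ hfin.toFinset := by simp [B, Real.dist_eq]
  obtain ⟨i, hi, hmin⟩ := hfin.toFinset.exists_min_image (fun i => |y - x i|) ⟨0, h0⟩
  refine ⟨i, fun j => ?_⟩
  by_cases hj : x j ∈ B
  · exact hmin j (by simpa using hj)
  · have h1 := hmin 0 h0
    have h2 : |x 0 - y| < |x j - y| := by simpa [B, Real.dist_eq] using hj
    rw [abs_sub_comm y, abs_sub_comm y] at h1 ⊢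
    linarith

end IsGeneric

lemma measurable_volumeReal_section {α : Type*} [MeasurableSpace α] {S : α → Set ℝ}
    (hS : MeasurableSet {p : α × ℝ | p.2 ∈ S p.1}) : Measurable fun x => volume.real (S x) :=
  (measurable_measure_prodMk_left hS).ennreal_toReal

lemma measurableSet_mem_voronoiCell (i : ℕ) :
    MeasurableSet {p : (ℕ → ℝ) × ℝ | p.2 ∈ voronoiCell p.1 i} := by
  have : {p : (ℕ → ℝ) × ℝ | p.2 ∈ voronoiCell p.1 i} =
      ⋂ j, {p : (ℕ → ℝ) × ℝ | |p.2 - p.1 i| ≤ |p.2 - p.1 j|} := by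
    ext p
    simp [voronoiCell]
  rw [this]
  exact MeasurableSet.iInter fun j => measurableSet_le (by fun_prop) (by fun_prop)

lemma measurable_leftReach (i : ℕ) : Measurable fun x => leftReach x i :=
  measurable_volumeReal_section ((measurableSet_mem_voronoiCell i).inter
    (measurableSet_le measurable_snd (by fun_prop : Measurable fun p : (ℕ → ℝ) × ℝ => p.1 i)))

lemma measurable_rightReach (i : ℕ) : Measurable fun x => rightReach x i :=
  measurable_volumeReal_section ((measurableSet_mem_voronoiCell i).inter
    (measurableSet_le (by fun_prop : Measurable fun p : (ℕ → ℝ) × ℝ => p.1 i) measurable_snd))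

/-! ### Law of the typical cell and of the cell covering a location. -/

/-- The density of the exponential distribution with parameter `r`. -/
noncomputable def expDensity (r x : ℝ) : ℝ≥0∞ :=
  (Set.Ioi 0).indicator (fun x => ENNReal.ofReal (r * Real.exp (-(r * x)))) x

lemma measurable_expDensity (r : ℝ) : Measurable (expDensity r) :=
  Measurable.indicator (by fun_prop) measurableSet_Ioi

lemma withDensity_expDensity_Ici {r : ℝ} (hr : 0 < r) (s : ℝ) :
    volume.withDensity (expDensity r) (Set.Ici s) =
      ENNReal.ofReal (Real.exp (-(r * max s 0))) := by
  rw [withDensity_apply _ measurableSet_Ici]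
  unfold expDensity
  rw [setLIntegral_indicator measurableSet_Ioi, setLIntegral_congr (t := Set.Ioi (max s 0)),
    ← ofReal_integral_eq_lintegral_ofReal]
  · congr 1
    rw [integral_const_mul]
    have h := integral_exp_mul_Ioi (a := -r) (by linarith) (max s 0)
    simp only [neg_mul] at h
    rw [h]
    field_simp
  · have h := (exp_neg_integrableOn_Ioi (max s 0) hr).const_mul r
    simp only [neg_mul] at h
    exact h
  · exact ae_of_all _ fun x => by positivity
  · rw [max_comm, ← Set.Ioi_inter_Ioi]
    exact (ae_eq_refl _).inter Ioi_ae_eq_Ici.symm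

namespace IsPoissonProcess

variable {Ω : Type*} [MeasurableSpace Ω] {P : Measure Ω} [IsProbabilityMeasure P] {lam : ℝ}
  {X : ℕ → Ω → ℝ}

lemma ae_isGeneric (hX : IsPoissonProcess P lam X) (hlam : 0 < lam) :
    ∀ᵐ ω ∂P, IsGeneric fun i => X i ω := by
  filter_upwards [hX.ae_injective hlam.le, hX.ae_locallyFinite, hX.ae_unbounded hlam]
    with ω h1 h2 h3 using ⟨h1, h2, h3⟩

lemma measurable_reach (hX : IsPoissonProcess P lam X) (i : ℕ) :
    Measurable fun ω => (X i ω, leftReach (fun k => X k ω) i, rightReach (fun k => X k ω) i) := by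
  have h : Measurable fun ω k => X k ω := measurable_pi_iff.2 hX.measurable
  exact (hX.measurable i).prodMk
    (((measurable_leftReach i).comp h).prodMk ((measurable_rightReach i).comp h))

/-- The typical Voronoi cell extends on both sides by independent exponential lengths. -/
lemma sum_map_reach (hX : IsPoissonProcess P lam X) (hlam : 0 < lam) :
    volume.prod (ENNReal.ofReal lam • (volume.withDensity (expDensity (2 * lam))).prod
      (volume.withDensity (expDensity (2 * lam)))) =
    Measure.sum fun i => P.map fun ω =>
      (X i ω, leftReach (fun k => X k ω) i, rightReach (fun k => X k ω) i) := by
  have hgen : MeasurableSpace.generateFrom (Set.range Set.Ici) =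
      (inferInstance : MeasurableSpace ℝ) := by
    rw [← borel_eq_generateFrom_Ici]
    exact (BorelSpace.measurable_eq (α := ℝ)).symm
  have hspan : ⋃ n : ℕ, Set.Ici (-(n : ℝ)) = Set.univ :=
    Set.eq_univ_of_forall fun x => by
      obtain ⟨n, hn⟩ := exists_nat_ge (-x)
      exact Set.mem_iUnion.2 ⟨n, by simpa using neg_le.1 hn⟩
  have hcs : IsCountablySpanning (Set.range (Set.Ici : ℝ → Set ℝ)) :=
    ⟨fun n => Set.Ici (-(n : ℝ)), fun n => ⟨_, rfl⟩, hspan⟩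
  have h2 : 0 < 2 * lam := by linarith
  let sp : (volume.withDensity (expDensity (2 * lam))).FiniteSpanningSetsIn
      (Set.range (Set.Ici : ℝ → Set ℝ)) :=
    ⟨fun n => Set.Ici (-(n : ℝ)), fun n => ⟨_, rfl⟩, fun n => by
      rw [withDensity_expDensity_Ici h2]
      exact ENNReal.ofReal_lt_top, hspan⟩
  let sp2 := sp.prod sp
  refine Measure.prod_eq_generateFrom generateFrom_boundedBorelSets
    (generateFrom_eq_prod hgen hgen hcs hcs) isPiSystem_boundedBorelSets
    (isPiSystem_Ici.prod isPiSystem_Ici) spanningBoundedBorelSets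
    ⟨sp2.set, sp2.set_mem, fun n => ?_, sp2.spanning⟩ ?_
  · rw [Measure.smul_apply, smul_eq_mul]
    exact ENNReal.mul_lt_top ENNReal.ofReal_lt_top (sp2.finite n)
  -- Joint tails suffice. For `s, t ≥ 0`, reaches of at least `s` and `t` mean a gap of total length
  -- `2 * (s + t)`, whose void probability is a product of two exponential tails.
  · rintro B hB _ ⟨_, ⟨s, rfl⟩, _, ⟨t, rfl⟩, rfl⟩
    have hm : MeasurableSet (B ×ˢ (Set.Ici s ×ˢ Set.Ici t)) :=
      hB.1.prod (measurableSet_Ici.prod measurableSet_Ici)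
    rw [Measure.sum_apply _ hm, Measure.smul_apply, Measure.prod_prod,
      withDensity_expDensity_Ici h2, withDensity_expDensity_Ici h2, smul_eq_mul,
      ← ENNReal.ofReal_mul (by positivity), ← Real.exp_add]
    have h3 : ∀ i, (P.map fun ω => (X i ω, leftReach (fun k => X k ω) i,
        rightReach (fun k => X k ω) i)) (B ×ˢ (Set.Ici s ×ˢ Set.Ici t)) =
        P (X i ⁻¹' B ∩ {ω | ∀ k, k ≠ i →
          X k ω ∉ Set.Ioo (X i ω - 2 * max s 0) (X i ω + 2 * max t 0)}) := by
      intro i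
      rw [Measure.map_apply (hX.measurable_reach i) hm]
      refine measure_congr ?_
      filter_upwards [hX.ae_isGeneric hlam] with ω hω
      refine propext (and_congr_right fun _ => ?_)
      exact hω.le_reach_iff i s t
    simp_rw [h3]
    rw [hX.mecke_gap hlam.le hB.1 hB.2 (by positivity) (by positivity)]
    rw [mul_comm (ENNReal.ofReal lam), mul_assoc]
    congr 4
    ring

lemma tsum_lintegral_reach (hX : IsPoissonProcess P lam X) (hlam : 0 < lam)
    {F : ℝ × ℝ × ℝ → ℝ≥0∞} (hF : Measurable F) :
    ∑' i, ∫⁻ ω, F (X i ω, leftReach (fun k => X k ω) i, rightReach (fun k => X k ω) i) ∂P =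
      ENNReal.ofReal lam * ∫⁻ x, ∫⁻ b, ∫⁻ c,
        expDensity (2 * lam) b * expDensity (2 * lam) c * F (x, b, c) := by
  have hd := measurable_expDensity (2 * lam)
  simp_rw [← fun i => lintegral_map (μ := P) hF (hX.measurable_reach i)]
  rw [← lintegral_sum_measure, ← hX.sum_map_reach hlam, lintegral_prod _ hF.aemeasurable]
  simp_rw [lintegral_smul_measure, smul_eq_mul]
  rw [lintegral_const_mul _ hF.lintegral_prod_right']
  congr 1
  refine lintegral_congr fun x => ?_
  have hFx : Measurable fun p => F (x, p) := hF.comp measurable_prodMk_left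
  rw [lintegral_prod _ hFx.aemeasurable,
    lintegral_withDensity_eq_lintegral_mul _ hd hFx.lintegral_prod_right']
  refine lintegral_congr fun b => ?_
  have hFb : Measurable fun c => F (x, b, c) := hFx.comp measurable_prodMk_left
  rw [Pi.mul_apply, lintegral_withDensity_eq_lintegral_mul _ hd hFb,
    ← lintegral_const_mul _ (hd.mul hFb)]
  simp_rw [Pi.mul_apply, mul_assoc]

end IsPoissonProcess

/-- Here `z` is the offset of a location from the RSU. The integrand is constant on `(-c, b)` and
vanishes elsewhere, so integrating out `z` produces the factor `b + c`, the length bias of the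
covering cell. -/
lemma lintegral_expDensity_sub_mul_add {r : ℝ} (hr : 0 ≤ r) (b c : ℝ) :
    ∫⁻ z, expDensity r (b - z) * expDensity r (c + z) =
      ENNReal.ofReal (r ^ 2 * (b + c) * Real.exp (-(r * (b + c)))) := by
  have h : ∀ z, expDensity r (b - z) * expDensity r (c + z) = (Set.Ioo (-c) b).indicator
      (fun _ => ENNReal.ofReal (r ^ 2 * Real.exp (-(r * (b + c))))) z := by
    intro z
    unfold expDensity
    by_cases h1 : b - z ∈ Set.Ioi (0 : ℝ)
    · by_cases h2 : c + z ∈ Set.Ioi (0 : ℝ)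
      · have hz : z ∈ Set.Ioo (-c) b := by
          simp only [Set.mem_Ioi] at h1 h2
          constructor <;> linarith
        rw [Set.indicator_of_mem h1, Set.indicator_of_mem h2, Set.indicator_of_mem hz,
          ← ENNReal.ofReal_mul' (mul_nonneg hr (Real.exp_pos _).le)]
        congr 1
        rw [show -(r * (b + c)) = -(r * (b - z)) + -(r * (c + z)) by ring, Real.exp_add]
        ring
      · have hz : z ∉ Set.Ioo (-c) b := by
          simp only [Set.mem_Ioi, not_lt] at h2
          rintro ⟨h3, -⟩
          linarith
        rw [Set.indicator_of_notMem h2, Set.indicator_of_notMem hz, mul_zero]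
    · have hz : z ∉ Set.Ioo (-c) b := by
        simp only [Set.mem_Ioi, not_lt] at h1
        rintro ⟨-, h3⟩
        linarith
      rw [Set.indicator_of_notMem h1, Set.indicator_of_notMem hz, zero_mul]
  simp_rw [h]
  rw [lintegral_indicator measurableSet_Ioo, setLIntegral_const, Real.volume_Ioo,
    ← ENNReal.ofReal_mul (by positivity)]
  congr 1
  ring

/-- The joint density of the distances from a fixed location to the end points of its Voronoi
cell. -/
noncomputable def cellDensity (lam b c : ℝ) : ℝ :=
  4 * lam ^ 3 * (b + c) * Real.exp (-(2 * lam * (b + c)))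

namespace IsPoissonProcess

variable {Ω : Type*} [MeasurableSpace Ω] {P : Measure Ω} [IsProbabilityMeasure P] {lam : ℝ}
  {X : ℕ → Ω → ℝ}

/-- The law of the Voronoi cell which covers a fixed location, averaged over a window. -/
lemma tsum_lintegral_voronoiCell (hX : IsPoissonProcess P lam X) (hlam : 0 < lam) (W : Set ℝ)
    {G : ℝ × ℝ → ℝ≥0∞} (hG : Measurable G) :
    ∑' i, ∫⁻ ω, (∫⁻ y in W, (voronoiCell (fun k => X k ω) i).indicator (fun y =>
        G (y - (X i ω - leftReach (fun k => X k ω) i),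
          X i ω + rightReach (fun k => X k ω) i - y)) y) ∂P =
      volume W * ∫⁻ b in Set.Ici 0, ∫⁻ c in Set.Ici 0,
        ENNReal.ofReal (cellDensity lam b c) * G (b, c) := by
  classical
  -- `z` is the location relative to the RSU and `p` holds the reaches of the cell, whose ends are
  -- then at distances `z + p.1` and `p.2 - z` from the location.
  let D : ℝ → ℝ × ℝ → ℝ≥0∞ := fun z p =>
    if -p.1 ≤ z ∧ z ≤ p.2 then G (z + p.1, p.2 - z) else 0
  have hD : Measurable fun q : ℝ × ℝ × ℝ => D q.1 q.2 := by
    refine Measurable.ite ?_ (hG.comp (by fun_prop)) measurable_const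
    exact (measurableSet_le (by fun_prop : Measurable fun q : ℝ × ℝ × ℝ => -q.2.1)
      (by fun_prop : Measurable fun q : ℝ × ℝ × ℝ => q.1)).inter
      (measurableSet_le (by fun_prop : Measurable fun q : ℝ × ℝ × ℝ => q.1)
        (by fun_prop : Measurable fun q : ℝ × ℝ × ℝ => q.2.2))
  let e : ℝ × ℝ → ℝ≥0∞ := fun p => expDensity (2 * lam) p.1 * expDensity (2 * lam) p.2
  have hexp := measurable_expDensity (2 * lam)
  have he : Measurable e := (hexp.comp measurable_fst).mul (hexp.comp measurable_snd)
  have hDW : Measurable fun q : (ℝ × ℝ × ℝ) × ℝ => D (q.2 - q.1.1) q.1.2 :=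
    hD.comp (f := fun q : (ℝ × ℝ × ℝ) × ℝ => (q.2 - q.1.1, q.1.2)) (by fun_prop)
  have h1 : ∀ i, ∫⁻ ω, (∫⁻ y in W, (voronoiCell (fun k => X k ω) i).indicator (fun y =>
        G (y - (X i ω - leftReach (fun k => X k ω) i),
          X i ω + rightReach (fun k => X k ω) i - y)) y) ∂P =
      ∫⁻ ω, (fun q : ℝ × ℝ × ℝ => ∫⁻ y in W, D (y - q.1) q.2)
        (X i ω, leftReach (fun k => X k ω) i, rightReach (fun k => X k ω) i) ∂P := by
    intro i
    refine lintegral_congr_ae ?_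
    filter_upwards [hX.ae_isGeneric hlam] with ω hω
    refine lintegral_congr fun y => ?_
    obtain ⟨-, -, h3⟩ := hω.voronoiCell_eq_Icc i
    by_cases hy : y ∈ voronoiCell (fun k => X k ω) i
    · rw [Set.indicator_of_mem hy]
      rw [h3] at hy
      simp only [D]
      rw [if_pos ⟨by linarith [hy.1], by linarith [hy.2]⟩]
      congr 2 <;> ring
    · rw [Set.indicator_of_notMem hy]
      simp only [D]
      rw [if_neg]
      rintro ⟨h4, h5⟩
      refine hy ?_
      rw [h3]
      constructor <;> linarith
  simp_rw [h1]
  rw [hX.tsum_lintegral_reach hlam hDW.lintegral_prod_right']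
  have h2 : ∀ x, ∫⁻ b, ∫⁻ c, expDensity (2 * lam) b * expDensity (2 * lam) c *
      ∫⁻ y in W, D (y - x) (b, c) = ∫⁻ y in W, ∫⁻ p, e p * D (y - x) p := by
    intro x
    have hx : Measurable fun q : (ℝ × ℝ) × ℝ => D (q.2 - x) q.1 :=
      hD.comp (f := fun q : (ℝ × ℝ) × ℝ => (q.2 - x, q.1)) (by fun_prop)
    have hx2 : Measurable fun p => e p * ∫⁻ y in W, D (y - x) p :=
      he.mul hx.lintegral_prod_right'
    rw [← lintegral_prod (fun p => e p * ∫⁻ y in W, D (y - x) p) hx2.aemeasurable]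
    have h3 : ∀ p, e p * ∫⁻ y in W, D (y - x) p = ∫⁻ y in W, e p * D (y - x) p := fun p =>
      (lintegral_const_mul _ (hx.comp measurable_prodMk_left)).symm
    simp_rw [h3]
    rw [← Measure.volume_eq_prod, lintegral_lintegral_swap]
    exact ((he.comp measurable_fst).mul hx).aemeasurable
  simp_rw [h2]
  have hΨ : Measurable fun z => ∫⁻ p, e p * D z p :=
    ((he.comp measurable_snd).mul hD).lintegral_prod_right'
  have hΨ2 : Measurable (Function.uncurry fun x y : ℝ => ∫⁻ p, e p * D (y - x) p) :=
    hΨ.comp (f := fun q : ℝ × ℝ => q.2 - q.1) (by fun_prop)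
  rw [lintegral_lintegral_swap (f := fun x y => ∫⁻ p, e p * D (y - x) p) hΨ2.aemeasurable]
  -- Integration over the RSU position `x` removes the dependence on `y`, so the window contributes
  -- its volume only.
  have h4 : ∀ y, ∫⁻ x, ∫⁻ p, e p * D (y - x) p = ∫⁻ z, ∫⁻ p, e p * D z p := fun y =>
    lintegral_sub_left_eq_self (fun z => ∫⁻ p, e p * D z p) y
  simp_rw [h4]
  rw [setLIntegral_const, mul_comm _ (volume W), mul_left_comm]
  congr 1
  -- For fixed `z` the reaches are traded, by a translation of the plane, for the distances from the
  -- location to the ends of the cell.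
  have h5 : ∀ z, ∫⁻ p, e p * D z p =
      ∫⁻ p : ℝ × ℝ, (expDensity (2 * lam) (p.1 - z) * expDensity (2 * lam) (p.2 + z)) *
        (Set.Ici 0 ×ˢ Set.Ici 0).indicator G p := by
    intro z
    have hz : Measurable fun p => e p * D z p := he.mul (hD.comp measurable_prodMk_left)
    rw [← (measurePreserving_add_right volume ((-z, z) : ℝ × ℝ)).lintegral_comp hz]
    refine lintegral_congr fun p => ?_
    simp only [e, D, Prod.fst_add, Prod.snd_add, ← sub_eq_add_neg]
    congr 1
    by_cases hp : p ∈ Set.Ici (0 : ℝ) ×ˢ Set.Ici (0 : ℝ)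
    · rw [Set.indicator_of_mem hp, if_pos ⟨by linarith [Set.mem_Ici.1 hp.1],
        by linarith [Set.mem_Ici.1 hp.2]⟩]
      congr 1
      ext <;> simp
    · rw [Set.indicator_of_notMem hp, if_neg]
      rintro ⟨h6, h7⟩
      refine hp ⟨?_, ?_⟩
      · show (0 : ℝ) ≤ p.1
        linarith
      · show (0 : ℝ) ≤ p.2
        linarith
  simp_rw [h5]
  have hGi : Measurable ((Set.Ici (0 : ℝ) ×ˢ Set.Ici (0 : ℝ)).indicator G) :=
    hG.indicator (measurableSet_Ici.prod measurableSet_Ici)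
  have hee : Measurable fun q : ℝ × ℝ × ℝ =>
      expDensity (2 * lam) (q.2.1 - q.1) * expDensity (2 * lam) (q.2.2 + q.1) :=
    (hexp.comp (by fun_prop)).mul (hexp.comp (by fun_prop))
  rw [lintegral_lintegral_swap (hee.mul (hGi.comp measurable_snd)).aemeasurable]
  have h6 : ∀ p : ℝ × ℝ, ∫⁻ z, expDensity (2 * lam) (p.1 - z) * expDensity (2 * lam) (p.2 + z) *
      (Set.Ici 0 ×ˢ Set.Ici 0).indicator G p = (Set.Ici 0 ×ˢ Set.Ici 0).indicator (fun p =>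
        ENNReal.ofReal ((2 * lam) ^ 2 * (p.1 + p.2) * Real.exp (-(2 * lam * (p.1 + p.2)))) *
          G p) p := by
    intro p
    have hp1 : Measurable fun z =>
        expDensity (2 * lam) (p.1 - z) * expDensity (2 * lam) (p.2 + z) :=
      hee.comp (f := fun z : ℝ => (z, p)) measurable_prodMk_right
    rw [lintegral_mul_const _ hp1]
    by_cases hp : p ∈ Set.Ici (0 : ℝ) ×ˢ Set.Ici (0 : ℝ)
    · rw [Set.indicator_of_mem hp, Set.indicator_of_mem hp,
        lintegral_expDensity_sub_mul_add (by linarith)]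
    · rw [Set.indicator_of_notMem hp, Set.indicator_of_notMem hp, mul_zero]
  simp_rw [h6]
  have hm : Measurable fun p : ℝ × ℝ => ENNReal.ofReal ((2 * lam) ^ 2 * (p.1 + p.2) *
      Real.exp (-(2 * lam * (p.1 + p.2)))) * G p := Measurable.mul (by fun_prop) hG
  rw [lintegral_indicator (measurableSet_Ici.prod measurableSet_Ici), Measure.volume_eq_prod,
    ← lintegral_const_mul _ hm, ← Measure.prod_restrict]
  rw [lintegral_prod _ (hm.const_mul _).aemeasurable]
  refine lintegral_congr fun b => lintegral_congr fun c => ?_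
  rw [← mul_assoc, ← ENNReal.ofReal_mul hlam.le, cellDensity]
  congr 2
  ring

end IsPoissonProcess

/-! ### Loads of a fixed set seen from the vehicles in a window. -/

namespace Highway

variable {Ω : Type*} {H : Highway Ω} [MeasurableSpace Ω] {P : Measure Ω} [IsProbabilityMeasure P]
  {lamR lamP m a : ℝ}

namespace IsPlatooned

/-- The vehicles seen from the vehicles located in a fixed window, for counts in a fixed set. -/
lemma tsum_lintegral_vehicles (hH : H.IsPlatooned P lamR lamP m a) {I W : Set ℝ}
    (hI : MeasurableSet I) (hIb : Bornology.IsBounded I) (hW : MeasurableSet W)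
    (h : ℕ → ℕ → ℝ≥0∞) :
    ∑' i, ∑' j, ∫⁻ ω, {ω | j < H.size i ω ∧ H.parent i ω + H.disp i j ω ∈ W}.indicator
        (fun ω => h (H.countOthers I i ω) (mateCount I j (H.parent i ω, H.mark i ω))) ω ∂P =
      ENNReal.ofReal lamP * (ENNReal.ofReal m * ∫⁻ y in W, ∫⁻ ω', ∫⁻ ω'', ∫⁻ ω,
        h (H.count I ω) (platoonCount I (y - H.disp 0 0 ω', H.mark 0 ω'')) ∂P ∂P ∂P) := by
  have hset : ∀ j, MeasurableSet {p : ℝ × ℕ × (ℕ → ℝ) | j < p.2.1 ∧ p.1 + p.2.2 j ∈ W} := by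
    intro j
    refine MeasurableSet.inter ?_ ?_
    · exact measurableSet_lt measurable_const
        (measurable_fst.comp measurable_snd : Measurable fun p : ℝ × ℕ × (ℕ → ℝ) => p.2.1)
    · exact (by fun_prop : Measurable fun p : ℝ × ℕ × (ℕ → ℝ) => p.1 + p.2.2 j) hW
  let ψ : ℕ → ℝ × ℕ × (ℕ → ℝ) → ℕ → ℝ≥0∞ := fun j p n =>
    {p : ℝ × ℕ × (ℕ → ℝ) | j < p.2.1 ∧ p.1 + p.2.2 j ∈ W}.indicator
      (fun p => h n (mateCount I j p)) p
  have hψ : ∀ j n, Measurable fun p => ψ j p n := fun j n =>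
    ((Measurable.of_discrete (f := h n)).comp (measurable_mateCount hI j)).indicator (hset j)
  have hpm : ∀ i, Measurable fun ω => (H.parent i ω, H.mark i ω) := fun i =>
    (hH.parent_poisson.measurable i).prodMk (hH.measurable_mark i)
  have hψc : ∀ j, Measurable fun q : (ℝ × ℕ × (ℕ → ℝ)) × ℕ => ψ j q.1 q.2 := fun j =>
    measurable_from_prod_countable_left (hψ j)
  have h1 : ∀ i, ∑' j, ∫⁻ ω, {ω | j < H.size i ω ∧ H.parent i ω + H.disp i j ω ∈ W}.indicator
        (fun ω => h (H.countOthers I i ω) (mateCount I j (H.parent i ω, H.mark i ω))) ω ∂P =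
      ∫⁻ ω, (fun p n => ∑' j, ψ j p n) (H.parent i ω, H.mark i ω) (H.countOthers I i ω) ∂P := by
    intro i
    have hi : ∀ j, Measurable fun ω => ψ j (H.parent i ω, H.mark i ω) (H.countOthers I i ω) :=
      fun j => (hψc j).comp ((hpm i).prodMk (hH.measurable_countOthers hI i))
    rw [lintegral_tsum fun j => (hi j).aemeasurable]
    rfl
  simp_rw [h1]
  rw [hH.lintegral_mecke hI hIb (Ψ := fun p n => ∑' j, ψ j p n) fun n =>
    Measurable.tsum fun j => hψ j n]
  congr 1
  have hcount := hH.measurable_count hI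
  have hmark := hH.measurable_mark 0
  let g : ℕ → ℝ≥0∞ := fun n => ∫⁻ ω, h (H.count I ω) n ∂P
  have h2 : ∀ p, ∫⁻ ω, ∑' j, ψ j p (H.count I ω) ∂P = ∑' j,
      {p : ℝ × ℕ × (ℕ → ℝ) | j < p.2.1 ∧ p.1 + p.2.2 j ∈ W}.indicator
        (fun p => g (mateCount I j p)) p := by
    intro p
    have hp : ∀ j, Measurable fun ω => ψ j p (H.count I ω) := fun j =>
      (Measurable.of_discrete (f := ψ j p)).comp hcount
    rw [lintegral_tsum fun j => (hp j).aemeasurable]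
    refine tsum_congr fun j => ?_
    by_cases hp : p ∈ {p : ℝ × ℕ × (ℕ → ℝ) | j < p.2.1 ∧ p.1 + p.2.2 j ∈ W}
    · rw [Set.indicator_of_mem hp]
      simp only [ψ, Set.indicator_of_mem hp, g]
    · rw [Set.indicator_of_notMem hp]
      simp only [ψ, Set.indicator_of_notMem hp, lintegral_zero]
  simp_rw [h2]
  have hg : ∀ j, Measurable fun p => g (mateCount I j p) := fun j =>
    (Measurable.of_discrete (f := g)).comp (measurable_mateCount hI j)
  have hgi : ∀ j, Measurable fun p =>
      {p : ℝ × ℕ × (ℕ → ℝ) | j < p.2.1 ∧ p.1 + p.2.2 j ∈ W}.indicator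
        (fun p => g (mateCount I j p)) p := fun j => (hg j).indicator (hset j)
  have hgω : ∀ j, Measurable fun q : ℝ × Ω =>
      {p : ℝ × ℕ × (ℕ → ℝ) | j < p.2.1 ∧ p.1 + p.2.2 j ∈ W}.indicator
        (fun p => g (mateCount I j p)) (q.1, H.mark 0 q.2) := fun j =>
    (hgi j).comp (measurable_fst.prodMk (hmark.comp measurable_snd))
  -- The substitution `y = x + disp` replaces the platoon centre by the position of the vehicle; the
  -- centre becomes `y` minus the displacement of that vehicle.
  have h3 : ∀ j, ∫⁻ x, ∫⁻ ω', {p : ℝ × ℕ × (ℕ → ℝ) | j < p.2.1 ∧ p.1 + p.2.2 j ∈ W}.indicator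
        (fun p => g (mateCount I j p)) (x, H.mark 0 ω') ∂P =
      ∫⁻ y in W, ∫⁻ ω, {ω | j < H.size 0 ω}.indicator
        (fun ω => g (mateCount I j (y - H.disp 0 j ω, H.mark 0 ω))) ω ∂P := by
    intro j
    have hsh : Measurable fun q : ℝ × Ω =>
        {p : ℝ × ℕ × (ℕ → ℝ) | j < p.2.1 ∧ p.1 + p.2.2 j ∈ W}.indicator
          (fun p => g (mateCount I j p)) (q.1 - H.disp 0 j q.2, H.mark 0 q.2) :=
      (hgi j).comp ((measurable_fst.sub ((hH.measurable_disp 0 j).comp measurable_snd)).prodMk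
        (hmark.comp measurable_snd))
    rw [lintegral_lintegral_swap (hgω j).aemeasurable]
    have h4 : ∀ ω', ∫⁻ x, {p : ℝ × ℕ × (ℕ → ℝ) | j < p.2.1 ∧ p.1 + p.2.2 j ∈ W}.indicator
          (fun p => g (mateCount I j p)) (x, H.mark 0 ω') =
        ∫⁻ y, {p : ℝ × ℕ × (ℕ → ℝ) | j < p.2.1 ∧ p.1 + p.2.2 j ∈ W}.indicator
          (fun p => g (mateCount I j p)) (y - H.disp 0 j ω', H.mark 0 ω') := fun ω' =>
      (lintegral_sub_right_eq_self _ _).symm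
    simp_rw [h4]
    rw [← lintegral_lintegral_swap (f := fun (y : ℝ) ω' =>
      {p : ℝ × ℕ × (ℕ → ℝ) | j < p.2.1 ∧ p.1 + p.2.2 j ∈ W}.indicator
          (fun p => g (mateCount I j p)) (y - H.disp 0 j ω', H.mark 0 ω')) hsh.aemeasurable,
      ← lintegral_indicator hW]
    refine lintegral_congr fun y => ?_
    by_cases hy : y ∈ W
    · rw [Set.indicator_of_mem hy]
      refine lintegral_congr fun ω => ?_
      by_cases hs : j < H.size 0 ω
      · rw [Set.indicator_of_mem (by simpa [mark] using ⟨hs, hy⟩),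
          Set.indicator_of_mem (show ω ∈ {ω | j < H.size 0 ω} from hs)]
      · rw [Set.indicator_of_notMem (by simp [mark, hs]),
          Set.indicator_of_notMem (show ω ∉ {ω | j < H.size 0 ω} from hs)]
    · rw [Set.indicator_of_notMem hy]
      simp [mark, hy]
  have h5 : ∀ y, ∑' j, ∫⁻ ω, {ω | j < H.size 0 ω}.indicator
        (fun ω => g (mateCount I j (y - H.disp 0 j ω, H.mark 0 ω))) ω ∂P =
      ENNReal.ofReal m * ∫⁻ ω', ∫⁻ ω'', ∫⁻ ω,
        h (H.count I ω) (platoonCount I (y - H.disp 0 0 ω', H.mark 0 ω'')) ∂P ∂P ∂P := fun y =>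
    hH.tsum_lintegral_mateCount hI g y
  have hj : ∀ j, Measurable fun y => ∫⁻ ω, {ω | j < H.size 0 ω}.indicator
        (fun ω => g (mateCount I j (y - H.disp 0 j ω, H.mark 0 ω))) ω ∂P := by
    intro j
    refine Measurable.lintegral_prod_right' (f := fun q : ℝ × Ω => {ω | j < H.size 0 ω}.indicator
        (fun ω => g (mateCount I j (q.1 - H.disp 0 j ω, H.mark 0 ω))) q.2) ?_
    have : Measurable fun q : ℝ × Ω => g (mateCount I j (q.1 - H.disp 0 j q.2, H.mark 0 q.2)) :=
      (hg j).comp ((measurable_fst.sub ((hH.measurable_disp 0 j).comp measurable_snd)).prodMk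
        (hmark.comp measurable_snd))
    exact this.indicator (measurable_snd (measurableSet_lt measurable_const
      (hH.measurable_size 0) : MeasurableSet {ω | j < H.size 0 ω}))
  have h6 : ∀ x, ∫⁻ ω', ∑' j, {p : ℝ × ℕ × (ℕ → ℝ) | j < p.2.1 ∧ p.1 + p.2.2 j ∈ W}.indicator
        (fun p => g (mateCount I j p)) (x, H.mark 0 ω') ∂P = ∑' j, ∫⁻ ω',
        {p : ℝ × ℕ × (ℕ → ℝ) | j < p.2.1 ∧ p.1 + p.2.2 j ∈ W}.indicator
        (fun p => g (mateCount I j p)) (x, H.mark 0 ω') ∂P := fun x =>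
    lintegral_tsum fun j => ((hgω j).comp measurable_prodMk_left).aemeasurable
  simp_rw [h6]
  rw [lintegral_tsum fun j => ((hgω j).lintegral_prod_right').aemeasurable]
  simp_rw [h3]
  rw [← lintegral_tsum fun j => (hj j).aemeasurable]
  simp_rw [h5]
  exact lintegral_const_mul' _ _ ENNReal.ofReal_ne_top

end IsPlatooned

end Highway

/-! ### The tagged cell: measurability and almost sure uniqueness. -/

namespace Highway

variable {Ω : Type*} {H : Highway Ω}

lemma taggedCell_eq_cell {p : ℕ × ℕ} {ω : Ω} {k : ℕ} (hk : H.pos p ω ∈ H.cell k ω)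
    (hu : ∀ l, H.pos p ω ∈ H.cell l ω → l = k) : H.taggedCell p ω = H.cell k ω := by
  ext x
  simp only [taggedCell, servingCell, Set.mem_iUnion, exists_prop]
  constructor
  · rintro ⟨l, hl, hx⟩
    rwa [← hu l hl]
  · exact fun hx => ⟨k, hk, hx⟩

lemma ownPlatoonLoad_eq_mateCount (p : ℕ × ℕ) (ω : Ω) :
    H.ownPlatoonLoad p ω = mateCount (H.taggedCell p ω) p.2 (H.parent p.1 ω, H.mark p.1 ω) := by
  refine Eq.trans ?_ (Set.ncard_image_of_injective _ (f := fun j => (p.1, j))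
    fun j j' h => by simpa using h)
  refine congrArg Set.ncard (Set.ext fun ⟨i, j⟩ => ?_)
  simp only [Set.mem_ofPred_eq, Set.mem_image, Prod.mk.injEq]
  constructor
  · rintro ⟨h1, rfl, h2, h3⟩
    exact ⟨j, ⟨h1, fun h => h2 (by rw [h]), h3⟩, rfl, rfl⟩
  · rintro ⟨j', ⟨h1, h2, h3⟩, rfl, rfl⟩
    exact ⟨h1, rfl, fun h => h2 (by rw [← h]), h3⟩

variable [MeasurableSpace Ω] {P : Measure Ω} [IsProbabilityMeasure P] {lamR lamP m a : ℝ}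

namespace IsPlatooned

lemma measurableSet_mem_cell (hH : H.IsPlatooned P lamR lamP m a) {α : Type*} [MeasurableSpace α]
    {f : α → ℝ} {g : α → Ω} (hf : Measurable f) (hg : Measurable g) (k : ℕ) :
    MeasurableSet {x | f x ∈ H.cell k (g x)} :=
  ((hH.measurable_rsu_fun.comp hg).prodMk hf) (measurableSet_mem_voronoiCell k)

lemma measurableSet_mem_taggedCell (hH : H.IsPlatooned P lamR lamP m a) {α : Type*}
    [MeasurableSpace α] {f : α → ℝ} {g : α → Ω} (hf : Measurable f) (hg : Measurable g)
    (p : ℕ × ℕ) : MeasurableSet {x | f x ∈ H.taggedCell p (g x)} := by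
  have h : {x | f x ∈ H.taggedCell p (g x)} = ⋃ k, {x | H.pos p (g x) ∈ H.cell k (g x)} ∩
      {x | f x ∈ H.cell k (g x)} := by
    ext x
    simp [taggedCell, servingCell]
  rw [h]
  exact MeasurableSet.iUnion fun k => (hH.measurableSet_mem_cell
    ((hH.measurable_pos p).comp hg) hg k).inter (hH.measurableSet_mem_cell hf hg k)

lemma measurable_taggedLength (hH : H.IsPlatooned P lamR lamP m a) (p : ℕ × ℕ) :
    Measurable (H.taggedLength p) :=
  measurable_volumeReal_section (hH.measurableSet_mem_taggedCell measurable_snd measurable_fst p)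

lemma measurable_otherPlatoonsLoad (hH : H.IsPlatooned P lamR lamP m a) (p : ℕ × ℕ) :
    Measurable (H.otherPlatoonsLoad p) :=
  measurable_ncard_setOf fun q => (hH.measurableSet_vehicles q).inter
    ((MeasurableSet.const _).inter
      (hH.measurableSet_mem_taggedCell (hH.measurable_pos q) measurable_id p))

lemma measurable_ownPlatoonLoad (hH : H.IsPlatooned P lamR lamP m a) (p : ℕ × ℕ) :
    Measurable (H.ownPlatoonLoad p) :=
  measurable_ncard_setOf fun q => (hH.measurableSet_vehicles q).inter
    ((MeasurableSet.const _).inter ((MeasurableSet.const _).inter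
      (hH.measurableSet_mem_taggedCell (hH.measurable_pos q) measurable_id p)))

/-- The displacement has no atoms and is independent of RSUs and centres, so it almost surely misses
the value that puts the vehicle on a midpoint. -/
lemma ae_pos_ne_midpoint (hH : H.IsPlatooned P lamR lamP m a) :
    ∀ᵐ ω ∂P, ∀ p k l, H.pos p ω ≠ (H.rsu k ω + H.rsu l ω) / 2 := by
  refine ae_all_iff.2 fun p => ae_all_iff.2 fun k => ae_all_iff.2 fun l => ?_
  have hind : IndepFun (fun ω => (H.rsu k ω + H.rsu l ω) / 2 - H.parent p.1 ω)
      (H.disp p.1 p.2) P :=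
    hH.indep_points_size_disp.comp
      (φ := fun q : (ℕ → ℝ) × (ℕ → ℝ) × (ℕ → ℕ) => (q.1 k + q.1 l) / 2 - q.2.1 p.1)
      (ψ := fun q : ℕ × ℕ → ℝ => q p) (by fun_prop) (by fun_prop)
  have hX : Measurable fun ω => (H.rsu k ω + H.rsu l ω) / 2 - H.parent p.1 ω :=
    (((hH.rsu_poisson.measurable k).add (hH.rsu_poisson.measurable l)).div_const 2).sub
      (hH.parent_poisson.measurable p.1)
  have hY := hH.measurable_disp p.1 p.2
  have hS : MeasurableSet {q : ℝ × ℝ | q.1 = q.2} :=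
    measurableSet_eq_fun measurable_fst measurable_snd
  have h := lintegral_comp_of_indepFun hX hY hind (f := {q : ℝ × ℝ | q.1 = q.2}.indicator 1)
    (measurable_one.indicator hS)
  have hXY : MeasurableSet {ω | (H.rsu k ω + H.rsu l ω) / 2 - H.parent p.1 ω =
      H.disp p.1 p.2 ω} := measurableSet_eq_fun hX hY
  have h0 : ∀ x, ∫⁻ ω, {q : ℝ × ℝ | q.1 = q.2}.indicator 1 (x, H.disp p.1 p.2 ω) ∂P = 0 := by
    intro x
    have h1 : P {ω | x = H.disp p.1 p.2 ω} = 0 := by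
      have : {ω | x = H.disp p.1 p.2 ω} = H.disp p.1 p.2 ⁻¹' {x} := by
        ext ω
        simp [eq_comm]
      rw [this, ← Measure.map_apply hY (measurableSet_singleton x), hH.disp_law]
      exact cond_absolutelyContinuous (measure_singleton x)
    rw [← h1, ← lintegral_indicator_one (measurableSet_eq_fun measurable_const hY)]
    rfl
  simp_rw [h0, lintegral_zero] at h
  refine (measure_eq_zero_iff_ae_notMem.1 ?_ : ∀ᵐ ω ∂P, ω ∉ {ω | (H.rsu k ω + H.rsu l ω) / 2 -
    H.parent p.1 ω = H.disp p.1 p.2 ω}).mono fun ω hω h2 => hω ?_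
  · rw [← h, ← lintegral_indicator_one hXY]
    rfl
  · rw [Set.mem_ofPred_eq, ← h2, pos]
    ring

lemma ae_existsUnique_cell (hH : H.IsPlatooned P lamR lamP m a) (hlamR : 0 < lamR) :
    ∀ᵐ ω ∂P, ∀ p, ∃ k, H.pos p ω ∈ H.cell k ω ∧ Bornology.IsBounded (H.cell k ω) ∧
      ∀ l, H.pos p ω ∈ H.cell l ω → l = k := by
  filter_upwards [hH.ae_pos_ne_midpoint, hH.rsu_poisson.ae_isGeneric hlamR] with ω h1 h2 p
  obtain ⟨k, hk⟩ := h2.exists_mem_voronoiCell (H.pos p ω)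
  refine ⟨k, hk, h2.isBounded_voronoiCell k, fun l hl => ?_⟩
  by_contra h
  exact h1 p l k (eq_midpoint_of_mem_voronoiCell h2.injective h hl hk)

/-- `ncard` is additive over disjoint finite sets; finiteness comes from the boundedness of the
tagged cell. -/
lemma ae_taggedLoad_eq_add (hH : H.IsPlatooned P lamR lamP m a) (hlamR : 0 < lamR) :
    ∀ᵐ ω ∂P, ∀ p, H.taggedLoad p ω = H.otherPlatoonsLoad p ω + H.ownPlatoonLoad p ω := by
  filter_upwards [hH.ae_existsUnique_cell hlamR, hH.ae_finite_vehicles] with ω h1 h2 p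
  obtain ⟨k, hk, hb, hu⟩ := h1 p
  have hfin := h2 _ hb
  rw [← taggedCell_eq_cell hk hu] at hfin
  rw [taggedLoad, otherPlatoonsLoad, ownPlatoonLoad, ← Set.ncard_union_eq
    (Set.disjoint_left.2 fun q hq hq' => hq.2.1 hq'.2.1)
    (hfin.subset fun q hq => ⟨hq.1, hq.2.2⟩) (hfin.subset fun q hq => ⟨hq.1, hq.2.2.2⟩)]
  · refine congrArg Set.ncard (Set.ext fun q => ?_)
    simp only [Set.mem_ofPred_eq, Set.mem_union]
    constructor
    · rintro ⟨h3, h4, h5⟩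
      by_cases h : q.1 = p.1
      · exact Or.inr ⟨h3, h, h4, h5⟩
      · exact Or.inl ⟨h3, h, h5⟩
    · rintro (⟨h3, h4, h5⟩ | ⟨h3, -, h4, h5⟩)
      · exact ⟨h3, fun h => h4 (by rw [h]), h5⟩
      · exact ⟨h3, h4, h5⟩

end IsPlatooned

end Highway

/-! ### Freezing the RSUs and summing over the cells. -/

namespace Highway

variable {Ω : Type*} {H : Highway Ω}

lemma platoonCount_Icc (b c x y : ℝ) (M : ℕ × (ℕ → ℝ)) :
    platoonCount (Set.Icc (y - b) (y + c)) (y + x, M) = platoonCount (Set.Icc (-b) c) (x, M) := by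
  refine congrArg Set.ncard (Set.ext fun j => and_congr_right fun _ => ?_)
  simp only [Set.mem_Icc]
  constructor <;> rintro ⟨h1, h2⟩ <;> constructor <;> linarith

lemma measurable_platoonCount_Icc : Measurable fun q : (ℝ × ℝ) × ℝ × ℕ × (ℕ → ℝ) =>
    platoonCount (Set.Icc (-q.1.1) q.1.2) q.2 := by
  refine measurable_ncard_setOf fun j => MeasurableSet.inter ?_ (MeasurableSet.inter ?_ ?_)
  · exact measurableSet_lt measurable_const
      (measurable_fst.comp (measurable_snd.comp measurable_snd) :
        Measurable fun q : (ℝ × ℝ) × ℝ × ℕ × (ℕ → ℝ) => q.2.2.1)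
  · exact measurableSet_le (by fun_prop : Measurable fun q : (ℝ × ℝ) × ℝ × ℕ × (ℕ → ℝ) => -q.1.1)
      (by fun_prop : Measurable fun q : (ℝ × ℝ) × ℝ × ℕ × (ℕ → ℝ) => q.2.1 + q.2.2.2 j)
  · exact measurableSet_le
      (by fun_prop : Measurable fun q : (ℝ × ℝ) × ℝ × ℕ × (ℕ → ℝ) => q.2.1 + q.2.2.2 j)
      (by fun_prop : Measurable fun q : (ℝ × ℝ) × ℝ × ℕ × (ℕ → ℝ) => q.1.2)

/-- The positions of the RSUs and of the platoon centres, and the sizes and displacements of the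
platoons. -/
abbrev Config : Type := (ℕ → ℝ) × (ℕ → ℝ) × (ℕ → ℕ × (ℕ → ℝ))

/-- The `j`-th vehicle of the `i`-th platoon is present, and located in `W` and in the `k`-th
cell. -/
def configEvent (W : Set ℝ) (k i j : ℕ) : Set Config :=
  {q | j < (q.2.2 i).1 ∧ q.2.1 i + (q.2.2 i).2 j ∈ W ∧
    q.2.1 i + (q.2.2 i).2 j ∈ voronoiCell q.1 k}

/-- The length of the `k`-th cell, with the numbers of vehicles in it which are not in the `i`-th
platoon, and which are in the `i`-th platoon but are not its `j`-th vehicle. -/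
noncomputable def configData (k i j : ℕ) (q : Config) : ℝ × ℕ × ℕ :=
  (volume.real (voronoiCell q.1 k),
    {p : ℕ × ℕ | p.2 < (q.2.2 p.1).1 ∧ p.1 ≠ i ∧
      q.2.1 p.1 + (q.2.2 p.1).2 p.2 ∈ voronoiCell q.1 k}.ncard,
    mateCount (voronoiCell q.1 k) j (q.2.1 i, q.2.2 i))

lemma measurableSet_configSize (i j : ℕ) : MeasurableSet {q : Config | j < (q.2.2 i).1} :=
  measurableSet_lt measurable_const (by fun_prop : Measurable fun q : Config => (q.2.2 i).1)

lemma measurableSet_configCell (k i j : ℕ) :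
    MeasurableSet {q : Config | q.2.1 i + (q.2.2 i).2 j ∈ voronoiCell q.1 k} :=
  (by fun_prop : Measurable fun q : Config => (q.1, q.2.1 i + (q.2.2 i).2 j))
    (measurableSet_mem_voronoiCell k)

lemma measurableSet_configEvent {W : Set ℝ} (hW : MeasurableSet W) (k i j : ℕ) :
    MeasurableSet (configEvent W k i j) :=
  (measurableSet_configSize i j).inter (MeasurableSet.inter
    ((by fun_prop : Measurable fun q : Config => q.2.1 i + (q.2.2 i).2 j) hW)
    (measurableSet_configCell k i j))

lemma measurable_configData (k i j : ℕ) : Measurable (configData k i j) := by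
  refine Measurable.prodMk ?_ (Measurable.prodMk ?_ ?_)
  · refine measurable_volumeReal_section ?_
    exact (by fun_prop : Measurable fun q : Config × ℝ => (q.1.1, q.2))
      (measurableSet_mem_voronoiCell k)
  · refine measurable_ncard_setOf fun p => MeasurableSet.inter ?_
      (MeasurableSet.inter (MeasurableSet.const _) ?_)
    · exact measurableSet_configSize p.1 p.2
    · exact measurableSet_configCell k p.1 p.2
  · refine measurable_ncard_setOf fun j' => MeasurableSet.inter ?_
      (MeasurableSet.inter (MeasurableSet.const _) ?_)
    · exact measurableSet_configSize i j'
    · exact measurableSet_configCell k i j'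

variable [MeasurableSpace Ω] {P : Measure Ω} [IsProbabilityMeasure P] {lamR lamP m a : ℝ}

namespace IsPlatooned

lemma measurable_count_closedBall (hH : H.IsPlatooned P lamR lamP m a) :
    Measurable fun q : ℝ × Ω => H.count (Metric.closedBall 0 q.1) q.2 := by
  refine measurable_ncard_setOf fun p => MeasurableSet.inter
    (measurable_snd (hH.measurableSet_vehicles p)) ?_
  exact measurableSet_le (((hH.measurable_pos p).comp measurable_snd).dist measurable_const)
    measurable_fst

lemma lintegral_count_Icc (hH : H.IsPlatooned P lamR lamP m a) (h : ℕ → ℝ≥0∞) (b c y : ℝ) :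
    ∫⁻ ω, h (H.count (Set.Icc (y - b) (y + c)) ω) ∂P =
      ∫⁻ ω, h (H.count (Metric.closedBall 0 ((b + c) / 2)) ω) ∂P := by
  have hset : Set.Icc (y - b) (y + c) =
      (· + -(y + (c - b) / 2)) ⁻¹' Metric.closedBall 0 ((b + c) / 2) := by
    ext x
    simp only [Set.mem_Icc, Set.mem_preimage, Real.closedBall_eq_Icc]
    constructor <;> rintro ⟨h1, h2⟩ <;> constructor <;> linarith
  rw [← lintegral_map (f := h) .of_discrete (hH.measurable_count measurableSet_Icc), hset,
    hH.map_count_translate measurableSet_closedBall Metric.isBounded_closedBall,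
    lintegral_map .of_discrete (hH.measurable_count measurableSet_closedBall)]

end IsPlatooned

/-- The expectation of a function of the length of a cell `[-b, c]` and of two independent loads:
the number of vehicles in it, and the number of vehicles in it of a platoon one of whose vehicles
is at the origin. -/
noncomputable def cellIntegral (H : Highway Ω) (P : Measure Ω) (h : ℝ × ℕ × ℕ → ℝ≥0∞)
    (q : ℝ × ℝ) : ℝ≥0∞ :=
  ∫⁻ ω', ∫⁻ ω'', ∫⁻ ω, h (q.1 + q.2, H.count (Metric.closedBall 0 ((q.1 + q.2) / 2)) ω,
    platoonCount (Set.Icc (-q.1) q.2) (-H.disp 0 0 ω', H.mark 0 ω'')) ∂P ∂P ∂P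

namespace IsPlatooned

lemma measurable_cellIntegral (hH : H.IsPlatooned P lamR lamP m a) {h : ℝ × ℕ × ℕ → ℝ≥0∞}
    (hh : Measurable h) : Measurable (cellIntegral H P h) := by
  have hG : Measurable fun q : (((ℝ × ℝ) × Ω) × Ω) × Ω =>
      h (q.1.1.1.1 + q.1.1.1.2, H.count (Metric.closedBall 0 ((q.1.1.1.1 + q.1.1.1.2) / 2)) q.2,
        platoonCount (Set.Icc (-q.1.1.1.1) q.1.1.1.2) (-H.disp 0 0 q.1.1.2, H.mark 0 q.1.2)) := by
    refine hh.comp (Measurable.prodMk (by fun_prop) (Measurable.prodMk ?_ ?_))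
    · exact hH.measurable_count_closedBall.comp (f := fun q : (((ℝ × ℝ) × Ω) × Ω) × Ω =>
        ((q.1.1.1.1 + q.1.1.1.2) / 2, q.2)) (by fun_prop)
    · have hd := hH.measurable_disp 0 0
      have hk := hH.measurable_mark 0
      exact measurable_platoonCount_Icc.comp (f := fun q : (((ℝ × ℝ) × Ω) × Ω) × Ω =>
        (q.1.1.1, (-H.disp 0 0 q.1.1.2, H.mark 0 q.1.2))) (by fun_prop)
  exact hG.lintegral_prod_right'.lintegral_prod_right'.lintegral_prod_right'

lemma measurable_vehicles_fun (hH : H.IsPlatooned P lamR lamP m a) :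
    Measurable fun ω => (fun i => H.parent i ω, fun i => H.mark i ω) :=
  hH.measurable_parent_fun.prodMk hH.measurable_mark_fun

/-- The vehicle almost surely lies in one cell only, so at most one `k` contributes. Independence
lets the vehicles be resampled while the RSUs are kept fixed. -/
lemma setLIntegral_tagged (hH : H.IsPlatooned P lamR lamP m a) (hlamR : 0 < lamR) {W : Set ℝ}
    (hW : MeasurableSet W) {h : ℝ × ℕ × ℕ → ℝ≥0∞} (hh : Measurable h) (p : ℕ × ℕ) :
    ∫⁻ ω in {ω | p ∈ H.vehicles ω ∧ H.pos p ω ∈ W},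
        h (H.taggedLength p ω, H.otherPlatoonsLoad p ω, H.ownPlatoonLoad p ω) ∂P =
      ∑' k, ∫⁻ ω, ∫⁻ ω', (configEvent W k p.1 p.2).indicator
        (fun q => h (configData k p.1 p.2 q))
        (fun i => H.rsu i ω, (fun i => H.parent i ω', fun i => H.mark i ω')) ∂P ∂P := by
  have hf : ∀ k, Measurable ((configEvent W k p.1 p.2).indicator
      fun q => h (configData k p.1 p.2 q)) := fun k =>
    (hh.comp (measurable_configData k p.1 p.2)).indicator (measurableSet_configEvent hW k p.1 p.2)
  have h2 := fun k => (lintegral_comp_of_indepFun hH.measurable_rsu_fun hH.measurable_vehicles_fun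
    hH.indepFun_rsu_vehicles (hf k)).symm
  have hfω := fun k => (hf k).comp (hH.measurable_rsu_fun.prodMk hH.measurable_vehicles_fun)
  have hm : MeasurableSet {ω | p ∈ H.vehicles ω ∧ H.pos p ω ∈ W} :=
    (hH.measurableSet_vehicles p).inter (hH.measurable_pos p hW)
  rw [tsum_congr h2]
  refine Eq.trans ?_ (lintegral_tsum fun k => (hfω k).aemeasurable)
  rw [← lintegral_indicator hm]
  refine lintegral_congr_ae ?_
  filter_upwards [hH.ae_existsUnique_cell hlamR] with ω hω
  obtain ⟨k, hk, -, hu⟩ := hω p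
  let q₀ : Config :=
    (fun i => H.rsu i ω, fun i => H.parent i ω, fun i => H.mark i ω)
  rw [tsum_eq_single k]
  · by_cases hp : ω ∈ {ω | p ∈ H.vehicles ω ∧ H.pos p ω ∈ W}
    · rw [Set.indicator_of_mem hp]
      refine Eq.trans ?_ (Set.indicator_of_mem (s := configEvent W k p.1 p.2)
        (show q₀ ∈ _ from ⟨hp.1, hp.2, hk⟩) _).symm
      rw [ownPlatoonLoad_eq_mateCount, taggedLength, otherPlatoonsLoad, taggedCell_eq_cell hk hu]
      rfl
    · rw [Set.indicator_of_notMem hp]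
      exact (Set.indicator_of_notMem (s := configEvent W k p.1 p.2)
        (fun hq : q₀ ∈ _ => hp ⟨hq.1, hq.2.1⟩) _).symm
  · intro l hl
    exact Set.indicator_of_notMem (s := configEvent W l p.1 p.2)
      (fun hq : q₀ ∈ _ => hl (hu l hq.2.2)) _

/-- With the RSUs frozen the cell is a fixed bounded set, so `tsum_lintegral_vehicles` applies to
the window `W ∩ voronoiCell x k`. After recentring at `y`, only the distances to the ends of the
cell remain. -/
lemma tsum_lintegral_config (hH : H.IsPlatooned P lamR lamP m a) {W : Set ℝ}
    (hW : MeasurableSet W) (h : ℝ × ℕ × ℕ → ℝ≥0∞) {x : ℕ → ℝ} (hx : IsGeneric x) (k : ℕ) :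
    ∑' i, ∑' j, ∫⁻ ω, (configEvent W k i j).indicator (fun q => h (configData k i j q))
        (x, (fun i => H.parent i ω, fun i => H.mark i ω)) ∂P =
      ENNReal.ofReal lamP * (ENNReal.ofReal m * ∫⁻ y in W, (voronoiCell x k).indicator (fun y =>
          cellIntegral H P h (y - (x k - leftReach x k), x k + rightReach x k - y)) y) := by
  have hI := (isClosed_voronoiCell x k).measurableSet
  refine (hH.tsum_lintegral_vehicles hI (hx.isBounded_voronoiCell k) (hW.inter hI)
    fun n l => h (volume.real (voronoiCell x k), n, l)).trans ?_
  rw [Set.inter_comm, ← Measure.restrict_restrict hI, ← lintegral_indicator hI]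
  congr 2
  refine lintegral_congr fun y => ?_
  by_cases hy : y ∈ voronoiCell x k
  · rw [Set.indicator_of_mem hy, Set.indicator_of_mem hy]
    obtain ⟨-, -, hc⟩ := hx.voronoiCell_eq_Icc k
    set b := y - (x k - leftReach x k)
    set c := x k + rightReach x k - y
    have hbc : voronoiCell x k = Set.Icc (y - b) (y + c) := by
      refine hc.trans ?_
      congr 1 <;> simp only [b, c] <;> ring
    have hle : y - b ≤ y + c := Set.nonempty_Icc.1 (hbc ▸ ⟨y, hy⟩)
    have hvol : volume.real (voronoiCell x k) = b + c := by
      rw [hbc, Real.volume_real_Icc_of_le hle]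
      ring
    refine lintegral_congr fun ω' => lintegral_congr fun ω'' => ?_
    rw [hvol, hbc, sub_eq_add_neg y (H.disp 0 0 ω'), platoonCount_Icc]
    exact hH.lintegral_count_Icc (fun n => h (b + c, n, _)) b c y
  · rw [Set.indicator_of_notMem hy, Set.indicator_of_notMem hy]

/-- The vehicles, seen together with their cells and loads. -/
lemma tsum_lintegral_tagged (hH : H.IsPlatooned P lamR lamP m a) (hlamR : 0 < lamR) {W : Set ℝ}
    (hW : MeasurableSet W) {h : ℝ × ℕ × ℕ → ℝ≥0∞} (hh : Measurable h) :
    ∑' p, ∫⁻ ω in {ω | p ∈ H.vehicles ω ∧ H.pos p ω ∈ W},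
        h (H.taggedLength p ω, H.otherPlatoonsLoad p ω, H.ownPlatoonLoad p ω) ∂P =
      ENNReal.ofReal lamP * (ENNReal.ofReal m * (volume W * ∫⁻ b in Set.Ici 0, ∫⁻ c in Set.Ici 0,
        ENNReal.ofReal (cellDensity lamR b c) * cellIntegral H P h (b, c))) := by
  rw [tsum_congr fun p => hH.setLIntegral_tagged hlamR hW hh p, ENNReal.tsum_comm,
    ← hH.rsu_poisson.tsum_lintegral_voronoiCell hlamR W (hH.measurable_cellIntegral hh),
    ← ENNReal.tsum_mul_left, ← ENNReal.tsum_mul_left]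
  refine tsum_congr fun k => ?_
  rw [← lintegral_const_mul' _ _ ENNReal.ofReal_ne_top,
    ← lintegral_const_mul' _ _ ENNReal.ofReal_ne_top]
  have hm : ∀ p : ℕ × ℕ, Measurable fun ω => ∫⁻ ω', (configEvent W k p.1 p.2).indicator
      (fun q => h (configData k p.1 p.2 q))
      (fun i => H.rsu i ω, (fun i => H.parent i ω', fun i => H.mark i ω')) ∂P := by
    intro p
    have hf : Measurable ((configEvent W k p.1 p.2).indicator
        fun q => h (configData k p.1 p.2 q)) :=
      (hh.comp (measurable_configData k p.1 p.2)).indicator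
        (measurableSet_configEvent hW k p.1 p.2)
    exact Measurable.lintegral_prod_right' (hf.comp
      ((hH.measurable_rsu_fun.comp measurable_fst).prodMk
        (hH.measurable_vehicles_fun.comp measurable_snd)))
  rw [← lintegral_tsum fun p => (hm p).aemeasurable]
  refine lintegral_congr_ae ?_
  filter_upwards [hH.rsu_poisson.ae_isGeneric hlamR] with ω hω
  rw [← hH.tsum_lintegral_config hW h hω k]
  exact ENNReal.tsum_prod (f := fun i j => ∫⁻ ω', (configEvent W k i j).indicator
      (fun q => h (configData k i j q))
      (fun i => H.rsu i ω, (fun i => H.parent i ω', fun i => H.mark i ω')) ∂P)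

end IsPlatooned

end Highway

/-! ### Uniform laws, change of variables, and the law of the cell length. -/

/-- The uniform distribution on `[-r, r]`. -/
noncomputable def symmUniform (r : ℝ) : Measure ℝ := cond volume (Set.Icc (-r) r)

lemma isProbabilityMeasure_symmUniform {r : ℝ} (hr : 0 < r) :
    IsProbabilityMeasure (symmUniform r) := by
  refine cond_isProbabilityMeasure_of_finite ?_ ?_
  · rw [Real.volume_Icc]
    simpa using hr
  · rw [Real.volume_Icc]
    exact ENNReal.ofReal_ne_top

lemma lintegral_symmUniform (r : ℝ) (f : ℝ → ℝ≥0∞) :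
    ∫⁻ x, f x ∂symmUniform r = (ENNReal.ofReal (2 * r))⁻¹ * ∫⁻ x in Set.Icc (-r) r, f x := by
  rw [symmUniform, ProbabilityTheory.cond, lintegral_smul_measure, Real.volume_Icc, smul_eq_mul]
  congr 3
  ring

lemma integral_symmUniform {r : ℝ} (hr : 0 < r) (f : ℝ → ℝ) :
    ∫ x, f x ∂symmUniform r = (2 * r)⁻¹ * ∫ x in (-r)..r, f x := by
  rw [symmUniform, ProbabilityTheory.cond, integral_smul_measure, Real.volume_Icc, smul_eq_mul,
    intervalIntegral.integral_of_le (by linarith), integral_Icc_eq_integral_Ioc,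
    ENNReal.toReal_inv, ENNReal.toReal_ofReal (by linarith)]
  congr 2
  ring

/-- Seen from the typical vehicle, the platoon centre lies at minus the displacement. -/
lemma lintegral_symmUniform_neg (r : ℝ) (f : ℝ → ℝ≥0∞) :
    ∫⁻ x, f (-x) ∂symmUniform r = ∫⁻ x, f x ∂symmUniform r := by
  rw [lintegral_symmUniform, lintegral_symmUniform, ← lintegral_indicator measurableSet_Icc,
    ← lintegral_indicator measurableSet_Icc, ← lintegral_neg_eq_self]
  congr 1
  refine lintegral_congr fun x => ?_
  have : -x ∈ Set.Icc (-r) r ↔ x ∈ Set.Icc (-r) r := by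
    simp only [Set.mem_Icc]
    constructor <;> rintro ⟨h1, h2⟩ <;> constructor <;> linarith
  by_cases hx : x ∈ Set.Icc (-r) r
  · rw [Set.indicator_of_mem hx, Set.indicator_of_mem (this.2 hx), neg_neg]
  · rw [Set.indicator_of_notMem hx, Set.indicator_of_notMem (mt this.1 hx)]

lemma integral_symmUniform_one_comp_mul {r : ℝ} (hr : 0 < r) (f : ℝ → ℝ) :
    ∫ z, f (r * z) ∂symmUniform 1 = (2 * r)⁻¹ * ∫ x in (-r)..r, f x := by
  rw [integral_symmUniform one_pos, intervalIntegral.integral_comp_mul_left f hr.ne']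
  simp only [smul_eq_mul, mul_neg, mul_one, mul_inv]
  ring

lemma lintegral_comp_mul_left_of_pos {r : ℝ} (hr : 0 < r) {f : ℝ → ℝ≥0∞} (hf : Measurable f) :
    ∫⁻ x, f x = ENNReal.ofReal r * ∫⁻ z, f (r * z) := by
  conv_lhs => rw [← Real.smul_map_volume_mul_left hr.ne']
  rw [lintegral_smul_measure, lintegral_map hf (measurable_const_mul r), abs_of_pos hr,
    smul_eq_mul]

/-- Parametrizing the pairs of nonnegative numbers by their sum and their relative
difference. -/
lemma lintegral_quadrant {F : ℝ × ℝ → ℝ≥0∞} (hF : Measurable F) :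
    ∫⁻ b in Set.Ici 0, ∫⁻ c in Set.Ici 0, F (b, c) =
      ∫⁻ t in Set.Ioi 0, ENNReal.ofReal t *
        ∫⁻ z, F (t / 2 - t / 2 * z, t / 2 + t / 2 * z) ∂symmUniform 1 := by
  let g : ℝ × ℝ → ℝ≥0∞ := (Set.Ici 0 ×ˢ Set.Ici 0).indicator F
  have hg : Measurable g := hF.indicator (measurableSet_Ici.prod measurableSet_Ici)
  have h1 : ∫⁻ b in Set.Ici 0, ∫⁻ c in Set.Ici 0, F (b, c) = ∫⁻ b, ∫⁻ c, g (b, c) := by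
    rw [← lintegral_prod g hg.aemeasurable, lintegral_indicator
      (measurableSet_Ici.prod measurableSet_Ici), ← Measure.prod_restrict,
      lintegral_prod F hF.aemeasurable]
  have h2 : ∀ b, ∫⁻ c, g (b, c) = ∫⁻ t, g (b, t - b) := fun b =>
    (lintegral_sub_right_eq_self (fun c => g (b, c)) b).symm
  have hsh : Measurable (Function.uncurry fun b t : ℝ => g (b, t - b)) :=
    hg.comp (f := fun q : ℝ × ℝ => (q.1, q.2 - q.1)) (by fun_prop)
  rw [h1]
  simp_rw [h2]
  rw [lintegral_lintegral_swap hsh.aemeasurable, ← lintegral_indicator measurableSet_Ioi]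
  refine lintegral_congr_ae ?_
  filter_upwards [compl_mem_ae_iff.2 (measure_singleton (0 : ℝ) : volume {(0 : ℝ)} = 0)]
    with t ht
  rcases lt_or_gt_of_ne ht with ht | ht
  · rw [Set.indicator_of_notMem (by simpa using ht.le), lintegral_eq_zero_iff' (by fun_prop)]
    refine Eventually.of_forall fun b => Set.indicator_of_notMem ?_ _
    rintro ⟨h3, h4⟩
    simp only [Set.mem_Ici] at h3 h4
    linarith
  · rw [Set.indicator_of_mem (Set.mem_Ioi.2 ht)]
    have h5 : ∫⁻ b, g (b, t - b) = ∫⁻ x, g (t / 2 - x, t / 2 + x) := by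
      rw [← lintegral_sub_left_eq_self _ (t / 2)]
      refine lintegral_congr fun x => ?_
      congr 2
      ring
    have h6 : Measurable fun x => g (t / 2 - x, t / 2 + x) := by fun_prop
    rw [h5, lintegral_comp_mul_left_of_pos (half_pos ht) h6, lintegral_symmUniform, ← mul_assoc,
      ← lintegral_indicator measurableSet_Icc]
    -- The factor `t` is the Jacobian `t / 2` of the scaling divided by the uniform density `1 / 2`
    -- on `[-1, 1]`.
    congr 1
    · rw [← ENNReal.ofReal_inv_of_pos (by norm_num), ← ENNReal.ofReal_mul ht.le]
      congr 1
      ring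
    · refine lintegral_congr fun z => ?_
      have ht2 := half_pos ht
      by_cases hz : z ∈ Set.Icc (-1 : ℝ) 1
      · rw [Set.indicator_of_mem hz]
        have hm : (t / 2 - t / 2 * z, t / 2 + t / 2 * z) ∈
            Set.Ici (0 : ℝ) ×ˢ Set.Ici (0 : ℝ) := by
          refine ⟨?_, ?_⟩
          · show (0 : ℝ) ≤ t / 2 - t / 2 * z
            nlinarith [hz.2]
          · show (0 : ℝ) ≤ t / 2 + t / 2 * z
            nlinarith [hz.1]
        exact Set.indicator_of_mem hm F
      · rw [Set.indicator_of_notMem hz]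
        refine Set.indicator_of_notMem ?_ _
        rintro ⟨h7, h8⟩
        simp only [Set.mem_Ici] at h7 h8
        refine hz ⟨?_, ?_⟩
        · by_contra h
          push Not at h
          nlinarith
        · by_contra h
          push Not at h
          nlinarith

/-- The law of the length of the tagged cell. -/
noncomputable def lengthLaw (lam : ℝ) : Measure ℝ :=
  (volume.restrict (Set.Ioi 0)).withDensity fun t => ENNReal.ofReal (taggedLengthDensity lam t)

lemma measurable_taggedLengthDensity (lam : ℝ) : Measurable (taggedLengthDensity lam) := by
  unfold taggedLengthDensity
  fun_prop

lemma taggedLengthDensity_nonneg {lam : ℝ} (hlam : 0 < lam) (t : ℝ) :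
    0 ≤ taggedLengthDensity lam t := by
  unfold taggedLengthDensity
  positivity

/-- This is the Gamma law of shape `3` and rate `2 * lam`; the constant is `(2 * lam) ^ 3 / Γ(3) = 4
* lam ^ 3`. -/
lemma isProbabilityMeasure_lengthLaw {lam : ℝ} (hlam : 0 < lam) :
    IsProbabilityMeasure (lengthLaw lam) := by
  constructor
  rw [lengthLaw, withDensity_apply _ .univ, Measure.restrict_univ,
    ← lintegral_gammaPDF_eq_one (a := 3) (r := 2 * lam) (by norm_num) (by linarith),
    ← lintegral_indicator measurableSet_Ioi]
  refine lintegral_congr_ae ?_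
  filter_upwards [compl_mem_ae_iff.2 (measure_singleton (0 : ℝ) : volume {(0 : ℝ)} = 0)]
    with t ht
  rcases lt_or_gt_of_ne ht with ht | ht
  · rw [Set.indicator_of_notMem (by simpa using ht.le), gammaPDF_of_neg ht]
  · rw [Set.indicator_of_mem (Set.mem_Ioi.2 ht), gammaPDF_of_nonneg ht.le, taggedLengthDensity]
    congr 1
    have h1 : Real.Gamma 3 = 2 := by
      rw [show (3 : ℝ) = (2 : ℕ) + 1 by norm_num, Real.Gamma_nat_eq_factorial]
      norm_num
    rw [h1, show (3 : ℝ) - 1 = (2 : ℕ) by norm_num, Real.rpow_natCast,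
      show (3 : ℝ) = (3 : ℕ) by norm_num, Real.rpow_natCast,
      show -2 * lam * t = -(2 * lam * t) by ring]
    ring

lemma abs_pow_le_one {u : ℝ} (hu : |u| ≤ 1) (n : ℕ) : ‖u ^ n‖ ≤ 1 := by
  rw [norm_pow, Real.norm_eq_abs]
  exact pow_le_one₀ (abs_nonneg u) hu

lemma setIntegral_lengthLaw {lam : ℝ} (hlam : 0 < lam) {A : Set ℝ} (hA : MeasurableSet A)
    (f : ℝ → ℝ) : ∫ t in A, f t ∂lengthLaw lam =
      ∫ t in A ∩ Set.Ioi 0, f t * taggedLengthDensity lam t := by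
  rw [lengthLaw, restrict_withDensity hA, Measure.restrict_restrict hA,
    integral_withDensity_eq_integral_toReal_smul
      (measurable_taggedLengthDensity lam).ennreal_ofReal
      (Eventually.of_forall fun _ => ENNReal.ofReal_lt_top)]
  refine integral_congr_ae (Eventually.of_forall fun t => ?_)
  simp only [ENNReal.toReal_ofReal (taggedLengthDensity_nonneg hlam t), smul_eq_mul]
  ring

/-! ### The joint Palm law of the cell length and the two loads. -/

namespace Highway

variable {Ω : Type*} {H : Highway Ω} [MeasurableSpace Ω] {P : Measure Ω} {lam : ℝ} {W : Set ℝ}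
  {β γ : Type*} [MeasurableSpace β] [MeasurableSpace γ]

lemma lintegral_palmLaw {F : ℕ × ℕ → Ω → β} (hF : ∀ p, Measurable (F p)) {h : β → ℝ≥0∞}
    (hh : Measurable h) : ∫⁻ x, h x ∂H.palmLaw P lam W F = (ENNReal.ofReal lam * volume W)⁻¹ *
      ∑' p, ∫⁻ ω in {ω | p ∈ H.vehicles ω ∧ H.pos p ω ∈ W}, h (F p ω) ∂P := by
  rw [palmLaw, lintegral_smul_measure, lintegral_sum_measure, smul_eq_mul]
  simp_rw [lintegral_map hh (hF _)]

lemma map_palmLaw {F : ℕ × ℕ → Ω → β} (hF : ∀ p, Measurable (F p)) {g : β → γ}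
    (hg : Measurable g) :
    (H.palmLaw P lam W F).map g = H.palmLaw P lam W fun p ω => g (F p ω) := by
  refine Measure.ext_of_lintegral _ fun h hh => ?_
  rw [lintegral_map hh hg, lintegral_palmLaw (h := fun x => h (g x)) hF (hh.comp hg),
    lintegral_palmLaw (F := fun p ω => g (F p ω)) (fun p => hg.comp (hF p)) hh]

lemma palmLaw_congr {F G : ℕ × ℕ → Ω → β} (h : ∀ᵐ ω ∂P, ∀ p, F p ω = G p ω) :
    H.palmLaw P lam W F = H.palmLaw P lam W G := by
  rw [palmLaw, palmLaw]
  congr 2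
  funext p
  exact Measure.map_congr (ae_restrict_of_ae (h.mono fun ω hω => hω p))

/-- The length of the tagged cell, and the two loads, as functions of the length `t` of the cell,
the position `x` of the tagged platoon relative to the typical vehicle, the relative position `z` of
the typical vehicle in its cell, and the tagged platoon and the other platoons. -/
noncomputable def tripleMap (H : Highway Ω) (q : ℝ × ℝ × ℝ × Ω × Ω) : ℝ × ℕ × ℕ :=
  (q.1, H.count (Metric.closedBall 0 (q.1 / 2)) q.2.2.2.2,
    platoonCount (Metric.closedBall (q.1 / 2 * q.2.2.1) (q.1 / 2)) (q.2.1, H.mark 0 q.2.2.2.1))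

/-- The law of the variables on which `tripleMap` depends. -/
noncomputable def tripleSource (P : Measure Ω) (lamR a : ℝ) : Measure (ℝ × ℝ × ℝ × Ω × Ω) :=
  (lengthLaw lamR).prod ((symmUniform a).prod ((symmUniform 1).prod (P.prod P)))

variable [IsProbabilityMeasure P] {lamR lamP m a : ℝ}

lemma isProbabilityMeasure_tripleSource (hlamR : 0 < lamR) (ha : 0 < a) :
    IsProbabilityMeasure (tripleSource P lamR a) := by
  have := isProbabilityMeasure_lengthLaw hlamR
  have := isProbabilityMeasure_symmUniform ha
  have := isProbabilityMeasure_symmUniform one_pos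
  unfold tripleSource
  infer_instance

/-- Writing the interval centre as `r * z` with `z` uniform on `[-1, 1]` makes its source
independent of the length, hence a factor of `tripleSource`. -/
lemma pgfV_eq (ha : 0 < a) {r : ℝ} (hr : 0 < r) (s : ℝ) :
    H.pgfV P a r s = ∫ x, ∫ z, ∫ ω,
      s ^ platoonCount (Metric.closedBall (r * z) r) (x, H.mark 0 ω) ∂P ∂symmUniform 1
        ∂symmUniform a := by
  rw [integral_symmUniform ha, pgfV]
  congr 2
  funext x
  exact (integral_symmUniform_one_comp_mul hr fun c =>
    ∫ ω, s ^ platoonCount (Metric.closedBall c r) (x, H.mark 0 ω) ∂P).symm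

namespace IsPlatooned

lemma measurable_platoonCount_closedBall (hH : H.IsPlatooned P lamR lamP m a) :
    Measurable fun q : (ℝ × ℝ) × ℝ × Ω =>
      platoonCount (Metric.closedBall q.1.1 q.1.2) (q.2.1, H.mark 0 q.2.2) := by
  have hm := hH.measurable_mark 0
  have h := measurable_platoonCount_Icc.comp (f := fun q : (ℝ × ℝ) × ℝ × Ω =>
    ((q.1.2 - q.1.1, q.1.1 + q.1.2), (q.2.1, H.mark 0 q.2.2))) (by fun_prop)
  simp_rw [Real.closedBall_eq_Icc]
  convert h using 3
  simp

lemma measurable_tripleMap (hH : H.IsPlatooned P lamR lamP m a) : Measurable H.tripleMap := by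
  refine measurable_fst.prodMk (Measurable.prodMk ?_ ?_)
  · exact hH.measurable_count_closedBall.comp (f := fun q : ℝ × ℝ × ℝ × Ω × Ω =>
      (q.1 / 2, q.2.2.2.2)) (by fun_prop)
  · exact hH.measurable_platoonCount_closedBall.comp (f := fun q : ℝ × ℝ × ℝ × Ω × Ω =>
      ((q.1 / 2 * q.2.2.1, q.1 / 2), (q.2.1, q.2.2.2.1))) (by fun_prop)

lemma lintegral_neg_disp (hH : H.IsPlatooned P lamR lamP m a) {f : ℝ → ℝ≥0∞}
    (hf : Measurable f) : ∫⁻ ω, f (-H.disp 0 0 ω) ∂P = ∫⁻ x, f x ∂symmUniform a := by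
  rw [← lintegral_map (f := fun x => f (-x)) (hf.comp measurable_neg) (hH.measurable_disp 0 0),
    hH.disp_law 0 0]
  exact lintegral_symmUniform_neg a f

/-- `cellDensity` depends on `t = b + c` only, so given `t` the relative position in the cell is
uniform. The weight `t` of `lintegral_quadrant` turns `4 λ³ t exp(-2 λ t)` into
`taggedLengthDensity`. -/
lemma lintegral_cellDensity_mul_cellIntegral (hH : H.IsPlatooned P lamR lamP m a)
    (hlamR : 0 < lamR) (ha : 0 < a) {h : ℝ × ℕ × ℕ → ℝ≥0∞} (hh : Measurable h) :
    ∫⁻ b in Set.Ici 0, ∫⁻ c in Set.Ici 0,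
        ENNReal.ofReal (cellDensity lamR b c) * cellIntegral H P h (b, c) =
      ∫⁻ q, h (H.tripleMap q) ∂tripleSource P lamR a := by
  have := isProbabilityMeasure_lengthLaw hlamR
  have := isProbabilityMeasure_symmUniform ha
  have := isProbabilityMeasure_symmUniform one_pos
  have hK : Measurable fun q => h (H.tripleMap q) := hh.comp hH.measurable_tripleMap
  have hdens : Measurable fun q : ℝ × ℝ => ENNReal.ofReal (cellDensity lamR q.1 q.2) := by
    unfold cellDensity
    fun_prop
  have hF : Measurable fun q : ℝ × ℝ =>
      ENNReal.ofReal (cellDensity lamR q.1 q.2) * cellIntegral H P h q :=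
    hdens.mul (hH.measurable_cellIntegral hh)
  have hΦ : Measurable fun t => ∫⁻ y, h (H.tripleMap (t, y))
      ∂((symmUniform a).prod ((symmUniform 1).prod (P.prod P))) := hK.lintegral_prod_right'
  rw [lintegral_quadrant hF, tripleSource, lintegral_prod _ hK.aemeasurable, lengthLaw,
    lintegral_withDensity_eq_lintegral_mul _
      (measurable_taggedLengthDensity lamR).ennreal_ofReal hΦ]
  refine setLIntegral_congr_fun measurableSet_Ioi fun t ht => ?_
  rw [Set.mem_Ioi] at ht
  have h1 : ∀ z, ENNReal.ofReal (cellDensity lamR (t / 2 - t / 2 * z) (t / 2 + t / 2 * z)) *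
      cellIntegral H P h (t / 2 - t / 2 * z, t / 2 + t / 2 * z) =
      ENNReal.ofReal (4 * lamR ^ 3 * t * Real.exp (-2 * lamR * t)) *
        ∫⁻ x, ∫⁻ ω', ∫⁻ ω, h (H.tripleMap (t, x, z, ω', ω)) ∂P ∂P ∂symmUniform a := by
    intro z
    have ht2 : t / 2 - t / 2 * z + (t / 2 + t / 2 * z) = t := by ring
    have hball : Set.Icc (-(t / 2 - t / 2 * z)) (t / 2 + t / 2 * z) =
        Metric.closedBall (t / 2 * z) (t / 2) := by
      rw [Real.closedBall_eq_Icc]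
      congr 1 <;> ring
    congr 1
    · rw [cellDensity, ht2]
      congr 3
      ring
    · rw [cellIntegral]
      dsimp only
      rw [ht2, hball]
      refine hH.lintegral_neg_disp (f := fun x => ∫⁻ ω', ∫⁻ ω,
        h (H.tripleMap (t, x, z, ω', ω)) ∂P ∂P) ?_
      exact (hK.comp (f := fun q : (ℝ × Ω) × Ω => (t, q.1.1, z, q.1.2, q.2))
        (by fun_prop)).lintegral_prod_right'.lintegral_prod_right'
  have h2 : Measurable (Function.uncurry fun z x => ∫⁻ ω', ∫⁻ ω,
      h (H.tripleMap (t, x, z, ω', ω)) ∂P ∂P) :=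
    (hK.comp (f := fun q : ((ℝ × ℝ) × Ω) × Ω => (t, q.1.1.2, q.1.1.1, q.1.2, q.2))
      (by fun_prop)).lintegral_prod_right'.lintegral_prod_right'
  have h3 : ∫⁻ y, h (H.tripleMap (t, y)) ∂((symmUniform a).prod
      ((symmUniform 1).prod (P.prod P))) = ∫⁻ x, ∫⁻ z, ∫⁻ ω', ∫⁻ ω,
        h (H.tripleMap (t, x, z, ω', ω)) ∂P ∂P ∂symmUniform 1 ∂symmUniform a := by
    have h4 : Measurable fun y => h (H.tripleMap (t, y)) := hK.comp measurable_prodMk_left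
    rw [lintegral_prod _ h4.aemeasurable]
    refine lintegral_congr fun x => ?_
    have h5 : Measurable fun y => h (H.tripleMap (t, x, y)) := h4.comp measurable_prodMk_left
    rw [lintegral_prod _ h5.aemeasurable]
    refine lintegral_congr fun z => ?_
    have h6 : Measurable fun y => h (H.tripleMap (t, x, z, y)) := h5.comp measurable_prodMk_left
    rw [lintegral_prod _ h6.aemeasurable]
  simp_rw [h1]
  rw [lintegral_const_mul' _ _ ENNReal.ofReal_ne_top, lintegral_lintegral_swap h2.aemeasurable,
    Pi.mul_apply, h3, ← mul_assoc, ← ENNReal.ofReal_mul ht.le, taggedLengthDensity]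
  congr 2
  ring

/-- The joint law of the length of the tagged cell and of the two contributions to the tagged
load. -/
lemma palmLaw_triple (hH : H.IsPlatooned P lamR lamP m a) (hlamR : 0 < lamR) (hlamP : 0 < lamP)
    (hm : 0 < m) (ha : 0 < a) (hW : MeasurableSet W) (hWb : Bornology.IsBounded W)
    (hW0 : volume W ≠ 0) :
    H.palmLaw P (m * lamP) W (fun p ω =>
        (H.taggedLength p ω, H.otherPlatoonsLoad p ω, H.ownPlatoonLoad p ω)) =
      (tripleSource P lamR a).map H.tripleMap := by
  refine Measure.ext_of_lintegral _ fun h hh => ?_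
  have hF : ∀ p, Measurable fun ω =>
      (H.taggedLength p ω, H.otherPlatoonsLoad p ω, H.ownPlatoonLoad p ω) := fun p =>
    (hH.measurable_taggedLength p).prodMk
      ((hH.measurable_otherPlatoonsLoad p).prodMk (hH.measurable_ownPlatoonLoad p))
  have hWt : volume W ≠ ∞ := hWb.measure_lt_top.ne
  rw [lintegral_palmLaw hF hh, lintegral_map hh hH.measurable_tripleMap,
    hH.tsum_lintegral_tagged hlamR hW hh,
    hH.lintegral_cellDensity_mul_cellIntegral hlamR ha hh, ENNReal.ofReal_mul hm.le,
    ← mul_assoc (ENNReal.ofReal lamP), ← mul_assoc (ENNReal.ofReal lamP * _),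
    mul_comm (ENNReal.ofReal lamP), ← mul_assoc, ENNReal.inv_mul_cancel, one_mul]
  · exact mul_ne_zero (mul_ne_zero (by simpa using hm) (by simpa using hlamP)) hW0
  · exact ENNReal.mul_ne_top (ENNReal.mul_ne_top ENNReal.ofReal_ne_top ENNReal.ofReal_ne_top) hWt

/-- For fixed `t`, `x`, `z` the loads depend on different coordinates of `P.prod P`, and the load of
the other platoons does not involve `x` or `z`; hence the integral factors. -/
lemma integral_tripleMap (hH : H.IsPlatooned P lamR lamP m a) (ha : 0 < a) {t : ℝ} (ht : 0 < t)
    {u v : ℝ} (hu : |u| ≤ 1) (hv : |v| ≤ 1) :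
    ∫ y, u ^ (H.tripleMap (t, y)).2.1 * v ^ (H.tripleMap (t, y)).2.2
        ∂((symmUniform a).prod ((symmUniform 1).prod (P.prod P))) =
      H.pgfS P (t / 2) u * H.pgfV P a (t / 2) v := by
  have := isProbabilityMeasure_symmUniform ha
  have := isProbabilityMeasure_symmUniform one_pos
  have hφ : Measurable fun q : ℝ × ℕ × ℕ => u ^ q.2.1 * v ^ q.2.2 :=
    ((Measurable.of_discrete (f := fun n : ℕ => u ^ n)).comp
      (measurable_fst.comp measurable_snd)).mul
    ((Measurable.of_discrete (f := fun n : ℕ => v ^ n)).comp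
      (measurable_snd.comp measurable_snd))
  have h1 : Measurable fun y => u ^ (H.tripleMap (t, y)).2.1 * v ^ (H.tripleMap (t, y)).2.2 :=
    (hφ.comp hH.measurable_tripleMap).comp measurable_prodMk_left
  have hb : ∀ y, ‖u ^ (H.tripleMap (t, y)).2.1 * v ^ (H.tripleMap (t, y)).2.2‖ ≤ 1 := fun y => by
    rw [norm_mul]
    exact mul_le_one₀ (abs_pow_le_one hu _) (norm_nonneg _) (abs_pow_le_one hv _)
  rw [pgfV_eq ha (half_pos ht), integral_prod _
    (Integrable.of_bound h1.aestronglyMeasurable 1 (Eventually.of_forall hb)),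
    ← integral_const_mul]
  refine integral_congr_ae (Eventually.of_forall fun x => ?_)
  have h2 : Measurable fun y => u ^ (H.tripleMap (t, x, y)).2.1 * v ^ (H.tripleMap (t, x, y)).2.2 :=
    h1.comp measurable_prodMk_left
  dsimp only
  rw [integral_prod _ (Integrable.of_bound h2.aestronglyMeasurable 1
    (Eventually.of_forall fun y => hb (x, y))), ← integral_const_mul]
  refine integral_congr_ae (Eventually.of_forall fun z => ?_)
  dsimp only
  refine (integral_congr_ae (Eventually.of_forall fun y => mul_comm _ _)).trans ?_
  rw [mul_comm (H.pgfS P (t / 2) u)]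
  exact integral_prod_mul
    (fun ω => v ^ platoonCount (Metric.closedBall (t / 2 * z) (t / 2)) (x, H.mark 0 ω))
    (fun ω => u ^ H.count (Metric.closedBall 0 (t / 2)) ω)

lemma setIntegral_map_tripleMap (hH : H.IsPlatooned P lamR lamP m a) (hlamR : 0 < lamR)
    (ha : 0 < a) {A : Set ℝ} (hA : MeasurableSet A) {u v : ℝ} (hu : |u| ≤ 1) (hv : |v| ≤ 1) :
    ∫ q in A ×ˢ Set.univ, u ^ q.2.1 * v ^ q.2.2 ∂(tripleSource P lamR a).map H.tripleMap =
      ∫ t in A ∩ Set.Ioi 0,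
        H.pgfS P (t / 2) u * H.pgfV P a (t / 2) v * taggedLengthDensity lamR t := by
  have := isProbabilityMeasure_lengthLaw hlamR
  have := isProbabilityMeasure_symmUniform ha
  have := isProbabilityMeasure_symmUniform one_pos
  have hφ : Measurable fun q : ℝ × ℕ × ℕ => u ^ q.2.1 * v ^ q.2.2 :=
    ((Measurable.of_discrete (f := fun n : ℕ => u ^ n)).comp
      (measurable_fst.comp measurable_snd)).mul
    ((Measurable.of_discrete (f := fun n : ℕ => v ^ n)).comp
      (measurable_snd.comp measurable_snd))
  have hpre : H.tripleMap ⁻¹' (A ×ˢ Set.univ) = A ×ˢ Set.univ := by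
    ext q
    simp [tripleMap]
  have hint : Integrable (fun q => u ^ (H.tripleMap q).2.1 * v ^ (H.tripleMap q).2.2)
      ((lengthLaw lamR).prod ((symmUniform a).prod ((symmUniform 1).prod (P.prod P)))) := by
    refine Integrable.of_bound (hφ.comp hH.measurable_tripleMap).aestronglyMeasurable 1
      (Eventually.of_forall fun q => ?_)
    rw [norm_mul]
    exact mul_le_one₀ (abs_pow_le_one hu _) (norm_nonneg _) (abs_pow_le_one hv _)
  rw [setIntegral_map (hA.prod .univ) hφ.aestronglyMeasurable
    hH.measurable_tripleMap.aemeasurable, hpre, tripleSource,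
    setIntegral_prod _ hint.integrableOn, Measure.restrict_univ, setIntegral_lengthLaw hlamR hA]
  refine setIntegral_congr_fun (hA.inter measurableSet_Ioi) fun t ht => ?_
  rw [← hH.integral_tripleMap ha ht.2 hu hv]

end IsPlatooned

end Highway

theorem theorem4 {Ω : Type*} [MeasurableSpace Ω] (P : Measure Ω) [IsProbabilityMeasure P]
    (lamR lamP m a : ℝ) (hlamR : 0 < lamR) (hlamP : 0 < lamP) (hm : 0 < m) (ha : 0 < a)
    (H : Highway Ω) (hH : H.IsPlatooned P lamR lamP m a)
    (W : Set ℝ) (hW : MeasurableSet W) (hWb : Bornology.IsBounded W) (hW0 : volume W ≠ 0) :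
    -- the tagged load has a probability law, with the claimed generating function
    IsProbabilityMeasure (H.palmLaw P (m * lamP) W H.taggedLoad) ∧
    (∀ s : ℝ, |s| ≤ 1 →
      ∫ n, s ^ n ∂(H.palmLaw P (m * lamP) W H.taggedLoad) =
        ∫ t in Set.Ioi 0,
          H.pgfS P (t / 2) s * H.pgfV P a (t / 2) s * taggedLengthDensity lamR t) ∧
    -- the tagged cell length has the stated density
    H.palmLaw P (m * lamP) W H.taggedLength =
      (volume.restrict (Set.Ioi 0)).withDensity
        (fun t => ENNReal.ofReal (taggedLengthDensity lamR t)) ∧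
    -- the load is the sum of the contributions of the other platoons and of the tagged platoon
    (∀ᵐ ω ∂P, ∀ p ∈ H.vehicles ω,
      H.taggedLoad p ω = H.otherPlatoonsLoad p ω + H.ownPlatoonLoad p ω) ∧
    -- given that the tagged cell has length `t`, these two contributions are independent, with
    -- generating functions `H.pgfS P (t / 2)` and `H.pgfV P a (t / 2)`
    (∀ A : Set ℝ, MeasurableSet A → ∀ u v : ℝ, |u| ≤ 1 → |v| ≤ 1 →
      ∫ q in A ×ˢ Set.univ, u ^ q.2.1 * v ^ q.2.2
          ∂(H.palmLaw P (m * lamP) W fun p ω =>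
            (H.taggedLength p ω, H.otherPlatoonsLoad p ω, H.ownPlatoonLoad p ω)) =
        ∫ t in A ∩ Set.Ioi 0,
          H.pgfS P (t / 2) u * H.pgfV P a (t / 2) v * taggedLengthDensity lamR t) := by
  have hT := hH.palmLaw_triple hlamR hlamP hm ha hW hWb hW0
  have hF : ∀ p, Measurable fun ω =>
      (H.taggedLength p ω, H.otherPlatoonsLoad p ω, H.ownPlatoonLoad p ω) := fun p =>
    (hH.measurable_taggedLength p).prodMk
      ((hH.measurable_otherPlatoonsLoad p).prodMk (hH.measurable_ownPlatoonLoad p))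
  have := Highway.isProbabilityMeasure_tripleSource (P := P) hlamR ha
  have := Measure.isProbabilityMeasure_map (μ := Highway.tripleSource P lamR a)
    hH.measurable_tripleMap.aemeasurable
  have hadd : Measurable fun q : ℝ × ℕ × ℕ => q.2.1 + q.2.2 := by fun_prop
  -- The almost sure splitting of the load makes its law an image of the joint law `hT`.
  have hload : H.palmLaw P (m * lamP) W H.taggedLoad =
      ((Highway.tripleSource P lamR a).map H.tripleMap).map fun q => q.2.1 + q.2.2 := by
    rw [← hT, Highway.map_palmLaw hF hadd]
    exact Highway.palmLaw_congr (hH.ae_taggedLoad_eq_add hlamR)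
  refine ⟨?_, fun s hs => ?_, ?_, ?_, fun A hA u v hu hv => ?_⟩
  · rw [hload]
    exact Measure.isProbabilityMeasure_map hadd.aemeasurable
  · rw [hload, integral_map hadd.aemeasurable (by fun_prop)]
    simp_rw [pow_add]
    have h := hH.setIntegral_map_tripleMap hlamR ha MeasurableSet.univ hs hs
    rwa [Set.univ_prod_univ, Measure.restrict_univ, Set.univ_inter] at h
  -- The length is the first coordinate of a product of probability measures, so its marginal is
  -- `lengthLaw`.
  · have h := congrArg (Measure.map Prod.fst) hT
    rw [Highway.map_palmLaw hF measurable_fst,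
      Measure.map_map measurable_fst hH.measurable_tripleMap] at h
    refine h.trans ?_
    have := isProbabilityMeasure_symmUniform ha
    have := isProbabilityMeasure_symmUniform one_pos
    have := isProbabilityMeasure_lengthLaw hlamR
    exact Measure.map_fst_prod.trans (by rw [measure_univ, one_smul, lengthLaw])
  · filter_upwards [hH.ae_taggedLoad_eq_add hlamR] with ω hω p _ using hω p
  · rw [hT]
    exact hH.setIntegral_map_tripleMap hlamR ha hA hu hv
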